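/- Let $d\ge 1$, let $\Omega\subset\mathbb R^d$ be a bounded Lipschitz domain (open, connected, non-empty), and let $0<r<1$. For $x\in\mathbb R^d$ let $D(x)=D_x\in\mathbb R^{d\times d}$ be invertible, with $D$ and $x\mapsto D_x^{-1}$ Lipschitz continuous on $\mathbb R^d$ and $0<D_1\le|\det D_x|\le D_2<\infty$ for $x\in\overline\Omega$. Put $Y=[0,1]^d$ and $Y_x=D_xY$. Spaces of functions of $(x,y)$, $x\in\Omega$, $y\in Y_x$, are obtained from those over $Y$ by $\psi(x,y)=\tilde\psi(x,D_x^{-1}y)$; in particular $\psi\in L^2(\Omega;C_{\mathrm{per}}(Y_x))$ means $\tilde\psi\in L^2(\Omega;C_{\mathrm{per}}(Y))$, where $C_{\mathrm{per}}(Y)$ is the space of continuous $\mathbb Z^d$-periodic functions with the supremum norm. For every $\varepsilon>0$ let $\Omega_1^\varepsilon,\dots,\Omega_{N_\varepsilon}^\varepsilon$ be pairwise disjoint open cubes of side $\varepsilon^r$, each meeting $\Omega$, with $\Omega\subset\bigcup_n\overline{\Omega_n^\varepsilon}$, and choose points $x_n^\varepsilon\in\Omega_n^\varepsilon\cap\Omega$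 and $\tilde x_n^\varepsilon\in\mathbb R^d$ arbitrarily. The locally periodic approximation of $\psi$ is $$(\mathcal L^\varepsilon\psi)(x)=\sum_{n=1}^{N_\varepsilon}\tilde\psi\Big(x,\frac{D_{x_n^\varepsilon}^{-1}(x-\tilde x_n^\varepsilon)}{\varepsilon}\Big)\chi_{\Omega_n^\varepsilon}(x),\qquad x\in\Omega .$$ With these choices fixed, a family $v^\varepsilon\in L^2(\Omega)$ converges locally-periodic two-scale (l-t-s) to $v\in L^2(\Omega;L^2(Y_x))$ if for every $\psi\in L^2(\Omega;C_{\mathrm{per}}(Y_x))$ $$\lim_{\varepsilon\to0}\int_\Omega v^\varepsilon(x)\,\mathcal L^\varepsilon\psi(x)\,dx=\int_\Omega\frac1{|Y_x|}\int_{Y_x}v(x,y)\,\psi(x,y)\,dy\,dx ;$$ vector-valued families are treated componentwise. Theorem. Let $\{u^\varepsilon\}_{\varepsilon>0}$ be bounded in $H^1(\Omega)$ and converge weakly in $H^1(\Omega)$ to $u$ as $\varepsilon\to0$. Then: (i) the whole family $u^\varepsilon$ converges l-t-s to $u$ (regarded as independent of $y$) as $\varepsilon\to0$; (ii) every sequence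 $\varepsilon_j\to0^+$ has a subsequence along which $\nabla u^\varepsilon$ converges l-t-s to $\nabla u+\nabla_yu_1$ for some $u_1\in L^2(\Omega;H^1_{\mathrm{per}}(Y_x)/\mathbb R)$. -/

import Mathlib

open MeasureTheory Set Filter Topology

open scoped ContDiff

namespace LTS

noncomputable section

/-- Euclidean space `ℝ^d`. -/
abbrev E (d : ℕ) : Type := EuclideanSpace ℝ (Fin d)

/-! ### Lipschitz domains and the Sobolev space `H¹` -/

/-- A bounded Lipschitz domain: bounded, open, connected, non-empty, and near each boundary point,
in suitable orthonormal coordinates (`ν` being the last coordinate direction), the set of points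
above the graph of a Lipschitz function of the remaining coordinates. -/
structure IsLipschitzDomain {d : ℕ} (Ω : Set (E d)) : Prop where
  isOpen : IsOpen Ω
  isConnected : IsConnected Ω
  isBounded : Bornology.IsBounded Ω
  lipschitz_boundary : ∀ p ∈ frontier Ω, ∃ ν : E d, ‖ν‖ = 1 ∧
    ∃ (K : NNReal) (g : E d → ℝ), LipschitzWith K g ∧ ∃ U ∈ 𝓝 p, ∀ x ∈ U,
      (x ∈ Ω ↔ g (x - inner ℝ ν x • ν) < inner ℝ ν x)

/-- `g` is the weak (distributional) gradient of `u` on the open set `Ω`. -/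
structure HasWeakGrad {d : ℕ} (Ω : Set (E d)) (u : E d → ℝ) (g : E d → E d) : Prop where
  locallyIntegrable : LocallyIntegrableOn u Ω
  locallyIntegrable_grad : LocallyIntegrableOn g Ω
  integral_eq : ∀ φ : E d → ℝ, ContDiff ℝ ∞ φ → HasCompactSupport φ → tsupport φ ⊆ Ω →
    ∫ x in Ω, u x • gradient φ x = -∫ x in Ω, φ x • g x

/-- `u ∈ H¹(Ω)`, with weak gradient `g` (which `u` determines almost everywhere on `Ω`). -/
structure IsH1 {d : ℕ} (Ω : Set (E d)) (u : E d → ℝ) (g : E d → E d) : Prop where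
  memLp : MemLp u 2 (volume.restrict Ω)
  memLp_grad : MemLp g 2 (volume.restrict Ω)
  hasWeakGrad : HasWeakGrad Ω u g

/-- The scalar product of `H¹(Ω)`, of the functions `u`, `v` with weak gradients `g`, `h`. -/
def innerH1 {d : ℕ} (Ω : Set (E d)) (u : E d → ℝ) (g : E d → E d) (v : E d → ℝ) (h : E d → E d) :
    ℝ :=
  ∫ x in Ω, (u x * v x + inner ℝ (g x) (h x))

/-- Weak convergence `u ε ⇀ u₀` in the Hilbert space `H¹(Ω)` along the filter `l`. -/
def TendstoWeaklyH1 {d : ℕ} (Ω : Set (E d)) (l : Filter ℝ)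
    (u : ℝ → E d → ℝ) (g : ℝ → E d → E d) (u₀ : E d → ℝ) (g₀ : E d → E d) : Prop :=
  ∀ (v : E d → ℝ) (h : E d → E d), IsH1 Ω v h →
    Tendsto (fun ε => innerH1 Ω (u ε) (g ε) v h) l (𝓝 (innerH1 Ω u₀ g₀ v h))

/-! ### Space-dependent periodicity -/

/-- The standing assumptions on the field of invertible matrices `D`: both `D` and its inverse are
Lipschitz continuous on `ℝ^d`, and `|det D|` lies between two positive constants on `closure Ω`. -/
structure IsTransformation {d : ℕ} (Ω : Set (E d)) (D : E d → (E d ≃L[ℝ] E d)) : Prop where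
  lipschitz : ∃ K : NNReal, LipschitzWith K (fun x => (D x : E d →L[ℝ] E d))
  lipschitz_inv : ∃ K : NNReal, LipschitzWith K (fun x => ((D x).symm : E d →L[ℝ] E d))
  det_bounds : ∃ D₁ D₂ : ℝ, 0 < D₁ ∧ ∀ x ∈ closure Ω,
    D₁ ≤ |(D x : E d →L[ℝ] E d).det| ∧ |(D x : E d →L[ℝ] E d).det| ≤ D₂

/-- The unit cell `Y = [0,1]^d`. -/
def unitCell (d : ℕ) : Set (E d) := {y | ∀ i, y i ∈ Icc (0 : ℝ) 1}

/-- The cell `Y_x = D_x Y`. -/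
def cell {d : ℕ} (D : E d → (E d ≃L[ℝ] E d)) (x : E d) : Set (E d) := D x '' unitCell d

/-- A point of the lattice `ℤ^d`, seen in `ℝ^d`. -/
def latticePt {d : ℕ} (k : Fin d → ℤ) : E d := WithLp.toLp 2 (fun i => (k i : ℝ))

/-- `C_per(Y)` with the supremum norm: the continuous `ℤ^d`-periodic functions on `ℝ^d` are the
continuous functions on the torus `ℝ^d / ℤ^d`. -/
abbrev Cper (d : ℕ) : Type := C(UnitAddTorus (Fin d), ℝ)

/-- The value at `y ∈ ℝ^d` of a `ℤ^d`-periodic continuous function. -/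
def perEval {d : ℕ} (f : Cper d) (y : E d) : ℝ := f (fun i => (y i : UnitAddCircle))

/-- The set of pairs `(x, y)` with `x ∈ Ω` and `y ∈ Y_x`. -/
def cellBundle {d : ℕ} (Ω : Set (E d)) (D : E d → (E d ≃L[ℝ] E d)) : Set (E d × E d) :=
  {p | p.1 ∈ Ω ∧ p.2 ∈ cell D p.1}

/-- `w ∈ L²(Ω; L²(Y_x))`, for `w` with values in `ℝ` or in `ℝ^d`. -/
def IsL2L2 {d : ℕ} {F : Type*} [NormedAddCommGroup F] (Ω : Set (E d))
    (D : E d → (E d ≃L[ℝ] E d)) (w : E d → E d → F) : Prop :=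
  MemLp (fun p : E d × E d => w p.1 p.2) 2 (volume.restrict (cellBundle Ω D))

/-- `w ∈ L²(Ω; H¹_per(Y_x)/ℝ)`, with `∇_y w = G`. A class modulo functions of `x` alone is given by
its representative `w` with mean value zero over each cell. Membership of `w(x, ·)` in `H¹_per(Y_x)`
means that it is `Y_x`-periodic on `ℝ^d`, has a weak gradient on all of `ℝ^d` (no jump
across the faces of the cells), and is square integrable over `Y_x` together with that gradient. -/
structure IsL2H1perModConst {d : ℕ} (Ω : Set (E d)) (D : E d → (E d ≃L[ℝ] E d))
    (w : E d → E d → ℝ) (G : E d → E d → E d) : Prop where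
  isL2 : IsL2L2 Ω D w
  isL2_grad : IsL2L2 Ω D G
  periodic : ∀ᵐ x ∂(volume.restrict Ω), ∀ (k : Fin d → ℤ) (y : E d),
    w x (y + D x (latticePt k)) = w x y
  hasWeakGrad : ∀ᵐ x ∂(volume.restrict Ω), HasWeakGrad univ (w x) (G x)
  mean_zero : ∀ᵐ x ∂(volume.restrict Ω), ∫ y in cell D x, w x y = 0

/-! ### The locally periodic approximation and locally periodic two-scale convergence -/

/-- An open cube of side `s` (in any position). -/
def IsOpenCube {d : ℕ} (s : ℝ) (Q : Set (E d)) : Prop :=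
  ∃ (a : E d) (R : E d ≃ₗᵢ[ℝ] E d), Q = (fun y => a + R y) '' {y | ∀ i, y i ∈ Ioo (0 : ℝ) s}

/-- Finitely many sets `Ω_n` (the cubes), with points `x_n` (`pt`), where the matrix is frozen, and
`x̃_n` (`shift`), the origins of the fast variable. -/
structure CubeFamily (d : ℕ) where
  N : ℕ
  cube : Fin N → Set (E d)
  pt : Fin N → E d
  shift : Fin N → E d

/-- The sets of the family are pairwise disjoint open cubes of side `s`, each of which meets `Ω`,
whose closures cover `Ω`, and `x_n ∈ Ω_n ∩ Ω`. The shifts `x̃_n` are arbitrary. -/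
structure CubeFamily.IsPartition {d : ℕ} (P : CubeFamily d) (Ω : Set (E d)) (s : ℝ) : Prop where
  isOpenCube : ∀ n, IsOpenCube s (P.cube n)
  disjoint : ∀ m n, m ≠ n → Disjoint (P.cube m) (P.cube n)
  inter_nonempty : ∀ n, (P.cube n ∩ Ω).Nonempty
  cover : Ω ⊆ ⋃ n, closure (P.cube n)
  pt_mem : ∀ n, P.pt n ∈ P.cube n ∩ Ω

/-- The locally periodic approximation
`(𝓛^ε ψ)(x) = ∑_n ψ̃(x, D_{x_n}⁻¹ (x - x̃_n) / ε) χ_{Ω_n}(x)` of `ψ(x, y) = ψ̃(x, D_x⁻¹ y)`. -/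
def locPerApprox {d : ℕ} (D : E d → (E d ≃L[ℝ] E d)) (P : CubeFamily d) (ε : ℝ)
    (ψ : E d → Cper d) (x : E d) : ℝ :=
  ∑ n, (P.cube n).indicator
    (fun z => perEval (ψ z) (ε⁻¹ • (D (P.pt n)).symm (z - P.shift n))) x

/-- Locally periodic two-scale convergence of `u ε` to `w ∈ L²(Ω; L²(Y_x))`, as `ε` runs along the
filter `l`. A test function `ψ ∈ L²(Ω; C_per(Y_x))` is `ψ(x, y) = ψ̃(x, D_x⁻¹ y)` with
`ψ̃ ∈ L²(Ω; C_per(Y))`; the variable `ψ` below is `ψ̃`. -/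
structure TendstoLTS {d : ℕ} (Ω : Set (E d)) (D : E d → (E d ≃L[ℝ] E d)) (P : ℝ → CubeFamily d)
    (l : Filter ℝ) (u : ℝ → E d → ℝ) (w : E d → E d → ℝ) : Prop where
  memLp : ∀ᶠ ε in l, MemLp (u ε) 2 (volume.restrict Ω)
  isL2_limit : IsL2L2 Ω D w
  tendsto : ∀ ψ : E d → Cper d, MemLp ψ 2 (volume.restrict Ω) →
    Tendsto (fun ε => ∫ x in Ω, u ε x * locPerApprox D (P ε) ε ψ x) l
      (𝓝 (∫ x in Ω, ⨍ y in cell D x, w x y * perEval (ψ x) ((D x).symm y)))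

end

end LTS

/-!
Functions on the cells `Y_x = D_x Y` are functions on the torus `𝕋^d = ℝ^d / ℤ^d` seen through
`y ↦ D_x⁻¹ y`, and the averages over the cells are integrals for Haar measure (`average_cell`). So
the two-scale limits are functions on `Ω × 𝕋^d`, tested against `ψ ∈ L²(Ω; C(𝕋^d))`. As the pairings
with `𝓛^ε ψ` are uniformly bounded functionals of `ψ`, it is enough to test with products of a
function of `x` and a mode `cos (2π k·y + θ)` (`dense_span_trig`, `tendsto_of_isL2Functional`).

The core is the oscillation lemma `tendsto_integral_osc`: if the fields `α^ε` and their divergences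
are bounded in `L²(Ω)`, then the component of `α^ε` along the wave vector `ω = D_x⁻ᵀ k` tends to
zero against the mode of frequency `k`. Indeed, in each cube `𝓛^ε` freezes `D` at the point `x_n`,
where the mode times `(2π / ε) D_{x_n}⁻ᵀ k` is the gradient of `sin (2π k·y + θ)`. These primitives
are cut off near the boundaries of the cubes and glued into one smooth function
(`CubeFamily.IsPartition.exists_primitive`), which is used in the divergence identity. The errors
are `ε`, from the divergence; `ε / ε ^ r`, from the gradients of the cutoffs; `ε ^ r`, from the
variation of `D⁻¹` over a cube; and the measure of the boundary layers, which is arbitrarily small.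
They all vanish because `0 < r < 1`.

For the fields `u^ε e_i`, the lemma shows that `u^ε` does not see the modes with `k ≠ 0`
(`tendsto_integral_mul_trig`), while the mode `k = 0` only involves weak convergence: hence the
limit of `u^ε` itself. The same result for `u^ε = 1`, together with `(𝓛^ε ψ)² = 𝓛^ε (ψ²)`, gives the
convergence of the norms of `𝓛^ε ψ` to the norm of `ψ` in `L²(Ω × 𝕋^d)`. With the theorem of
Banach and Alaoglu in the dual of the separable space `L²(Ω; C(𝕋^d))`, it follows that the
derivatives of `u^ε` have two-scale limits `v_i ∈ L²(Ω × 𝕋^d)` along a subsequence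
(`exists_subseq_isL2Functional_pi`, `exists_twoScale_limit`).

For the divergence free fields `∂_a u^ε e_b - ∂_b u^ε e_a`, the oscillation lemma says that almost
every fibre of `v` has Fourier coefficients parallel to `ω` (`ae_waveVec_mul_integral_trig`), and the
mean value of `v` is the weak limit `∇u₀` (`ae_integral_torus_eq`). So `v - ∇u₀` is the gradient in
`y` of the Fourier series with the coefficients `ω · v̂(x, k) / (2πi |ω|²)`, `k ≠ 0`, which is the
corrector `u₁` (`exists_corrector`).
-/

namespace LTS

/-! ### The torus and the cells -/

/-- The Haar probability measure on the torus `ℝ^d / ℤ^d`. -/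
noncomputable abbrev torusMeasure (d : ℕ) : Measure (UnitAddTorus (Fin d)) :=
  Measure.pi fun _ => AddCircle.haarAddCircle

/-- The quotient map `ℝ^d → ℝ^d / ℤ^d`. -/
def toTorus {d : ℕ} (y : E d) : UnitAddTorus (Fin d) := fun i => (y i : UnitAddCircle)

/-- The half-open unit cell with corner `a`. -/
def boxIoc {d : ℕ} (a : Fin d → ℝ) : Set (E d) := {y | ∀ i, y i ∈ Ioc (a i) (a i + 1)}

variable {d : ℕ}

lemma continuous_toTorus : Continuous (toTorus (d := d)) := by
  unfold toTorus
  fun_prop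

lemma toTorus_add_latticePt (y : E d) (k : Fin d → ℤ) :
    toTorus (y + latticePt k) = toTorus y := by
  ext i
  simp [toTorus, latticePt]

lemma measurableSet_unitCell : MeasurableSet (unitCell d) := by
  have : unitCell d = ⋂ i, (fun y : E d => y i) ⁻¹' Icc (0 : ℝ) 1 := by
    ext y; simp [unitCell]
  rw [this]
  exact MeasurableSet.iInter fun i => measurableSet_Icc.preimage (by fun_prop)

lemma map_toTorus_boxIoc (a : Fin d → ℝ) :
    (volume.restrict (boxIoc a)).map toTorus = torusMeasure d := by
  have h1 : MeasurePreserving (fun (x : Fin d → ℝ) => (fun i => x i : UnitAddTorus (Fin d)))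
      (Measure.pi fun i => (volume : Measure ℝ).restrict (Ioc (a i) (a i + 1)))
      (torusMeasure d) := by
    refine measurePreserving_pi _ _ fun i => ?_
    have := AddCircle.measurePreserving_mk 1 (a i)
    rw [AddCircle.volume_eq_smul_haarAddCircle, ENNReal.ofReal_one, one_smul] at this
    exact this
  rw [← Measure.restrict_pi_pi] at h1
  have h2 := (EuclideanSpace.volume_preserving_symm_measurableEquiv_toLp (Fin d)).restrict_preimage
    (s := univ.pi fun i => Ioc (a i) (a i + 1)) (MeasurableSet.univ_pi fun i => measurableSet_Ioc)
  have h3 := h1.comp h2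
  have h4 : ⇑(MeasurableEquiv.toLp 2 (Fin d → ℝ)).symm ⁻¹' (univ.pi fun i => Ioc (a i) (a i + 1))
      = boxIoc a := by
    ext y; simp [boxIoc, Set.mem_pi]
  rw [h4] at h3
  exact h3.map_eq

lemma volume_slice_eq_zero (i : Fin d) (c : ℝ) : volume {y : E d | y i = c} = 0 := by
  have h := (EuclideanSpace.volume_preserving_symm_measurableEquiv_toLp (Fin d)).measure_preimage
    (s := {y : Fin d → ℝ | y i = c})
    ((measurableSet_singleton c).preimage (measurable_pi_apply i)).nullMeasurableSet
  have h2 : volume {y : Fin d → ℝ | y i = c} = 0 :=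
    Measure.pi_hyperplane (fun _ => (volume : Measure ℝ)) i c
  rw [h2] at h
  exact h

lemma unitCell_ae_eq_boxIoc : unitCell d =ᵐ[volume] (boxIoc 0 : Set (E d)) := by
  have h : ∀ᵐ y : E d, ∀ i, y i ≠ 0 := by
    rw [ae_all_iff]
    intro i
    rw [ae_iff]
    simpa using volume_slice_eq_zero i 0
  filter_upwards [h] with y hy
  apply propext
  constructor
  · intro hh i
    have := hh i
    simp only [mem_Icc, Pi.zero_apply, zero_add, mem_Ioc] at *
    exact ⟨lt_of_le_of_ne this.1 (hy i).symm, this.2⟩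
  · intro hh i
    have := hh i
    simp only [mem_Icc, Pi.zero_apply, zero_add, mem_Ioc] at *
    exact ⟨this.1.le, this.2⟩

lemma map_toTorus_unitCell : (volume.restrict (unitCell d)).map toTorus = torusMeasure d := by
  rw [Measure.restrict_congr_set unitCell_ae_eq_boxIoc, map_toTorus_boxIoc]

lemma volume_unitCell : volume (unitCell d) = 1 := by
  have h := congrArg (fun m => m univ) (map_toTorus_unitCell (d := d))
  simpa [Measure.map_apply continuous_toTorus.measurable MeasurableSet.univ] using h

lemma integral_unitCell {F : Type*} [NormedAddCommGroup F] [NormedSpace ℝ F]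
    (f : UnitAddTorus (Fin d) → F) :
    ∫ y in unitCell d, f (toTorus y) = ∫ t, f t ∂torusMeasure d := by
  rw [Measure.restrict_congr_set unitCell_ae_eq_boxIoc]
  have h := UnitAddTorus.integral_preimage f (0 : Fin d → ℝ)
  refine Eq.trans ?_ h.symm
  have h4 : ⇑(MeasurableEquiv.toLp 2 (Fin d → ℝ)).symm ⁻¹'
      {x : Fin d → ℝ | ∀ i, x i ∈ Ioc ((0 : Fin d → ℝ) i) ((0 : Fin d → ℝ) i + 1)}
      = boxIoc (0 : Fin d → ℝ) := by
    ext y; simp [boxIoc]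
  rw [← h4]
  exact (EuclideanSpace.volume_preserving_symm_measurableEquiv_toLp (Fin d)).setIntegral_preimage_emb
    (MeasurableEquiv.measurableEmbedding _) (fun y => f (fun i => (y i : UnitAddCircle))) _

lemma det_ne_zero (A : E d ≃L[ℝ] E d) : (A : E d →L[ℝ] E d).det ≠ 0 :=
  (LinearEquiv.isUnit_det' A.toLinearEquiv).ne_zero

lemma integral_cell {F : Type*} [NormedAddCommGroup F] [NormedSpace ℝ F]
    (D : E d → (E d ≃L[ℝ] E d)) (x : E d) (f : UnitAddTorus (Fin d) → F) :
    ∫ y in cell D x, f (toTorus ((D x).symm y)) =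
      |(D x : E d →L[ℝ] E d).det| • ∫ t, f t ∂torusMeasure d := by
  unfold cell
  rw [integral_image_eq_integral_abs_det_fderiv_smul volume measurableSet_unitCell
    (f' := fun _ => (D x : E d →L[ℝ] E d)) (fun y _ => (D x).hasFDerivWithinAt)
    (D x).injective.injOn]
  simp only [ContinuousLinearEquiv.symm_apply_apply]
  rw [integral_smul, integral_unitCell]

lemma volume_cell (D : E d → (E d ≃L[ℝ] E d)) (x : E d) :
    volume (cell D x) = ENNReal.ofReal |(D x : E d →L[ℝ] E d).det| := by
  unfold cell
  have := Measure.addHaar_image_continuousLinearMap volume (D x : E d →L[ℝ] E d) (unitCell d)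
  rw [volume_unitCell, mul_one] at this
  exact this

/-- The normalization `1 / |Y_x|` absorbs the Jacobian `|det D_x|`: mean values over the cells are
integrals over the torus. -/
lemma average_cell {F : Type*} [NormedAddCommGroup F] [NormedSpace ℝ F]
    (D : E d → (E d ≃L[ℝ] E d)) (x : E d) (f : UnitAddTorus (Fin d) → F) :
    ⨍ y in cell D x, f (toTorus ((D x).symm y)) = ∫ t, f t ∂torusMeasure d := by
  rw [setAverage_eq, integral_cell, measureReal_def, volume_cell,
    ENNReal.toReal_ofReal (abs_nonneg _), smul_smul,
    inv_mul_cancel₀ (abs_ne_zero.2 (det_ne_zero _)), one_smul]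

/-- The map `(x, y) ↦ (x, D_x⁻¹ y)` of the cells onto the torus. -/
def cellToTorus (D : E d → (E d ≃L[ℝ] E d)) (p : E d × E d) : E d × UnitAddTorus (Fin d) :=
  (p.1, toTorus ((D p.1).symm p.2))

section

variable {Ω : Set (E d)} {D : E d → (E d ≃L[ℝ] E d)}

lemma IsTransformation.continuous_symm_apply (hD : IsTransformation Ω D) :
    Continuous fun p : E d × E d => (D p.1).symm p.2 := by
  obtain ⟨K, hK⟩ := hD.lipschitz_inv
  have h : Continuous fun p : E d × E d => ((D p.1).symm : E d →L[ℝ] E d) p.2 :=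
    (hK.continuous.comp continuous_fst).clm_apply continuous_snd
  exact h

lemma IsTransformation.measurable_cellToTorus (hD : IsTransformation Ω D) :
    Measurable (cellToTorus D) :=
  (continuous_fst.prodMk (continuous_toTorus.comp hD.continuous_symm_apply)).measurable

lemma measurableSet_cellBundle (hD : IsTransformation Ω D) (hΩ : IsOpen Ω) :
    MeasurableSet (cellBundle Ω D) := by
  have : cellBundle Ω D = (Prod.fst ⁻¹' Ω) ∩ (fun p : E d × E d => (D p.1).symm p.2) ⁻¹' unitCell d := by
    ext p
    simp only [cellBundle, cell, mem_ofPred_eq, mem_inter_iff, mem_preimage, and_congr_right_iff]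
    intro _
    constructor
    · rintro ⟨z, hz, h⟩
      simpa [← h] using hz
    · intro h
      exact ⟨_, h, by simp⟩
  rw [this]
  exact (hΩ.measurableSet.preimage measurable_fst).inter
    (measurableSet_unitCell.preimage hD.continuous_symm_apply.measurable)

/-- The Jacobian of `(x, y) ↦ (x, D_x⁻¹ y)` is bounded, so square integrability over the cells
follows from square integrability over the torus. -/
lemma IsTransformation.map_cellToTorus_le (hD : IsTransformation Ω D) (hΩ : IsOpen Ω) :
    ∃ C : NNReal, (volume.restrict (cellBundle Ω D)).map (cellToTorus D) ≤
      C • (volume.restrict Ω).prod (torusMeasure d) := by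
  obtain ⟨D₁, D₂, -, hdet⟩ := hD.det_bounds
  refine ⟨D₂.toNNReal, Measure.le_iff.2 fun S hS => ?_⟩
  rw [Measure.map_apply hD.measurable_cellToTorus hS,
    Measure.restrict_apply (hS.preimage hD.measurable_cellToTorus), Measure.smul_apply,
    Measure.volume_eq_prod, Measure.prod_apply ((hS.preimage hD.measurable_cellToTorus).inter
      (measurableSet_cellBundle hD hΩ)), Measure.prod_apply hS]
  rw [← lintegral_indicator hΩ.measurableSet, ENNReal.smul_def, smul_eq_mul,
    ← lintegral_const_mul' _ _ ENNReal.coe_ne_top]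
  refine lintegral_mono fun x => ?_
  by_cases hx : x ∈ Ω
  · rw [indicator_of_mem hx]
    have h1 : (Prod.mk x ⁻¹' (cellToTorus D ⁻¹' S ∩ cellBundle Ω D)) =
        (D x : E d →L[ℝ] E d) '' (toTorus ⁻¹' (Prod.mk x ⁻¹' S) ∩ unitCell d) := by
      ext y
      simp only [cellToTorus, cellBundle, cell, mem_preimage, mem_inter_iff, mem_ofPred_eq, hx,
        true_and, mem_image]
      constructor
      · rintro ⟨h, z, hz, rfl⟩
        refine ⟨z, ⟨by simpa using h, hz⟩, rfl⟩
      · rintro ⟨z, ⟨h, hz⟩, rfl⟩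
        refine ⟨by simpa using h, z, hz, rfl⟩
    rw [h1, Measure.addHaar_image_continuousLinearMap]
    have h2 : volume (toTorus ⁻¹' (Prod.mk x ⁻¹' S) ∩ unitCell d) =
        torusMeasure d (Prod.mk x ⁻¹' S) := by
      rw [← map_toTorus_unitCell, Measure.map_apply continuous_toTorus.measurable
        (measurable_prodMk_left hS), Measure.restrict_apply
        ((measurable_prodMk_left hS).preimage continuous_toTorus.measurable)]
    rw [h2]
    gcongr
    exact ENNReal.ofReal_le_ofReal (hdet x (subset_closure hx)).2
  · have : (Prod.mk x ⁻¹' (cellToTorus D ⁻¹' S ∩ cellBundle Ω D)) = ∅ := by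
      ext y
      simp [cellBundle, hx]
    simp [this]

/-- A function in `L²(Ω × 𝕋^d)` induces a function in `L²(Ω; L²(Y_x))`. -/
lemma IsTransformation.isL2L2 (hD : IsTransformation Ω D) (hΩ : IsOpen Ω) {F : Type*}
    [NormedAddCommGroup F] {W : E d × UnitAddTorus (Fin d) → F}
    (hW : MemLp W 2 ((volume.restrict Ω).prod (torusMeasure d))) :
    IsL2L2 Ω D fun x y => W (x, toTorus ((D x).symm y)) := by
  obtain ⟨C, hC⟩ := hD.map_cellToTorus_le hΩ
  have h := (hW.smul_measure (c := (C : ENNReal)) ENNReal.coe_ne_top).mono_measure hC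
  exact h.comp_of_map hD.measurable_cellToTorus.aemeasurable

end

/-- The image on the torus of Lebesgue measure on a bounded set is at most a multiple of Haar measure,
as the set is covered by finitely many unit cells. -/
lemma exists_map_toTorus_le {B : Set (E d)} (hB : Bornology.IsBounded B) :
    ∃ C : NNReal, (volume.restrict B).map toTorus ≤ C • torusMeasure d := by
  obtain ⟨R, hR⟩ := hB.subset_closedBall 0
  obtain ⟨N, hN⟩ := exists_nat_gt R
  let s : Finset (Fin d → ℤ) := Fintype.piFinset fun _ => Finset.Icc (-(N : ℤ) - 1) N
  have hcov : B ⊆ ⋃ k ∈ s, boxIoc (fun i => (k i : ℝ)) := by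
    intro y hy
    have hy' : ‖y‖ ≤ R := by simpa using hR hy
    simp only [mem_iUnion]
    have hyi : ∀ i, |y i| < N := fun i =>
      lt_of_le_of_lt ((PiLp.norm_apply_le y i).trans hy') hN
    refine ⟨fun i => ⌈y i⌉ - 1, ?_, fun i => ?_⟩
    · simp only [s, Fintype.mem_piFinset, Finset.mem_Icc]
      intro i
      have h := abs_lt.1 (hyi i)
      constructor
      · have : (-(N : ℤ)) ≤ ⌈y i⌉ := by
          have h2 : ((-(N : ℤ) : ℤ) : ℝ) ≤ ⌈y i⌉ := by
            push_cast
            exact h.1.le.trans (Int.le_ceil _)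
          exact_mod_cast h2
        linarith
      · have : ⌈y i⌉ ≤ (N : ℤ) := Int.ceil_le.2 (by exact_mod_cast h.2.le)
        linarith
    · push_cast
      refine ⟨?_, ?_⟩
      · linarith [Int.ceil_lt_add_one (y i)]
      · linarith [Int.le_ceil (y i)]
  refine ⟨s.card, Measure.le_iff.2 fun S hS => ?_⟩
  rw [Measure.map_apply continuous_toTorus.measurable hS,
    Measure.restrict_apply (hS.preimage continuous_toTorus.measurable)]
  calc volume (toTorus ⁻¹' S ∩ B)
      ≤ volume (⋃ k ∈ s, toTorus ⁻¹' S ∩ boxIoc (fun i => (k i : ℝ))) := by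
        refine measure_mono ?_
        rw [← inter_iUnion₂]
        exact inter_subset_inter_right _ hcov
    _ ≤ ∑ k ∈ s, volume (toTorus ⁻¹' S ∩ boxIoc (fun i => (k i : ℝ))) :=
        measure_biUnion_finset_le _ _
    _ = ∑ k ∈ s, torusMeasure d S := by
        refine Finset.sum_congr rfl fun k _ => ?_
        rw [← map_toTorus_boxIoc (fun i => (k i : ℝ)),
          Measure.map_apply continuous_toTorus.measurable hS,
          Measure.restrict_apply (hS.preimage continuous_toTorus.measurable)]
    _ = _ := by simp [ENNReal.smul_def]

/-! ### Smooth cutoffs and density of test functions -/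

lemma exists_smooth_cutoff {K U : Set (E d)} (hK : IsCompact K) (hU : IsOpen U) (hKU : K ⊆ U) :
    ∃ χ : E d → ℝ, ContDiff ℝ ∞ χ ∧ HasCompactSupport χ ∧ tsupport χ ⊆ U ∧
      (∀ x, χ x ∈ Icc (0 : ℝ) 1) ∧ ∀ x ∈ K, χ x = 1 := by
  obtain ⟨K', hK', hKK', hK'U⟩ := exists_compact_between hK hU hKU
  obtain ⟨χ, h1, h2, h3, h4⟩ := exists_contMDiff_support_eq_eq_one_iff
    (modelWithCornersSelf ℝ (E d)) (n := ⊤) isOpen_interior hK.isClosed hKK'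
  have hts : tsupport χ ⊆ K' := by
    refine closure_minimal ?_ hK'.isClosed
    rw [h3]
    exact interior_subset
  exact ⟨χ, h1.contDiff, HasCompactSupport.of_support_subset_isCompact hK'
    (subset_tsupport χ |>.trans hts), hts.trans hK'U, fun x => h2 (mem_range_self x),
    fun x hx => (h4 x).1 hx⟩

/-- Test functions on `Ω` with values in `ℝ`: `C_c^∞(Ω)`. -/
structure IsTest (Ω : Set (E d)) (φ : E d → ℝ) : Prop where
  smooth : ContDiff ℝ ∞ φ
  compact : HasCompactSupport φ
  supp : tsupport φ ⊆ Ω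

lemma IsTest.memLp {Ω : Set (E d)} {φ : E d → ℝ} (h : IsTest Ω φ) :
    MemLp φ 2 (volume.restrict Ω) :=
  (h.smooth.continuous.memLp_of_hasCompactSupport h.compact).restrict _

lemma IsTest.add {Ω : Set (E d)} {φ ψ : E d → ℝ} (h : IsTest Ω φ) (h' : IsTest Ω ψ) :
    IsTest Ω (φ + ψ) where
  smooth := h.smooth.add h'.smooth
  compact := h.compact.add h'.compact
  supp := (tsupport_add φ ψ).trans (union_subset h.supp h'.supp)

lemma IsTest.mul_right {Ω : Set (E d)} {φ S : E d → ℝ} (h : IsTest Ω φ) (h' : ContDiff ℝ ∞ S) :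
    IsTest Ω (fun x => φ x * S x) where
  smooth := h.smooth.mul h'
  compact := h.compact.mul_right
  supp := (tsupport_mul_subset_left).trans h.supp

/-- Test functions are dense in `L²(Ω)`. -/
lemma exists_test_approx {Ω : Set (E d)} (hΩ : IsOpen Ω)
    {f : E d → ℝ} (hf : MemLp f 2 (volume.restrict Ω)) {δ : ENNReal} (hδ : δ ≠ 0) :
    ∃ φ, IsTest Ω φ ∧ eLpNorm (f - φ) 2 (volume.restrict Ω) ≤ δ := by
  have hmain : ∃ φ, eLpNorm (f - φ) 2 (volume.restrict Ω) ≤ δ ∧ IsTest Ω φ := by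
    refine hf.induction_dense (by simp) (IsTest Ω) ?_ (fun _ _ h h' => h.add h')
      (fun _ h => h.memLp.aestronglyMeasurable) hδ
    intro c S hS hSfin δ hδ
    obtain ⟨η, hη, hη'⟩ := exists_eLpNorm_indicator_le (μ := volume.restrict Ω) (p := 2)
      (by simp) c hδ
    rw [Measure.restrict_apply hS] at hSfin
    have hη2 : ((η / 2 : NNReal) : ENNReal) ≠ 0 := by
      have : 0 < η / 2 := by positivity
      exact_mod_cast this.ne'
    -- the indicator of `S` is approximated by a cutoff between `K ⊆ S ⊆ U`, with `U \ K` small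
    obtain ⟨K, hKS, hK, hKm⟩ := (hS.inter hΩ.measurableSet).exists_isCompact_sdiff_lt hSfin.ne hη2
    obtain ⟨U, hSU, hU, -, hUm⟩ := (hS.inter hΩ.measurableSet).exists_isOpen_sdiff_lt hSfin.ne hη2
    obtain ⟨χ, h1, h2, h3, h4, h5⟩ := exists_smooth_cutoff hK (hU.inter hΩ)
      (fun x hx => ⟨hSU (hKS hx), (hKS hx).2⟩)
    refine ⟨fun x => c * χ x, ?_, ⟨contDiff_const.mul h1, h2.mul_left,
      (tsupport_mul_subset_right).trans (h3.trans inter_subset_right)⟩⟩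
    refine le_trans ?_ (hη' (U \ K) ?_)
    · refine eLpNorm_mono_ae ?_
      filter_upwards [ae_restrict_mem hΩ.measurableSet] with x hx
      simp only [Pi.sub_apply]
      by_cases hxK : x ∈ K
      · rw [indicator_of_mem (hKS hxK).1, h5 x hxK]
        simp
      by_cases hxU : x ∈ U
      · rw [indicator_of_mem (s := U \ K) ⟨hxU, hxK⟩]
        by_cases hxS : x ∈ S
        · rw [indicator_of_mem hxS, show c * χ x - c = c * (χ x - 1) by ring, norm_mul]
          refine mul_le_of_le_one_right (norm_nonneg _) ?_
          rw [Real.norm_eq_abs, abs_le]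
          constructor <;> linarith [(h4 x).1, (h4 x).2]
        · rw [indicator_of_notMem hxS, sub_zero, norm_mul]
          refine mul_le_of_le_one_right (norm_nonneg _) ?_
          rw [Real.norm_eq_abs, abs_le]
          constructor <;> linarith [(h4 x).1, (h4 x).2]
      · have hxS : x ∉ S := fun h => hxU (hSU ⟨h, hx⟩)
        have : χ x = 0 := image_eq_zero_of_notMem_tsupport fun h => hxU (h3 h).1
        rw [indicator_of_notMem hxS, this]
        simp
    · calc (volume.restrict Ω) (U \ K) ≤ volume (U \ K) := Measure.restrict_apply_le _ _
        _ ≤ volume ((U \ (S ∩ Ω)) ∪ ((S ∩ Ω) \ K)) := by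
          refine measure_mono fun x hx => ?_
          by_cases h : x ∈ S ∩ Ω
          · exact Or.inr ⟨h, hx.2⟩
          · exact Or.inl ⟨hx.1, h⟩
        _ ≤ _ := measure_union_le _ _
        _ ≤ ((η / 2 : NNReal) : ENNReal) + ((η / 2 : NNReal) : ENNReal) :=
          add_le_add hUm.le hKm.le
        _ = η := by rw [← ENNReal.coe_add, add_halves]
  obtain ⟨φ, h1, h2⟩ := hmain
  exact ⟨φ, h2, h1⟩

/-! ### Cutoffs adapted to cubes -/

/-- The open unit cube. -/
def openUnit (d : ℕ) : Set (E d) := {y | ∀ i, y i ∈ Ioo (0 : ℝ) 1}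

lemma isOpen_openUnit : IsOpen (openUnit d) := by
  have : openUnit d = ⋂ i, (fun y : E d => y i) ⁻¹' Ioo (0 : ℝ) 1 := by
    ext y; simp [openUnit]
  rw [this]
  exact isOpen_iInter_of_finite fun i => isOpen_Ioo.preimage (by fun_prop)

lemma convex_openUnit : Convex ℝ (openUnit d) := by
  intro x hx y hy a b ha hb hab i
  have := convex_Ioo (0 : ℝ) 1 (hx i) (hy i) ha hb hab
  simpa using this

lemma norm_sub_le_of_mem_openUnit {x y : E d} (hx : x ∈ openUnit d) (hy : y ∈ openUnit d) :
    ‖x - y‖ ≤ √d := by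
  rw [EuclideanSpace.norm_eq]
  refine Real.sqrt_le_sqrt ?_
  calc ∑ i, ‖(x - y) i‖ ^ 2 ≤ ∑ i : Fin d, (1 : ℝ) := by
        refine Finset.sum_le_sum fun i _ => ?_
        rw [Real.norm_eq_abs, sq_abs, PiLp.sub_apply]
        have h1 := hx i
        have h2 := hy i
        simp only [mem_Ioo] at h1 h2
        nlinarith
    _ = d := by simp

lemma volume_openUnit_le : volume (openUnit d) ≤ 1 := by
  rw [← volume_unitCell (d := d)]
  exact measure_mono fun y hy i => ⟨(hy i).1.le, (hy i).2.le⟩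

lemma volume_openUnit_ne_zero : volume (openUnit d) ≠ 0 := by
  refine (isOpen_openUnit.measure_pos volume ⟨WithLp.toLp 2 fun _ => 1 / 2, fun i => ?_⟩).ne'
  norm_num

/-- A profile of cutoffs: a smooth function supported in the open unit cube, with values in
`[0, 1]`, equal to `1` up to a part of the cube of measure at most `τ`. -/
structure IsProfile (τ : ℝ) (H : E d → ℝ) : Prop where
  test : IsTest (openUnit d) H
  mem_Icc : ∀ x, H x ∈ Icc (0 : ℝ) 1
  lintegral_le : ∫⁻ z in openUnit d, ENNReal.ofReal (1 - H z) ≤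
    ENNReal.ofReal τ * volume (openUnit d)

lemma exists_isProfile {τ : ℝ} (hτ : 0 < τ) : ∃ H : E d → ℝ, IsProfile τ H := by
  have h0 : ENNReal.ofReal τ * volume (openUnit d) ≠ 0 :=
    mul_ne_zero (by simpa using hτ) volume_openUnit_ne_zero
  obtain ⟨K, hKU, hK, hKm⟩ := (isOpen_openUnit (d := d)).measurableSet.exists_isCompact_sdiff_lt
    (μ := volume)
    (volume_openUnit_le.trans_lt ENNReal.one_lt_top).ne h0
  obtain ⟨χ, h1, h2, h3, h4, h5⟩ := exists_smooth_cutoff hK isOpen_openUnit hKU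
  refine ⟨χ, ⟨h1, h2, h3⟩, h4, ?_⟩
  calc ∫⁻ z in openUnit d, ENNReal.ofReal (1 - χ z)
      ≤ ∫⁻ z in openUnit d, (openUnit d \ K).indicator 1 z := by
        refine setLIntegral_mono' isOpen_openUnit.measurableSet fun z hz => ?_
        by_cases hzK : z ∈ K
        · simp [h5 z hzK]
        · rw [indicator_of_mem (show z ∈ openUnit d \ K from ⟨hz, hzK⟩)]
          simp [(h4 z).1]
    _ ≤ volume (openUnit d \ K) := by
        rw [lintegral_indicator_one (isOpen_openUnit.measurableSet.diff hK.measurableSet)]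
        exact Measure.restrict_apply_le _ _
    _ ≤ _ := hKm.le

/-- Standard coordinates on a cube `Q` of side `s`: the map `T` takes the unit cube to `Q`. -/
lemma IsOpenCube.exists_chart {s : ℝ} (hs : 0 < s) {Q : Set (E d)} (hQ : IsOpenCube s Q) :
    ∃ (a : E d) (R : E d ≃ₗᵢ[ℝ] E d), Q = (fun z => a + s • R z) '' openUnit d := by
  obtain ⟨a, R, rfl⟩ := hQ
  refine ⟨a, R, ?_⟩
  ext x
  constructor
  · rintro ⟨y, hy, rfl⟩
    refine ⟨s⁻¹ • y, fun i => ?_, ?_⟩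
    · have := hy i
      simp only [mem_Ioo, PiLp.smul_apply, smul_eq_mul] at this ⊢
      exact ⟨mul_pos (inv_pos.2 hs) this.1, by rw [inv_mul_lt_iff₀ hs]; simpa using this.2⟩
    · simp [smul_smul, hs.ne']
  · rintro ⟨z, hz, rfl⟩
    refine ⟨s • z, fun i => ?_, by simp⟩
    have := hz i
    simp only [mem_Ioo, PiLp.smul_apply, smul_eq_mul] at this ⊢
    exact ⟨mul_pos hs this.1, by nlinarith [this.2]⟩

lemma IsOpenCube.isOpen {s : ℝ} (hs : 0 < s) {Q : Set (E d)} (hQ : IsOpenCube s Q) : IsOpen Q := by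
  obtain ⟨a, R, rfl⟩ := hQ.exists_chart hs
  have : (fun z => a + s • R z) '' openUnit d = (fun x => s⁻¹ • R.symm (x - a)) ⁻¹' openUnit d := by
    ext x
    constructor
    · rintro ⟨z, hz, rfl⟩
      simpa [smul_smul, hs.ne'] using hz
    · intro h
      exact ⟨_, h, by simp [smul_smul, hs.ne']⟩
  rw [this]
  exact isOpen_openUnit.preimage (by fun_prop)

lemma IsOpenCube.norm_sub_le {s : ℝ} (hs : 0 < s) {Q : Set (E d)} (hQ : IsOpenCube s Q) {x y : E d}
    (hx : x ∈ Q) (hy : y ∈ Q) : ‖x - y‖ ≤ s * √d := by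
  obtain ⟨a, R, rfl⟩ := hQ.exists_chart hs
  obtain ⟨z, hz, rfl⟩ := hx
  obtain ⟨w, hw, rfl⟩ := hy
  have : a + s • R z - (a + s • R w) = s • R (z - w) := by
    rw [map_sub, smul_sub]; abel
  simp only [this, norm_smul, LinearIsometryEquiv.norm_map, Real.norm_eq_abs, abs_of_pos hs]
  exact mul_le_mul_of_nonneg_left (norm_sub_le_of_mem_openUnit hz hw) hs.le

/-- The boundary of a convex set is negligible. -/
lemma IsOpenCube.volume_closure_diff {s : ℝ} {Q : Set (E d)} (hs : 0 < s) (hQ : IsOpenCube s Q) :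
    volume (closure Q \ Q) = 0 := by
  have hconv : Convex ℝ Q := by
    obtain ⟨a, R, rfl⟩ := hQ.exists_chart hs
    have := ((convex_openUnit (d := d)).is_linear_image (f := fun z => s • R z)
      ⟨fun x y => by simp, fun c x => by simp only [map_smul]; exact smul_comm _ _ _⟩).translate a
    rwa [image_image] at this
  have h := hconv.addHaar_frontier volume
  rwa [frontier, (hQ.isOpen hs).interior_eq] at h

/-- The rescaling of a profile to a cube of side `s`. -/
lemma IsOpenCube.exists_cutoff {s : ℝ} (hs : 0 < s) {Q : Set (E d)} (hQ : IsOpenCube s Q) {τ CH : ℝ}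
    {H : E d → ℝ} (hH : IsProfile τ H) (hCH : ∀ z, ‖fderiv ℝ H z‖ ≤ CH) :
    ∃ η : E d → ℝ, ContDiff ℝ ∞ η ∧ (∀ x, η x ∈ Icc (0 : ℝ) 1) ∧
      (∀ x ∉ Q, η x = 0 ∧ fderiv ℝ η x = 0) ∧ (∀ x, ‖fderiv ℝ η x‖ ≤ CH / s) ∧
      ∫⁻ x in Q, ENNReal.ofReal (1 - η x) ≤ ENNReal.ofReal τ * volume Q := by
  obtain ⟨a, R, hQe⟩ := hQ.exists_chart hs
  set T : E d → E d := fun z => a + s • R z with hT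
  set T' : E d → E d := fun x => s⁻¹ • R.symm (x - a) with hT'
  have hTT' : ∀ z, T' (T z) = z := fun z => by simp [hT, hT', smul_smul, hs.ne']
  have hT'T : ∀ x, T (T' x) = x := fun x => by simp [hT, hT', smul_smul, hs.ne']
  have hT'd : ∀ x, HasFDerivAt T' (s⁻¹ • (R.symm : E d →L[ℝ] E d)) x := fun x =>
    (((R.symm : E d →L[ℝ] E d).hasFDerivAt).comp x ((hasFDerivAt_id x).sub_const a)).const_smul s⁻¹
  have hηd : ∀ x, HasFDerivAt (fun x => H (T' x))
      ((fderiv ℝ H (T' x)).comp (s⁻¹ • (R.symm : E d →L[ℝ] E d))) x := fun x =>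
    ((hH.test.smooth.differentiable (by simp)) _).hasFDerivAt.comp x (hT'd x)
  have hmem : ∀ x, T' x ∈ openUnit d → x ∈ Q := fun x hx => by
    rw [hQe]; exact ⟨_, hx, hT'T x⟩
  refine ⟨fun x => H (T' x), hH.test.smooth.comp ?_, fun x => hH.mem_Icc _, fun x hx => ?_,
    fun x => ?_, ?_⟩
  · exact (R.symm.contDiff.comp (contDiff_id.sub contDiff_const)).const_smul s⁻¹
  · have h1 : T' x ∉ tsupport H := fun h => hx (hmem x (hH.test.supp h))
    refine ⟨image_eq_zero_of_notMem_tsupport h1, ?_⟩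
    rw [(hηd x).fderiv, image_eq_zero_of_notMem_tsupport
      (fun h => h1 (tsupport_fderiv_subset ℝ h)), ContinuousLinearMap.zero_comp]
  · rw [(hηd x).fderiv, div_eq_mul_inv]
    refine (ContinuousLinearMap.opNorm_comp_le _ _).trans ?_
    have hCH0 : 0 ≤ CH := (norm_nonneg _).trans (hCH 0)
    refine mul_le_mul (hCH _) ?_ (norm_nonneg _) hCH0
    refine ContinuousLinearMap.opNorm_le_bound _ (inv_nonneg.2 hs.le) fun y => ?_
    simp [norm_smul, abs_of_pos hs]
  · have hinj : InjOn T (openUnit d) := fun z _ w _ h => by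
      rw [← hTT' z, ← hTT' w, h]
    have hTd : ∀ z ∈ openUnit d, HasFDerivWithinAt T (s • (R : E d →L[ℝ] E d)) (openUnit d) z :=
      fun z _ => ((((R : E d →L[ℝ] E d).hasFDerivAt (x := z)).const_smul s).const_add
        a).hasFDerivWithinAt
    have hcv := lintegral_image_eq_lintegral_abs_det_fderiv_mul volume
      isOpen_openUnit.measurableSet hTd hinj
    have h1 := hcv 1
    simp only [Pi.one_apply, mul_one, lintegral_const, one_mul, Measure.restrict_apply_univ] at h1
    rw [hQe, hcv, h1, lintegral_const_mul' _ _ ENNReal.ofReal_ne_top]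
    simp only [hTT']
    calc _ ≤ ENNReal.ofReal |(s • (R : E d →L[ℝ] E d)).det| *
          (ENNReal.ofReal τ * volume (openUnit d)) := by gcongr; exact hH.lintegral_le
      _ = _ := by ring

/-! ### Trigonometric modes -/

lemma mFourier_toTorus (k : Fin d → ℤ) (y : E d) :
    UnitAddTorus.mFourier k (toTorus y) =
      Complex.exp ((2 * Real.pi * inner ℝ (latticePt k) y : ℝ) * Complex.I) := by
  simp only [UnitAddTorus.mFourier, ContinuousMap.coe_mk, toTorus, fourier_coe_apply]
  rw [← Complex.exp_sum]
  congr 1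
  rw [PiLp.inner_apply]
  simp only [latticePt, RCLike.inner_apply, conj_trivial]
  push_cast
  rw [Finset.mul_sum, Finset.sum_mul]
  refine Finset.sum_congr rfl fun i _ => ?_
  ring

/-- The real mode `y ↦ cos (2π k·y + θ)`, for a frequency `k ∈ ℤ^d` and a phase shift `θ`. -/
noncomputable def trig (k : Fin d → ℤ) (θ : ℝ) : Cper d where
  toFun t := (Complex.exp (θ * Complex.I) * UnitAddTorus.mFourier k t).re
  continuous_toFun := by fun_prop

lemma perEval_trig (k : Fin d → ℤ) (θ : ℝ) (y : E d) :
    perEval (trig k θ) y = Real.cos (2 * Real.pi * inner ℝ (latticePt k) y + θ) := by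
  change (Complex.exp (θ * Complex.I) * UnitAddTorus.mFourier k (toTorus y)).re = _
  rw [mFourier_toTorus, ← Complex.exp_add, ← add_mul,
    ← Complex.ofReal_add, Complex.exp_ofReal_mul_I_re, add_comm]

/-- The linear form `b ↦ k · D_x⁻¹ b`: up to the factor `2π`, the derivative in `y` of the phase
of the mode `k` in the cell `Y_x`. -/
noncomputable def waveForm (D : E d → (E d ≃L[ℝ] E d)) (k : Fin d → ℤ) (x : E d) : E d →L[ℝ] ℝ :=
  (innerSL ℝ (latticePt k)).comp ((D x).symm : E d →L[ℝ] E d)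

lemma waveForm_apply (D : E d → (E d ≃L[ℝ] E d)) (k : Fin d → ℤ) (x b : E d) :
    waveForm D k x b = inner ℝ (latticePt k) ((D x).symm b) := rfl

section

variable {Ω : Set (E d)} {D : E d → (E d ≃L[ℝ] E d)}

lemma IsTransformation.lipschitz_waveForm (hD : IsTransformation Ω D) (k : Fin d → ℤ) :
    ∃ L : ℝ, 0 ≤ L ∧ ∀ x y, ‖waveForm D k x - waveForm D k y‖ ≤ L * ‖x - y‖ := by
  obtain ⟨K, hK⟩ := hD.lipschitz_inv
  refine ⟨‖innerSL ℝ (latticePt k : E d)‖ * K, by positivity, fun x y => ?_⟩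
  have : waveForm D k x - waveForm D k y = (innerSL ℝ (latticePt k)).comp
      (((D x).symm : E d →L[ℝ] E d) - ((D y).symm : E d →L[ℝ] E d)) := by
    rw [ContinuousLinearMap.comp_sub]; rfl
  rw [this, mul_assoc]
  refine (ContinuousLinearMap.opNorm_comp_le _ _).trans ?_
  gcongr
  simpa [dist_eq_norm] using hK.dist_le_mul x y

lemma IsTransformation.continuous_waveForm (hD : IsTransformation Ω D) (k : Fin d → ℤ) :
    Continuous (waveForm D k) := by
  obtain ⟨K, hK⟩ := hD.lipschitz_inv
  exact continuous_const.clm_comp hK.continuous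

lemma IsTransformation.exists_waveForm_le (hD : IsTransformation Ω D) (hb : Bornology.IsBounded Ω)
    (k : Fin d → ℤ) : ∃ M : ℝ, 0 ≤ M ∧ ∀ x ∈ Ω, ‖waveForm D k x‖ ≤ M := by
  have h := hb.isCompact_closure.exists_bound_of_continuousOn
    (hD.continuous_waveForm k).continuousOn
  obtain ⟨M, hM⟩ := h
  exact ⟨max M 0, le_max_right _ _, fun x hx => (hM x (subset_closure hx)).trans (le_max_left _ _)⟩

end

/-! ### The locally periodic approximation, pointwise -/

section

variable {Ω : Set (E d)} {D : E d → (E d ≃L[ℝ] E d)} {P : CubeFamily d} {s ε : ℝ}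

lemma CubeFamily.IsPartition.eq_of_mem (hP : P.IsPartition Ω s) {m n : Fin P.N} {x : E d}
    (hm : x ∈ P.cube m) (hn : x ∈ P.cube n) : m = n := by
  by_contra h
  exact (Set.disjoint_left.1 (hP.disjoint m n h)) hm hn

lemma CubeFamily.IsPartition.sum_eq (hP : P.IsPartition Ω s) {F : Type*} [AddCommMonoid F]
    {n : Fin P.N} {x : E d} (hn : x ∈ P.cube n) (f : Fin P.N → F)
    (hf : ∀ m, x ∉ P.cube m → f m = 0) : ∑ m, f m = f n :=
  Finset.sum_eq_single n (fun m _ hmn => hf m fun hm => hmn (hP.eq_of_mem hm hn)) (by simp)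

lemma CubeFamily.IsPartition.locPerApprox_eq (hP : P.IsPartition Ω s) {n : Fin P.N} {x : E d}
    (hn : x ∈ P.cube n) (ψ : E d → Cper d) :
    locPerApprox D P ε ψ x = perEval (ψ x) (ε⁻¹ • (D (P.pt n)).symm (x - P.shift n)) := by
  unfold locPerApprox
  rw [hP.sum_eq hn _ (fun m hm => indicator_of_notMem hm _), indicator_of_mem hn]

lemma locPerApprox_eq_zero {x : E d} (hx : ∀ n, x ∉ P.cube n) (ψ : E d → Cper d) :
    locPerApprox D P ε ψ x = 0 :=
  Finset.sum_eq_zero fun n _ => indicator_of_notMem (hx n) _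

/-- The cubes cover `Ω` up to their boundaries, which are negligible. -/
lemma CubeFamily.IsPartition.ae_mem (hP : P.IsPartition Ω s) (hs : 0 < s) (hΩ : IsOpen Ω) :
    ∀ᵐ x ∂volume.restrict Ω, ∃ n, x ∈ P.cube n := by
  have h : ∀ᵐ x ∂volume.restrict Ω, ∀ n, x ∉ closure (P.cube n) \ P.cube n := by
    rw [ae_all_iff]
    intro n
    refine ae_restrict_of_ae ?_
    rw [ae_iff]
    simpa only [not_not] using! (hP.isOpenCube n).volume_closure_diff hs
  filter_upwards [h, ae_restrict_mem hΩ.measurableSet] with x hx hxΩ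
  obtain ⟨n, hn⟩ := mem_iUnion.1 (hP.cover hxΩ)
  by_contra hcon
  push Not at hcon
  exact hx n ⟨hn, hcon n⟩

/-- At each point, `𝓛^ε` is either an evaluation on the torus, the same for all `ψ`, or zero. -/
lemma CubeFamily.IsPartition.locPerApprox_cases (hP : P.IsPartition Ω s) (D : E d → (E d ≃L[ℝ] E d))
    (ε : ℝ) (x : E d) : (∃ t, ∀ ψ : E d → Cper d, locPerApprox D P ε ψ x = ψ x t) ∨
      ∀ ψ : E d → Cper d, locPerApprox D P ε ψ x = 0 := by
  by_cases h : ∃ n, x ∈ P.cube n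
  · obtain ⟨n, hn⟩ := h
    exact Or.inl ⟨_, fun ψ => hP.locPerApprox_eq hn ψ⟩
  · push Not at h
    exact Or.inr fun ψ => locPerApprox_eq_zero h ψ

lemma CubeFamily.IsPartition.abs_locPerApprox_le (hP : P.IsPartition Ω s) (ψ : E d → Cper d)
    (x : E d) : |locPerApprox D P ε ψ x| ≤ ‖ψ x‖ := by
  rcases hP.locPerApprox_cases D ε x with ⟨t, h⟩ | h
  · rw [h]; exact (ψ x).norm_coe_le_norm t
  · rw [h]; simp

lemma locPerApprox_add (ψ ψ' : E d → Cper d) (x : E d) :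
    locPerApprox D P ε (fun x => ψ x + ψ' x) x =
      locPerApprox D P ε ψ x + locPerApprox D P ε ψ' x := by
  unfold locPerApprox
  rw [← Finset.sum_add_distrib]
  refine Finset.sum_congr rfl fun n _ => ?_
  by_cases h : x ∈ P.cube n <;> simp [h, perEval]

lemma locPerApprox_smul (f : E d → ℝ) (ψ : E d → Cper d) (x : E d) :
    locPerApprox D P ε (fun x => f x • ψ x) x = f x * locPerApprox D P ε ψ x := by
  unfold locPerApprox
  rw [Finset.mul_sum]
  refine Finset.sum_congr rfl fun n _ => ?_
  by_cases h : x ∈ P.cube n <;> simp [h, perEval]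

lemma CubeFamily.IsPartition.aestronglyMeasurable_locPerApprox (hP : P.IsPartition Ω s)
    (hs : 0 < s) {μ : Measure (E d)} {ψ : E d → Cper d} (hψ : AEStronglyMeasurable ψ μ) :
    AEStronglyMeasurable (locPerApprox D P ε ψ) μ := by
  have : locPerApprox D P ε ψ = ∑ n, (P.cube n).indicator
      (fun z => perEval (ψ z) (ε⁻¹ • (D (P.pt n)).symm (z - P.shift n))) := by
    ext x; simp [locPerApprox]
  rw [this]
  refine Finset.aestronglyMeasurable_sum _ fun n _ => ?_
  refine AEStronglyMeasurable.indicator ?_ ((hP.isOpenCube n).isOpen hs).measurableSet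
  have hc : Continuous fun z : E d => toTorus (ε⁻¹ • (D (P.pt n)).symm (z - P.shift n)) :=
    continuous_toTorus.comp (by fun_prop)
  have he : Continuous fun p : Cper d × UnitAddTorus (Fin d) => p.1 p.2 := by fun_prop
  exact he.comp_aestronglyMeasurable (hψ.prodMk hc.aestronglyMeasurable)

lemma CubeFamily.IsPartition.memLp_locPerApprox (hP : P.IsPartition Ω s)
    (hs : 0 < s) {μ : Measure (E d)} {ψ : E d → Cper d} (hψ : MemLp ψ 2 μ) :
    MemLp (locPerApprox D P ε ψ) 2 μ :=
  hψ.mono (hP.aestronglyMeasurable_locPerApprox hs hψ.1)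
    (ae_of_all _ fun x => hP.abs_locPerApprox_le ψ x)

/-- The cubes are disjoint and meet `Ω`, so those of side at most `1` fill at most the
`√d`-neighbourhood of `Ω`: their total measure is bounded whatever their number. -/
lemma CubeFamily.IsPartition.measure_iUnion_le (hP : P.IsPartition Ω s) (hs : 0 < s) (hs1 : s ≤ 1) :
    ∑ n, volume (P.cube n) ≤ volume (Metric.cthickening √d Ω) := by
  rw [← tsum_fintype (L := .unconditional _), ← measure_iUnion (fun m n h => hP.disjoint m n h)
    (fun n => ((hP.isOpenCube n).isOpen hs).measurableSet)]
  refine measure_mono (iUnion_subset fun n x hx => ?_)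
  refine Metric.mem_cthickening_of_dist_le x (P.pt n) _ _ (hP.pt_mem n).2 ?_
  rw [dist_eq_norm]
  refine ((hP.isOpenCube n).norm_sub_le hs hx (hP.pt_mem n).1).trans ?_
  exact mul_le_of_le_one_left (Real.sqrt_nonneg _) hs1

/-- A smooth function whose derivative is, up to small errors, the mode `cos (2π k·y + θ)` of
`𝓛^ε`, times `2π/ε` and the wave covector. In each cube it is the primitive mode
`sin (2π k·y + θ)`, cut off near the boundary of the cube. The function `ρ` measures the layer
where the cutoff acts; the error `CH / s` is the gradient of the cutoff, and `L * (s * √d)` bounds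
the variation of the wave covector over a cube of side `s`. -/
lemma CubeFamily.IsPartition.exists_primitive (hP : P.IsPartition Ω s) (hs : 0 < s) (hε : 0 < ε)
    (k : Fin d → ℤ) (θ : ℝ) {M L : ℝ} (hM : ∀ x ∈ Ω, ‖waveForm D k x‖ ≤ M)
    (hL : 0 ≤ L) (hLip : ∀ x y, ‖waveForm D k x - waveForm D k y‖ ≤ L * ‖x - y‖) {τ CH : ℝ}
    {H : E d → ℝ} (hH : IsProfile τ H) (hCH : ∀ z, ‖fderiv ℝ H z‖ ≤ CH) :
    ∃ (S ρ : E d → ℝ), ContDiff ℝ ∞ S ∧ Measurable ρ ∧ (∀ x, ρ x ∈ Icc (0 : ℝ) 1) ∧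
      (∀ x n, x ∈ P.cube n → |S x| ≤ 1) ∧
      ∫⁻ x, ENNReal.ofReal (ρ x) ≤ ENNReal.ofReal τ * ∑ n, volume (P.cube n) ∧
      ∀ x n, x ∈ P.cube n → ‖fderiv ℝ S x - ((2 * Real.pi / ε) *
          locPerApprox D P ε (fun _ => trig k θ) x) • waveForm D k x‖ ≤
        CH / s + 2 * Real.pi / ε * (M * ρ x + L * (s * √d)) := by
  choose η hη hη01 hη0 hη' hηint using fun n => (hP.isOpenCube n).exists_cutoff hs hH hCH
  -- the phase in the `n`-th cube, where the transformation is frozen at `P.pt n`: it is affine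
  let ph : Fin P.N → E d → ℝ := fun n x =>
    2 * Real.pi * inner ℝ (latticePt k) (ε⁻¹ • (D (P.pt n)).symm (x - P.shift n)) + θ
  have hph : ∀ n x, HasFDerivAt (ph n) ((2 * Real.pi / ε) • waveForm D k (P.pt n)) x := by
    intro n x
    have h : HasFDerivAt (fun x => waveForm D k (P.pt n) (x - P.shift n))
        (waveForm D k (P.pt n)) x :=
      (waveForm D k (P.pt n)).hasFDerivAt.comp x ((hasFDerivAt_id x).sub_const _)
    have h2 := (h.const_mul (2 * Real.pi / ε)).add_const θ
    convert! h2 using 2 with z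
    simp only [ph, waveForm_apply, inner_smul_right]
    ring
  have hphs : ∀ n, ContDiff ℝ ∞ (ph n) := fun n => by
    have : ph n = fun x => 2 * Real.pi / ε * waveForm D k (P.pt n) (x - P.shift n) + θ := by
      ext x
      simp only [ph, waveForm_apply, inner_smul_right]
      ring
    rw [this]
    exact (contDiff_const.mul ((waveForm D k (P.pt n)).contDiff.comp
      (contDiff_id.sub contDiff_const))).add contDiff_const
  have hterm : ∀ n x, HasFDerivAt (fun x => η n x * Real.sin (ph n x))
      (η n x • (Real.cos (ph n x) • ((2 * Real.pi / ε) • waveForm D k (P.pt n))) +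
        Real.sin (ph n x) • fderiv ℝ (η n) x) x := fun n x =>
    (((hη n).differentiable (by simp)) x).hasFDerivAt.mul (hph n x).sin
  have hmeasQ : ∀ n, MeasurableSet (P.cube n) := fun n =>
    ((hP.isOpenCube n).isOpen hs).measurableSet
  have hρn : ∀ x n, x ∈ P.cube n →
      ∑ m, (P.cube m).indicator (fun x => 1 - η m x) x = 1 - η n x := fun x n hn => by
    rw [hP.sum_eq hn _ (fun m hm => indicator_of_notMem hm _), indicator_of_mem hn]
  refine ⟨fun x => ∑ n, η n x * Real.sin (ph n x),
    fun x => ∑ n, (P.cube n).indicator (fun x => 1 - η n x) x, ?_, ?_, ?_, ?_, ?_, ?_⟩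
  · exact ContDiff.sum fun n _ => (hη n).mul (Real.contDiff_sin.comp (hphs n))
  · exact Finset.measurable_sum _ fun n _ =>
      (measurable_const.sub (hη n).continuous.measurable).indicator (hmeasQ n)
  · intro x
    beta_reduce
    by_cases h : ∃ n, x ∈ P.cube n
    · obtain ⟨n, hn⟩ := h
      rw [hρn x n hn]
      constructor <;> linarith [(hη01 n x).1, (hη01 n x).2]
    · push Not at h
      rw [Finset.sum_eq_zero fun n _ => indicator_of_notMem (h n) _]
      simp
  · intro x n hn
    beta_reduce
    rw [hP.sum_eq hn _ (fun m hm => by rw [(hη0 m x hm).1, zero_mul]), abs_mul]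
    refine mul_le_one₀ ?_ (abs_nonneg _) (Real.abs_sin_le_one _)
    rw [abs_of_nonneg (hη01 n x).1]
    exact (hη01 n x).2
  · calc ∫⁻ x, ENNReal.ofReal (∑ n, (P.cube n).indicator (fun x => 1 - η n x) x)
        = ∫⁻ x, ∑ n, (P.cube n).indicator (fun x => ENNReal.ofReal (1 - η n x)) x := by
          refine lintegral_congr fun x => ?_
          rw [ENNReal.ofReal_sum_of_nonneg]
          · refine Finset.sum_congr rfl fun n _ => ?_
            by_cases h : x ∈ P.cube n <;> simp [h]
          · intro n _
            exact indicator_nonneg (fun x _ => by linarith [(hη01 n x).2]) x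
      _ = ∑ n, ∫⁻ x in P.cube n, ENNReal.ofReal (1 - η n x) := by
          rw [lintegral_finsetSum _ fun n _ => (Measurable.ennreal_ofReal (measurable_const.sub
            (hη n).continuous.measurable) :
            Measurable fun x => ENNReal.ofReal (1 - η n x)).indicator (hmeasQ n)]
          exact Finset.sum_congr rfl fun n _ => lintegral_indicator (hmeasQ n) _
      _ ≤ ∑ n, ENNReal.ofReal τ * volume (P.cube n) := Finset.sum_le_sum fun n _ => hηint n
      _ = _ := by rw [Finset.mul_sum]
  · intro x n hn
    have hSd : fderiv ℝ (fun x => ∑ n, η n x * Real.sin (ph n x)) x =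
        η n x • (Real.cos (ph n x) • ((2 * Real.pi / ε) • waveForm D k (P.pt n))) +
        Real.sin (ph n x) • fderiv ℝ (η n) x := by
      rw [(HasFDerivAt.fun_sum fun n (_ : n ∈ Finset.univ) => hterm n x).fderiv]
      refine hP.sum_eq hn _ fun m hm => ?_
      rw [(hη0 m x hm).1, (hη0 m x hm).2]
      simp
    have hcos : locPerApprox D P ε (fun _ => trig k θ) x = Real.cos (ph n x) := by
      rw [hP.locPerApprox_eq hn, perEval_trig]
    beta_reduce
    rw [hSd, hcos, hρn x n hn]
    -- the error splits into the gradient of the cutoff, the variation of the wave covector, and the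
    -- boundary layer
    set c := Real.cos (ph n x)
    have hdec : η n x • (c • ((2 * Real.pi / ε) • waveForm D k (P.pt n))) +
        Real.sin (ph n x) • fderiv ℝ (η n) x - ((2 * Real.pi / ε) * c) • waveForm D k x =
        Real.sin (ph n x) • fderiv ℝ (η n) x + ((2 * Real.pi / ε) * c) •
          (waveForm D k (P.pt n) - waveForm D k x - (1 - η n x) • waveForm D k (P.pt n)) := by
      module
    rw [hdec]
    refine (norm_add_le _ _).trans (add_le_add ?_ ?_)
    · rw [norm_smul, Real.norm_eq_abs]
      calc |Real.sin (ph n x)| * ‖fderiv ℝ (η n) x‖ ≤ 1 * (CH / s) :=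
            mul_le_mul (Real.abs_sin_le_one _) (hη' n x) (norm_nonneg _) zero_le_one
        _ = _ := one_mul _
    · have hp : 0 ≤ 2 * Real.pi / ε := by positivity
      rw [norm_smul, norm_mul, Real.norm_of_nonneg hp]
      refine mul_le_mul ?_ ?_ (norm_nonneg _) hp
      · exact mul_le_of_le_one_right hp (Real.abs_cos_le_one _)
      · rw [add_comm]
        refine (norm_sub_le _ _).trans (add_le_add ?_ ?_)
        · refine (hLip _ _).trans (mul_le_mul_of_nonneg_left ?_ hL)
          exact (hP.isOpenCube n).norm_sub_le hs (hP.pt_mem n).1 hn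
        · have h1 : 0 ≤ 1 - η n x := by linarith [(hη01 n x).2]
          rw [norm_smul, Real.norm_of_nonneg h1, mul_comm]
          exact mul_le_mul_of_nonneg_right (hM _ (hP.pt_mem n).2) h1

end

/-! ### Estimates in `L²` -/

section

variable {X F G : Type*} [MeasurableSpace X] {μ : Measure X} [NormedAddCommGroup F]
  [NormedAddCommGroup G]

lemma lpNorm_two_eq {f : X → F} (hf : AEStronglyMeasurable f μ) :
    lpNorm f 2 μ = √(∫ x, ‖f x‖ ^ 2 ∂μ) := by
  rw [lpNorm_eq_integral_norm_rpow_toReal (by simp) (by simp) hf]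
  simp [Real.sqrt_eq_rpow]

lemma integral_norm_mul_norm_le {f : X → F} {g : X → G} (hf : MemLp f 2 μ) (hg : MemLp g 2 μ) :
    ∫ x, ‖f x‖ * ‖g x‖ ∂μ ≤ lpNorm f 2 μ * lpNorm g 2 μ := by
  have h := integral_mul_norm_le_Lp_mul_Lq (μ := μ) (f := fun x => ‖f x‖) (g := fun x => ‖g x‖)
    (p := 2) (q := 2) ⟨by norm_num, by norm_num, by norm_num⟩ (by simpa using hf.norm)
    (by simpa using hg.norm)
  rw [lpNorm_two_eq hf.1, lpNorm_two_eq hg.1, Real.sqrt_eq_rpow, Real.sqrt_eq_rpow]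
  simpa using h

lemma integrable_norm_mul_norm {f : X → F} {g : X → G} (hf : MemLp f 2 μ) (hg : MemLp g 2 μ) :
    Integrable (fun x => ‖f x‖ * ‖g x‖) μ :=
  hf.norm.integrable_mul hg.norm

lemma abs_integral_le_lpNorm_mul {h : X → ℝ} {f : X → F} {g : X → G} (hf : MemLp f 2 μ)
    (hg : MemLp g 2 μ) (hh : ∀ᵐ x ∂μ, |h x| ≤ ‖f x‖ * ‖g x‖) :
    |∫ x, h x ∂μ| ≤ lpNorm f 2 μ * lpNorm g 2 μ := by
  rw [← Real.norm_eq_abs]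
  exact (norm_integral_le_of_norm_le (integrable_norm_mul_norm hf hg) hh).trans
    (integral_norm_mul_norm_le hf hg)

lemma integral_norm_le_lpNorm [IsFiniteMeasure μ] {f : X → F} (hf : MemLp f 2 μ) :
    ∫ x, ‖f x‖ ∂μ ≤ √(μ.real univ) * lpNorm f 2 μ := by
  have h := integral_norm_mul_norm_le (memLp_const (1 : ℝ) (μ := μ)) hf
  simp only [norm_one, one_mul] at h
  refine h.trans_eq ?_
  rw [lpNorm_two_eq aestronglyMeasurable_const]
  simp

end

/-! ### The oscillation estimate -/

section

variable {Ω : Set (E d)} {D : E d → (E d ≃L[ℝ] E d)}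

lemma IsTest.exists_bound {φ : E d → ℝ} (h : IsTest Ω φ) :
    ∃ B : ℝ, 0 ≤ B ∧ (∀ x, |φ x| ≤ B) ∧ ∀ x, ‖fderiv ℝ φ x‖ ≤ B := by
  obtain ⟨B₁, h1⟩ := h.smooth.continuous.bounded_above_of_compact_support h.compact
  obtain ⟨B₂, h2⟩ := (h.smooth.continuous_fderiv (by simp)).bounded_above_of_compact_support
    (h.compact.fderiv ℝ)
  exact ⟨max B₁ B₂, ((abs_nonneg _).trans (h1 0)).trans (le_max_left _ _),
    fun x => (h1 x).trans (le_max_left _ _), fun x => (h2 x).trans (le_max_right _ _)⟩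

lemma IsTest.integrable_fderiv {φ : E d → ℝ} (h : IsTest Ω φ) {μ : Measure (E d)}
    [IsFiniteMeasure μ] {α : E d → E d} (hα : MemLp α 2 μ) :
    Integrable (fun x => fderiv ℝ φ x (α x)) μ := by
  obtain ⟨B, -, -, hB⟩ := h.exists_bound
  refine Integrable.mono' (g := fun x => B * ‖α x‖)
    ((hα.integrable (by norm_num)).norm.const_mul B) ?_ ?_
  · have hc : Continuous fun p : (E d →L[ℝ] ℝ) × E d => p.1 p.2 := by fun_prop
    exact hc.comp_aestronglyMeasurable
      ((h.smooth.continuous_fderiv (by simp)).aestronglyMeasurable.prodMk hα.1)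
  · exact ae_of_all _ fun x => (ContinuousLinearMap.le_opNorm _ _).trans
      (mul_le_mul_of_nonneg_right (hB x) (norm_nonneg _))

lemma memLp_locPerApprox_trig_waveForm (hΩ : IsOpen Ω) (hb : Bornology.IsBounded Ω)
    (hD : IsTransformation Ω D)
    {P : CubeFamily d} {s ε : ℝ} (hP : P.IsPartition Ω s) (hs : 0 < s) (k : Fin d → ℤ) (c : Cper d)
    {α : E d → E d} (hα : MemLp α 2 (volume.restrict Ω)) :
    MemLp (fun x => locPerApprox D P ε (fun _ => c) x * waveForm D k x (α x)) 2
      (volume.restrict Ω) := by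
  obtain ⟨M, hM0, hM⟩ := hD.exists_waveForm_le hb k
  refine MemLp.of_le_mul (g := α) (c := ‖c‖ * M) hα ?_ ?_
  · refine (hP.aestronglyMeasurable_locPerApprox hs aestronglyMeasurable_const).mul ?_
    have hc : Continuous fun p : (E d →L[ℝ] ℝ) × E d => p.1 p.2 := by fun_prop
    exact hc.comp_aestronglyMeasurable
      ((hD.continuous_waveForm k).aestronglyMeasurable.prodMk hα.1)
  · filter_upwards [ae_restrict_mem hΩ.measurableSet] with x hx
    rw [norm_mul, mul_assoc]
    refine mul_le_mul (hP.abs_locPerApprox_le _ x) ?_ (norm_nonneg _) (norm_nonneg _)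
    exact (ContinuousLinearMap.le_opNorm _ _).trans
      (mul_le_mul_of_nonneg_right (hM x hx) (norm_nonneg _))

/-- If `div α = -β`, integrating by parts against the primitive of a mode gains a factor `ε`. -/
lemma CubeFamily.IsPartition.abs_integral_osc_le (hΩ : IsOpen Ω) (hb : Bornology.IsBounded Ω)
    (hD : IsTransformation Ω D)
    {P : CubeFamily d} {s ε : ℝ} (hP : P.IsPartition Ω s) (hs : 0 < s) (hs1 : s ≤ 1) (hε : 0 < ε)
    (k : Fin d → ℤ) (θ : ℝ) {M L : ℝ} (hM0 : 0 ≤ M) (hM : ∀ x ∈ Ω, ‖waveForm D k x‖ ≤ M)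
    (hL : 0 ≤ L) (hLip : ∀ x y, ‖waveForm D k x - waveForm D k y‖ ≤ L * ‖x - y‖) {τ CH : ℝ}
    (hτ : 0 ≤ τ) {H : E d → ℝ} (hH : IsProfile τ H) (hCH : ∀ z, ‖fderiv ℝ H z‖ ≤ CH)
    {α : E d → E d} {β : E d → ℝ} (hα : MemLp α 2 (volume.restrict Ω))
    (hβ : MemLp β 2 (volume.restrict Ω)) {C : ℝ} (hαC : lpNorm α 2 (volume.restrict Ω) ≤ C)
    (hβC : lpNorm β 2 (volume.restrict Ω) ≤ C)
    (hdiv : ∀ Φ, IsTest Ω Φ → ∫ x in Ω, fderiv ℝ Φ x (α x) = ∫ x in Ω, β x * Φ x)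
    {φ : E d → ℝ} (hφ : IsTest Ω φ) {B : ℝ} (hB0 : 0 ≤ B) (hB : ∀ x, |φ x| ≤ B)
    (hB' : ∀ x, ‖fderiv ℝ φ x‖ ≤ B) :
    |∫ x in Ω, φ x * (locPerApprox D P ε (fun _ => trig k θ) x * waveForm D k x (α x))| ≤
      B * (√(volume.real Ω) * C) * (ε / (2 * Real.pi) * (2 + CH / s) + L * √d * s) +
        B * M * C * √(τ * volume.real (Metric.cthickening √d Ω)) := by
  have hfin : IsFiniteMeasure (volume.restrict Ω) :=
    isFiniteMeasure_restrict.2 hb.measure_lt_top.ne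
  obtain ⟨S, ρ, hS, hρm, hρ01, hS1, hρint, hSd⟩ := hP.exists_primitive (D := D) hs hε k θ hM hL hLip
    hH hCH
  set μ := volume.restrict Ω with hμ
  set Lc : E d → ℝ := locPerApprox D P ε (fun _ => trig k θ) with hLc
  set c₀ : ℝ := 2 * Real.pi / ε with hc₀
  have hc₀pos : 0 < c₀ := by positivity
  have hC0 : 0 ≤ C := lpNorm_nonneg.trans hαC
  have hCH0 : 0 ≤ CH := (norm_nonneg _).trans (hCH 0)
  -- the divergence identity is tested with `φ S`; in its derivative, `φ ∇S` contains `c₀` times the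
  -- integrand of interest, and `A₁`, `ρ` collect the rest
  have hΦ : IsTest Ω (fun x => φ x * S x) := hφ.mul_right hS
  have hdΦ : ∀ x, fderiv ℝ (fun x => φ x * S x) x = φ x • fderiv ℝ S x + S x • fderiv ℝ φ x :=
    fun x => fderiv_fun_mul (hφ.smooth.differentiable (by simp) x) (hS.differentiable (by simp) x)
  have hI : Integrable (fun x => φ x * (Lc x * waveForm D k x (α x))) μ :=
    hφ.memLp.integrable_mul (memLp_locPerApprox_trig_waveForm hΩ hb hD hP hs k _ hα)
  have hIΦ := hΦ.integrable_fderiv (μ := μ) hα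
  -- as `0 ≤ ρ ≤ 1`, the square of the norm of `ρ` is at most its integral
  have hρ2 : lpNorm ρ 2 μ ≤ √(τ * volume.real (Metric.cthickening √d Ω)) := by
    rw [lpNorm_two_eq hρm.aestronglyMeasurable]
    refine Real.sqrt_le_sqrt ?_
    have h1 : ∫ x, ‖ρ x‖ ^ 2 ∂μ ≤ ∫ x, ρ x ∂μ := by
      have hρI : Integrable ρ μ := Integrable.of_bound hρm.aestronglyMeasurable 1
        (ae_of_all _ fun x => by
          rw [Real.norm_of_nonneg (hρ01 x).1]; exact (hρ01 x).2)
      refine integral_mono_of_nonneg (ae_of_all _ fun x => by positivity) hρI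
        (ae_of_all _ fun x => ?_)
      have := hρ01 x
      simp only [Real.norm_eq_abs, sq_abs]
      nlinarith [this.1, this.2]
    refine h1.trans ?_
    rw [integral_eq_lintegral_of_nonneg_ae (ae_of_all _ fun x => (hρ01 x).1)
      hρm.aestronglyMeasurable]
    have hfin2 : volume (Metric.cthickening √d Ω) < ⊤ := hb.cthickening.measure_lt_top
    have h2 : ∫⁻ x, ENNReal.ofReal (ρ x) ∂μ ≤
        ENNReal.ofReal τ * volume (Metric.cthickening √d Ω) :=
      (lintegral_mono' Measure.restrict_le_self le_rfl).trans
        (hρint.trans (mul_le_mul_right (hP.measure_iUnion_le hs hs1) _))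
    refine (ENNReal.toReal_mono (ENNReal.mul_ne_top ENNReal.ofReal_ne_top hfin2.ne) h2).trans_eq ?_
    rw [ENNReal.toReal_mul, ENNReal.toReal_ofReal hτ, measureReal_def]
  have hρL : MemLp ρ 2 μ := MemLp.of_bound hρm.aestronglyMeasurable 1
    (ae_of_all _ fun x => by rw [Real.norm_of_nonneg (hρ01 x).1]; exact (hρ01 x).2)
  set A₁ : ℝ := B + B * (CH / s + c₀ * (L * (s * √d))) with hA₁
  have hA₁0 : 0 ≤ A₁ := by positivity
  have hrest : |∫ x, (fderiv ℝ (fun x => φ x * S x) x (α x) -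
      c₀ * (φ x * (Lc x * waveForm D k x (α x)))) ∂μ| ≤
      A₁ * (√(volume.real Ω) * C) + B * (c₀ * M) *
        (√(τ * volume.real (Metric.cthickening √d Ω)) * C) := by
    have hg : Integrable (fun x => A₁ * ‖α x‖ + B * (c₀ * M) * (‖ρ x‖ * ‖α x‖)) μ :=
      ((hα.integrable (by norm_num)).norm.const_mul _).add
        ((integrable_norm_mul_norm hρL hα).const_mul _)
    rw [← Real.norm_eq_abs]
    refine (norm_integral_le_of_norm_le hg ?_).trans ?_
    · filter_upwards [hP.ae_mem hs hΩ] with x hx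
      obtain ⟨n, hn⟩ := hx
      have h1 := hSd x n hn
      have h2 := hS1 x n hn
      have hdec : fderiv ℝ (fun x => φ x * S x) x (α x) -
          c₀ * (φ x * (Lc x * waveForm D k x (α x))) =
          φ x * (fderiv ℝ S x - (c₀ * Lc x) • waveForm D k x) (α x) + S x * fderiv ℝ φ x (α x) := by
        rw [hdΦ]
        simp only [add_apply, smul_apply,
          sub_apply, smul_eq_mul]
        ring
      rw [hdec]
      calc _ ≤ |φ x| * (‖fderiv ℝ S x - (c₀ * Lc x) • waveForm D k x‖ * ‖α x‖) +
            |S x| * (‖fderiv ℝ φ x‖ * ‖α x‖) := by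
            refine (norm_add_le _ _).trans (add_le_add ?_ ?_)
            · rw [norm_mul]
              exact mul_le_mul_of_nonneg_left (ContinuousLinearMap.le_opNorm _ _) (norm_nonneg _)
            · rw [norm_mul]
              exact mul_le_mul_of_nonneg_left (ContinuousLinearMap.le_opNorm _ _) (norm_nonneg _)
        _ ≤ B * ((CH / s + c₀ * (M * ρ x + L * (s * √d))) * ‖α x‖) + 1 * (B * ‖α x‖) := by
            gcongr
            · exact hB x
            · exact hB' x
        _ = _ := by
            rw [hA₁, Real.norm_of_nonneg (hρ01 x).1]
            ring
    · rw [integral_add ((hα.integrable (by norm_num)).norm.const_mul _)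
        ((integrable_norm_mul_norm hρL hα).const_mul _), integral_const_mul, integral_const_mul]
      have e1 : ∫ x, ‖α x‖ ∂μ ≤ √(volume.real Ω) * C := by
        refine (integral_norm_le_lpNorm hα).trans ?_
        rw [hμ, measureReal_restrict_apply_univ]
        gcongr
      have e2 := (integral_norm_mul_norm_le hρL hα).trans
        (mul_le_mul hρ2 hαC lpNorm_nonneg (Real.sqrt_nonneg _))
      gcongr
  have hΦβ : |∫ x, β x * (φ x * S x) ∂μ| ≤ B * (√(volume.real Ω) * C) := by
    have hg : Integrable (fun x => B * ‖β x‖) μ := (hβ.integrable (by norm_num)).norm.const_mul _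
    rw [← Real.norm_eq_abs]
    refine (norm_integral_le_of_norm_le hg ?_).trans ?_
    · filter_upwards [hP.ae_mem hs hΩ] with x hx
      obtain ⟨n, hn⟩ := hx
      rw [norm_mul, norm_mul, mul_comm]
      refine mul_le_mul_of_nonneg_right ?_ (norm_nonneg _)
      calc ‖φ x‖ * ‖S x‖ ≤ B * 1 := mul_le_mul (hB x) (hS1 x n hn) (norm_nonneg _) hB0
        _ = B := mul_one B
    · rw [integral_const_mul]
      have e1 : ∫ x, ‖β x‖ ∂μ ≤ √(volume.real Ω) * C := by
        refine (integral_norm_le_lpNorm hβ).trans ?_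
        rw [hμ, measureReal_restrict_apply_univ]
        gcongr
      gcongr
  have hkey : c₀ * ∫ x, φ x * (Lc x * waveForm D k x (α x)) ∂μ =
      ∫ x, β x * (φ x * S x) ∂μ - ∫ x, (fderiv ℝ (fun x => φ x * S x) x (α x) -
      c₀ * (φ x * (Lc x * waveForm D k x (α x)))) ∂μ := by
    rw [integral_sub hIΦ (hI.const_mul _), hdiv _ hΦ, integral_const_mul]
    ring
  have hfinal : c₀ * |∫ x, φ x * (Lc x * waveForm D k x (α x)) ∂μ| ≤
      B * (√(volume.real Ω) * C) + (A₁ * (√(volume.real Ω) * C) + B * (c₀ * M) *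
        (√(τ * volume.real (Metric.cthickening √d Ω)) * C)) := by
    rw [← abs_of_pos hc₀pos, ← abs_mul, abs_of_pos hc₀pos, hkey]
    exact (abs_sub _ _).trans (add_le_add hΦβ hrest)
  have hinv : ε / (2 * Real.pi) = c₀⁻¹ := by rw [hc₀, inv_div]
  rw [← le_div_iff₀' hc₀pos] at hfinal
  refine hfinal.trans_eq ?_
  rw [hinv, hA₁]
  field_simp
  ring

/-- Oscillation lemma: if `div α^ε = -β^ε` with `α^ε`, `β^ε` bounded in `L²(Ω)`, then the component
of `α^ε` along the wave covector does not see the mode. -/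
theorem tendsto_integral_osc (hΩ : IsOpen Ω) (hb : Bornology.IsBounded Ω)
    (hD : IsTransformation Ω D) {r : ℝ} (hr₀ : 0 < r) (hr₁ : r < 1) {P : ℝ → CubeFamily d}
    (hP : ∀ ε : ℝ, 0 < ε → (P ε).IsPartition Ω (ε ^ r))
    {α : ℝ → E d → E d} {β : ℝ → E d → ℝ} {C : ℝ}
    (hα : ∀ ε, 0 < ε → MemLp (α ε) 2 (volume.restrict Ω))
    (hβ : ∀ ε, 0 < ε → MemLp (β ε) 2 (volume.restrict Ω))
    (hαC : ∀ ε, 0 < ε → lpNorm (α ε) 2 (volume.restrict Ω) ≤ C)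
    (hβC : ∀ ε, 0 < ε → lpNorm (β ε) 2 (volume.restrict Ω) ≤ C)
    (hdiv : ∀ ε, 0 < ε → ∀ Φ, IsTest Ω Φ →
      ∫ x in Ω, fderiv ℝ Φ x (α ε x) = ∫ x in Ω, β ε x * Φ x)
    (k : Fin d → ℤ) (θ : ℝ) {f : E d → ℝ} (hf : MemLp f 2 (volume.restrict Ω)) :
    Tendsto (fun ε => ∫ x in Ω, f x *
      (locPerApprox D (P ε) ε (fun _ => trig k θ) x * waveForm D k x (α ε x)))
      (𝓝[>] (0 : ℝ)) (𝓝 0) := by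
  obtain ⟨M, hM0, hM⟩ := hD.exists_waveForm_le hb k
  obtain ⟨L, hL0, hL⟩ := hD.lipschitz_waveForm k
  have hC0 : 0 ≤ C := lpNorm_nonneg.trans (hαC 1 one_pos)
  set W : ℝ := volume.real (Metric.cthickening √d Ω)
  have hsr : Tendsto (fun ε : ℝ => ε ^ r) (𝓝[>] 0) (𝓝 0) := by
    have := (Real.continuousAt_rpow_const 0 r (Or.inr hr₀.le)).tendsto
    rw [Real.zero_rpow hr₀.ne'] at this
    exact this.mono_left nhdsWithin_le_nhds
  have hsr' : Tendsto (fun ε : ℝ => ε / ε ^ r) (𝓝[>] 0) (𝓝 0) := by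
    have := (Real.continuousAt_rpow_const 0 (1 - r) (Or.inr (by linarith))).tendsto
    rw [Real.zero_rpow (by linarith)] at this
    refine (this.mono_left nhdsWithin_le_nhds).congr' ?_
    filter_upwards [self_mem_nhdsWithin] with ε hε
    rw [Real.rpow_sub hε, Real.rpow_one]
  have hid : Tendsto (fun ε : ℝ => ε) (𝓝[>] 0) (𝓝 0) := tendsto_id.mono_left nhdsWithin_le_nhds
  rw [Metric.tendsto_nhds]
  intro δ hδ
  -- the error `δ` is shared between the replacement of `f` by a test function `φ` at distance `δ₁`,
  -- the boundary layers, of relative measure `τ`, and the terms of order `ε`, `ε / ε ^ r`, `ε ^ r`;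
  -- the constants `B`, `CH` depend on `φ` and `τ`, which are fixed before `ε → 0`
  set δ₁ : ℝ := δ / (3 * (M * C + 1)) with hδ₁
  have hδ₁pos : 0 < δ₁ := by positivity
  obtain ⟨φ, hφ, hφf⟩ := exists_test_approx hΩ hf (δ := ENNReal.ofReal δ₁) (by simpa using hδ₁pos)
  have hsub : MemLp (f - φ) 2 (volume.restrict Ω) := hf.sub hφ.memLp
  have hφf' : lpNorm (f - φ) 2 (volume.restrict Ω) ≤ δ₁ := by
    rw [← toReal_eLpNorm hsub.1]
    exact ENNReal.toReal_le_of_le_ofReal hδ₁pos.le hφf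
  obtain ⟨B, hB0, hB, hB'⟩ := hφ.exists_bound
  set q : ℝ := δ / (3 * (B * M * C + 1)) with hq
  have hqpos : 0 < q := by positivity
  set τ : ℝ := q ^ 2 / (W + 1) with hτ
  have hW0 : 0 ≤ W := measureReal_nonneg
  have hτpos : 0 < τ := by positivity
  obtain ⟨H, hH⟩ := exists_isProfile (d := d) hτpos
  obtain ⟨CH, -, -, hCH⟩ := hH.test.exists_bound
  have hτq : √(τ * W) ≤ q := by
    rw [Real.sqrt_le_left hqpos.le, hτ, div_mul_eq_mul_div]
    rw [div_le_iff₀ (by positivity)]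
    nlinarith [sq_nonneg q]
  have hlim : Tendsto (fun ε : ℝ => B * (√(volume.real Ω) * C) *
      (2 * (ε / (2 * Real.pi)) + CH * ((ε / ε ^ r) / (2 * Real.pi)) + L * √d * ε ^ r))
      (𝓝[>] 0) (𝓝 (B * (√(volume.real Ω) * C) *
      (2 * (0 / (2 * Real.pi)) + CH * (0 / (2 * Real.pi)) + L * √d * 0))) :=
    ((((hid.div_const _).const_mul _).add ((hsr'.div_const _).const_mul _)).add
      (hsr.const_mul _)).const_mul _
  simp only [zero_div, mul_zero, add_zero] at hlim
  have hs1 : ∀ᶠ ε in 𝓝[>] (0 : ℝ), ε ^ r ≤ 1 := hsr.eventually_le_const one_pos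
  filter_upwards [self_mem_nhdsWithin, hs1, hlim.eventually_lt_const (show 0 < δ / 3 by positivity)]
    with ε hε hε1 hεlim
  rw [dist_zero_right, Real.norm_eq_abs]
  have hε : 0 < ε := hε
  have hs : 0 < ε ^ r := Real.rpow_pos_of_pos hε r
  have hest := (hP ε hε).abs_integral_osc_le hΩ hb hD hs hε1 hε k θ hM0 hM hL0 hL hτpos.le hH hCH
    (hα ε hε) (hβ ε hε) (hαC ε hε) (hβC ε hε) (hdiv ε hε) hφ hB0 hB hB'
  have hLα := memLp_locPerApprox_trig_waveForm (ε := ε) hΩ hb hD (hP ε hε) hs k (trig k θ) (hα ε hε)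
  have hsplit : ∫ x in Ω, f x *
      (locPerApprox D (P ε) ε (fun _ => trig k θ) x * waveForm D k x (α ε x)) =
      (∫ x in Ω, φ x *
      (locPerApprox D (P ε) ε (fun _ => trig k θ) x * waveForm D k x (α ε x))) +
      ∫ x in Ω, (f - φ) x *
      (locPerApprox D (P ε) ε (fun _ => trig k θ) x * waveForm D k x (α ε x)) := by
    refine Eq.trans ?_ (integral_add (hφ.memLp.integrable_mul hLα) (hsub.integrable_mul hLα))
    refine integral_congr_ae (ae_of_all _ fun x => ?_)
    simp only [Pi.sub_apply]
    ring
  have htrig : ∀ x, |locPerApprox D (P ε) ε (fun _ => trig k θ) x| ≤ 1 := by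
    intro x
    by_cases h : ∃ n, x ∈ (P ε).cube n
    · obtain ⟨n, hn⟩ := h
      rw [(hP ε hε).locPerApprox_eq hn, perEval_trig]
      exact Real.abs_cos_le_one _
    · push Not at h
      rw [locPerApprox_eq_zero h]
      simp
  have h2 : |∫ x in Ω, (f - φ) x *
      (locPerApprox D (P ε) ε (fun _ => trig k θ) x * waveForm D k x (α ε x))| ≤ δ₁ * (M * C) := by
    refine (abs_integral_le_lpNorm_mul hsub ((hα ε hε).const_smul M) ?_).trans ?_
    · filter_upwards [ae_restrict_mem hΩ.measurableSet] with x hx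
      rw [abs_mul]
      refine mul_le_mul_of_nonneg_left ?_ (abs_nonneg _)
      rw [abs_mul, Pi.smul_apply, norm_smul, Real.norm_of_nonneg hM0]
      calc _ ≤ 1 * (M * ‖α ε x‖) := by
            refine mul_le_mul (htrig x) ?_ (abs_nonneg _) zero_le_one
            exact (ContinuousLinearMap.le_opNorm _ _).trans
              (mul_le_mul_of_nonneg_right (hM x hx) (norm_nonneg _))
        _ = _ := one_mul _
    · refine mul_le_mul hφf' ?_ lpNorm_nonneg hδ₁pos.le
      rw [lpNorm_const_smul, coe_nnnorm, Real.norm_of_nonneg hM0]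
      exact mul_le_mul_of_nonneg_left (hαC ε hε) hM0
  have h3 : δ₁ * (M * C) < δ / 3 := by
    rw [hδ₁, div_mul_eq_mul_div, div_lt_div_iff₀ (by positivity) (by norm_num)]
    have : 0 ≤ M * C := by positivity
    nlinarith
  have h4 : B * M * C * √(τ * W) < δ / 3 := by
    have h0 : 0 ≤ B * M * C := by positivity
    refine (mul_le_mul_of_nonneg_left hτq h0).trans_lt ?_
    rw [hq, mul_div_assoc', div_lt_div_iff₀ (by positivity) (by norm_num)]
    nlinarith
  have h5 : B * (√(volume.real Ω) * C) * (ε / (2 * Real.pi) * (2 + CH / ε ^ r) + L * √d * ε ^ r) =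
      B * (√(volume.real Ω) * C) *
      (2 * (ε / (2 * Real.pi)) + CH * ((ε / ε ^ r) / (2 * Real.pi)) + L * √d * ε ^ r) := by
    field_simp
  rw [h5] at hest
  rw [hsplit]
  refine (abs_add_le _ _).trans_lt ?_
  linarith

end

/-! ### The space `H¹` -/

section

variable {Ω : Set (E d)}

lemma IsTest.fderiv_apply {φ : E d → ℝ} (h : IsTest Ω φ) (b : E d) :
    IsTest Ω (fun x => fderiv ℝ φ x b) where
  smooth := (h.smooth.fderiv_right (m := ∞) (by simp)).clm_apply contDiff_const
  compact := h.compact.fderiv_apply ℝ b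
  supp := (tsupport_fderiv_apply_subset ℝ b).trans h.supp

lemma IsTest.smul_const {φ : E d → ℝ} (h : IsTest Ω φ) (b : E d) {μ : Measure (E d)}
    [IsFiniteMeasure μ] : MemLp (fun x => φ x • b) 2 μ := by
  obtain ⟨B, -, hB, -⟩ := h.exists_bound
  refine MemLp.of_bound
    (h.smooth.continuous.smul continuous_const).aestronglyMeasurable (B * ‖b‖) (ae_of_all _ fun x => ?_)
  rw [norm_smul]
  exact mul_le_mul_of_nonneg_right (hB x) (norm_nonneg _)

/-- The defining identity of the weak gradient, tested in one direction `b`. -/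
lemma HasWeakGrad.of_forall {u : E d → ℝ} {g : E d → E d}
    (hu : LocallyIntegrableOn u Ω) (hg : LocallyIntegrableOn g Ω)
    (hui : ∀ φ, IsTest Ω φ → Integrable (fun x => u x • gradient φ x) (volume.restrict Ω))
    (hgi : ∀ φ, IsTest Ω φ → Integrable (fun x => φ x • g x) (volume.restrict Ω))
    (h : ∀ φ, IsTest Ω φ → ∀ b, ∫ x in Ω, u x * fderiv ℝ φ x b = -∫ x in Ω, φ x * inner ℝ (g x) b) :
    HasWeakGrad Ω u g := by
  refine ⟨hu, hg, fun φ h1 h2 h3 => ?_⟩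
  have hφ : IsTest Ω φ := ⟨h1, h2, h3⟩
  refine ext_inner_left ℝ fun b => ?_
  rw [← integral_inner (hui φ hφ), inner_neg_right, ← integral_inner (hgi φ hφ)]
  simp only [inner_smul_right, inner_gradient_right, conj_trivial]
  rw [h φ hφ b]
  simp only [real_inner_comm b]

lemma continuous_gradient {φ : E d → ℝ} (h : ContDiff ℝ ∞ φ) : Continuous (gradient φ) :=
  (InnerProductSpace.toDual ℝ (E d)).symm.continuous.comp (h.continuous_fderiv (by simp))

lemma norm_gradient (φ : E d → ℝ) (x : E d) : ‖gradient φ x‖ = ‖fderiv ℝ φ x‖ :=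
  (InnerProductSpace.toDual ℝ (E d)).symm.norm_map _

lemma IsTest.integrable_smul_gradient {φ : E d → ℝ} (h : IsTest Ω φ) {μ : Measure (E d)}
    [IsFiniteMeasure μ] {u : E d → ℝ} (hu : MemLp u 2 μ) :
    Integrable (fun x => u x • gradient φ x) μ := by
  obtain ⟨B, -, -, hB⟩ := h.exists_bound
  exact (hu.integrable (by norm_num)).smul_bdd B
    (continuous_gradient h.smooth).aestronglyMeasurable
    (ae_of_all _ fun x => (norm_gradient φ x).le.trans (hB x))

lemma IsTest.integrable_smul {φ : E d → ℝ} (h : IsTest Ω φ) {μ : Measure (E d)}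
    [IsFiniteMeasure μ] {g : E d → E d} (hg : MemLp g 2 μ) :
    Integrable (fun x => φ x • g x) μ := by
  obtain ⟨B, -, hB, -⟩ := h.exists_bound
  exact (hg.integrable (by norm_num)).bdd_smul B
    h.smooth.continuous.aestronglyMeasurable (ae_of_all _ hB)

lemma IsH1.of_forall [IsFiniteMeasure (volume.restrict Ω)] {u : E d → ℝ} {g : E d → E d}
    (hu : MemLp u 2 (volume.restrict Ω)) (hg : MemLp g 2 (volume.restrict Ω))
    (h : ∀ φ, IsTest Ω φ → ∀ b, ∫ x in Ω, u x * fderiv ℝ φ x b = -∫ x in Ω, φ x * inner ℝ (g x) b) :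
    IsH1 Ω u g :=
  ⟨hu, hg, .of_forall
    (IntegrableOn.locallyIntegrableOn (hu.integrable (by norm_num)))
    (IntegrableOn.locallyIntegrableOn (hg.integrable (by norm_num)))
    (fun _ hφ => hφ.integrable_smul_gradient hu) (fun _ hφ => hφ.integrable_smul hg) h⟩

lemma IsH1.integral_fderiv [IsFiniteMeasure (volume.restrict Ω)] {u : E d → ℝ} {g : E d → E d}
    (hu : IsH1 Ω u g) {φ : E d → ℝ} (hφ : IsTest Ω φ) (b : E d) :
    ∫ x in Ω, u x * fderiv ℝ φ x b = -∫ x in Ω, φ x * inner ℝ (g x) b := by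
  have h := congrArg (inner ℝ b) (hu.hasWeakGrad.integral_eq φ hφ.smooth hφ.compact hφ.supp)
  rw [← integral_inner (hφ.integrable_smul_gradient hu.memLp), inner_neg_right,
    ← integral_inner (hφ.integrable_smul hu.memLp_grad)] at h
  simp only [inner_smul_right, inner_gradient_right, conj_trivial] at h
  rw [h]
  simp only [real_inner_comm b]

lemma isH1_one [IsFiniteMeasure (volume.restrict Ω)] : IsH1 Ω (fun _ => 1) (fun _ => 0) := by
  refine .of_forall (memLp_const 1) MemLp.zero' fun φ hφ b => ?_
  simp only [one_mul, inner_zero_left, mul_zero, integral_zero, neg_zero]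
  rw [setIntegral_eq_integral_of_forall_compl_eq_zero fun x hx => ?_]
  · have h1 : Integrable (fun x => fderiv ℝ φ x b) :=
      (hφ.fderiv_apply b).smooth.continuous.integrable_of_hasCompactSupport
        (hφ.fderiv_apply b).compact
    have h2 : Integrable φ := hφ.smooth.continuous.integrable_of_hasCompactSupport hφ.compact
    have h := integral_mul_fderiv_eq_neg_fderiv_mul_of_integrable (μ := volume)
      (f := fun _ => (1 : ℝ)) (g := φ) (v := b) (by simp) (by simpa using h1) (by simpa using h2)
      (fun _ _ => differentiableAt_const _) (fun x _ => hφ.smooth.differentiable (by simp) x)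
    simpa using h
  · by_contra h
    exact hx ((hφ.fderiv_apply b).supp (subset_tsupport _ h))

/-- A gradient is curl free: it is orthogonal to the fields `∂_bΦ a - ∂_aΦ b`. -/
lemma IsH1.integral_curl [IsFiniteMeasure (volume.restrict Ω)] {u : E d → ℝ} {g : E d → E d}
    (hu : IsH1 Ω u g) {φ : E d → ℝ} (hφ : IsTest Ω φ) (a b : E d) :
    ∫ x in Ω, fderiv ℝ φ x (inner ℝ (g x) a • b - inner ℝ (g x) b • a) = 0 := by
  have ha := hu.integral_fderiv (hφ.fderiv_apply b) a
  have hb := hu.integral_fderiv (hφ.fderiv_apply a) b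
  have hsymm : ∀ x, fderiv ℝ (fun x => fderiv ℝ φ x b) x a = fderiv ℝ (fun x => fderiv ℝ φ x a) x b := by
    intro x
    have hs : IsSymmSndFDerivAt ℝ φ x := (hφ.smooth.contDiffAt (x := x)).isSymmSndFDerivAt (by
      simpa using WithTop.coe_le_coe.2 (le_top : (2 : ℕ∞) ≤ ⊤))
    have hd : DifferentiableAt ℝ (fderiv ℝ φ) x :=
      (hφ.smooth.fderiv_right (m := ∞) (by simp)).differentiable (by simp) x
    rw [fderiv_clm_apply hd (differentiableAt_const _), fderiv_clm_apply hd (differentiableAt_const _)]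
    simpa using hs.eq a b
  simp only [hsymm] at ha
  have hI : ∀ a b : E d, Integrable (fun x => fderiv ℝ φ x b * inner ℝ (g x) a) (volume.restrict Ω) :=
    fun a b => (hφ.fderiv_apply b).memLp.integrable_mul (hu.memLp_grad.inner_const a)
  have heq : ∀ x, fderiv ℝ φ x (inner ℝ (g x) a • b - inner ℝ (g x) b • a) =
      fderiv ℝ φ x b * inner ℝ (g x) a - fderiv ℝ φ x a * inner ℝ (g x) b := by
    intro x
    simp only [map_sub, map_smul, smul_eq_mul]
    ring
  simp only [heq]
  rw [integral_sub (hI a b) (hI b a)]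
  linarith

lemma lpNorm_le_of_innerH1_le {u : E d → ℝ} {g : E d → E d} (hu : IsH1 Ω u g) {C : ℝ}
    (hC : innerH1 Ω u g u g ≤ C) : lpNorm u 2 (volume.restrict Ω) ≤ √C ∧
      lpNorm g 2 (volume.restrict Ω) ≤ √C := by
  have h1 : Integrable (fun x => ‖u x‖ ^ 2) (volume.restrict Ω) := hu.memLp.integrable_norm_pow (by simp)
  have h2 : Integrable (fun x => ‖g x‖ ^ 2) (volume.restrict Ω) :=
    hu.memLp_grad.integrable_norm_pow (by simp)
  have h : innerH1 Ω u g u g = (∫ x in Ω, ‖u x‖ ^ 2) + ∫ x in Ω, ‖g x‖ ^ 2 := by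
    rw [innerH1, ← integral_add h1 h2]
    congr 1
    ext x
    rw [real_inner_self_eq_norm_sq, Real.norm_eq_abs, sq_abs, ← sq]
  rw [h] at hC
  have p1 : 0 ≤ ∫ x in Ω, ‖u x‖ ^ 2 := integral_nonneg fun x => by positivity
  have p2 : 0 ≤ ∫ x in Ω, ‖g x‖ ^ 2 := integral_nonneg fun x => by positivity
  rw [lpNorm_two_eq hu.memLp.1, lpNorm_two_eq hu.memLp_grad.1]
  exact ⟨Real.sqrt_le_sqrt (by linarith), Real.sqrt_le_sqrt (by linarith)⟩

/-- Orthogonal projection on the orthogonal complement of a set, in a Hilbert space. -/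
lemma exists_orthogonal_projection {V : Type*} [NormedAddCommGroup V] [InnerProductSpace ℝ V]
    [CompleteSpace V] (W : Set V) (f : V) :
    ∃ p : V, (∀ w ∈ W, inner ℝ w p = 0) ∧
      ∀ q : V, (∀ w ∈ W, inner ℝ w q = 0) → inner ℝ q f = inner ℝ q p := by
  let K : Submodule ℝ V := (Submodule.span ℝ W)ᗮ
  have hK : ∀ q : V, q ∈ K ↔ ∀ w ∈ W, inner ℝ w q = 0 := by
    intro q
    rw [Submodule.mem_orthogonal]
    constructor
    · exact fun h w hw => h w (Submodule.subset_span hw)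
    · intro h w hw
      induction hw using Submodule.span_induction with
      | mem x hx => exact h x hx
      | zero => exact inner_zero_left _
      | add x y _ _ hx hy => rw [inner_add_left, hx, hy, add_zero]
      | smul c x _ hx => rw [inner_smul_left, hx, mul_zero]
  refine ⟨K.starProjection f, (hK _).1 (Submodule.starProjection_apply_mem K f), fun q hq => ?_⟩
  have h := (Submodule.mem_orthogonal _ _).1 (K.sub_starProjection_mem_orthogonal f) q ((hK q).2 hq)
  rw [inner_sub_right] at h
  linarith

/-- Weak convergence in `H¹(Ω)` implies weak convergence of the functions and their gradients in
`L²(Ω)`, since every functional on `L²` is represented on the closed subspace `H¹` by the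
orthogonal projection of its Riesz vector. -/
lemma TendstoWeaklyH1.tendsto_integral [IsFiniteMeasure (volume.restrict Ω)] {l : Filter ℝ}
    {u : ℝ → E d → ℝ} {g : ℝ → E d → E d} {u₀ : E d → ℝ} {g₀ : E d → E d}
    (h : TendstoWeaklyH1 Ω l u g u₀ g₀) (hu : ∀ᶠ ε in l, IsH1 Ω (u ε) (g ε)) (hu₀ : IsH1 Ω u₀ g₀)
    {f : E d → ℝ} {v : E d → E d} (hf : MemLp f 2 (volume.restrict Ω))
    (hv : MemLp v 2 (volume.restrict Ω)) :
    Tendsto (fun ε => ∫ x in Ω, (u ε x * f x + inner ℝ (g ε x) (v x))) l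
      (𝓝 (∫ x in Ω, (u₀ x * f x + inner ℝ (g₀ x) (v x)))) := by
  set μ := volume.restrict Ω with hμ
  let V := WithLp 2 (Lp ℝ 2 μ × Lp (E d) 2 μ)
  let mk : ∀ {u : E d → ℝ} {g : E d → E d}, MemLp u 2 μ → MemLp g 2 μ → V :=
    fun hu hg => WithLp.toLp 2 (hu.toLp _, hg.toLp _)
  have hinner : ∀ {u u' : E d → ℝ} {g g' : E d → E d} (hu : MemLp u 2 μ) (hg : MemLp g 2 μ)
      (hu' : MemLp u' 2 μ) (hg' : MemLp g' 2 μ), inner ℝ (mk hu hg) (mk hu' hg') =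
        ∫ x, (u x * u' x + inner ℝ (g x) (g' x)) ∂μ := by
    intro u u' g g' hu hg hu' hg'
    have e1 : inner ℝ (hu.toLp u) (hu'.toLp u') = ∫ x, u x * u' x ∂μ := by
      rw [L2.inner_def]
      refine integral_congr_ae ?_
      filter_upwards [hu.coeFn_toLp, hu'.coeFn_toLp] with x h1 h2
      rw [h1, h2]
      simp [mul_comm]
    have e2 : inner ℝ (hg.toLp g) (hg'.toLp g') = ∫ x, inner ℝ (g x) (g' x) ∂μ := by
      rw [L2.inner_def]
      refine integral_congr_ae ?_
      filter_upwards [hg.coeFn_toLp, hg'.coeFn_toLp] with x h1 h2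
      rw [h1, h2]
    have i2 : Integrable (fun x => inner ℝ (g x) (g' x)) μ :=
      Integrable.mono' (integrable_norm_mul_norm hg hg') (hg.1.inner hg'.1)
        (ae_of_all _ fun x => norm_inner_le_norm _ _)
    refine Eq.trans (WithLp.prod_inner_apply _ _) (Eq.trans ?_
      (integral_add (hu.integrable_mul hu') i2).symm)
    exact congrArg₂ (· + ·) e1 e2
  -- `H¹(Ω)` is the orthogonal complement of the pairs `(∂_b φ, φ b)`
  let W : Set V := {w | ∃ (φ : E d → ℝ) (hφ : IsTest Ω φ) (b : E d),
    w = mk (hφ.fderiv_apply b).memLp (hφ.smul_const b (μ := μ))}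
  have hmem : ∀ {u : E d → ℝ} {g : E d → E d} (hu : MemLp u 2 μ) (hg : MemLp g 2 μ),
      (∀ w ∈ W, inner ℝ w (mk hu hg) = 0) ↔ IsH1 Ω u g := by
    intro u g hu hg
    have key : ∀ (φ : E d → ℝ) (hφ : IsTest Ω φ) (b : E d),
        inner ℝ (mk (hφ.fderiv_apply b).memLp (hφ.smul_const b (μ := μ))) (mk hu hg) =
          (∫ x, u x * fderiv ℝ φ x b ∂μ) + ∫ x, φ x * inner ℝ (g x) b ∂μ := by
      intro φ hφ b
      rw [hinner, ← integral_add]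
      · refine integral_congr_ae (ae_of_all _ fun x => ?_)
        simp only [inner_smul_left, conj_trivial, real_inner_comm b]
        ring
      · exact hu.integrable_mul (hφ.fderiv_apply b).memLp
      · exact hφ.memLp.integrable_mul (hg.inner_const b)
    constructor
    · intro hw
      refine .of_forall hu hg fun φ hφ b => ?_
      have := hw _ ⟨φ, hφ, b, rfl⟩
      rw [key φ hφ] at this
      linarith
    · rintro hH _ ⟨φ, hφ, b, rfl⟩
      rw [key φ hφ, hH.integral_fderiv hφ b]
      ring
  obtain ⟨p, hp, hpq⟩ := exists_orthogonal_projection W (mk hf hv)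
  have hp1 : MemLp (p.fst : E d → ℝ) 2 μ := Lp.memLp _
  have hp2 : MemLp (p.snd : E d → E d) 2 μ := Lp.memLp _
  have hpe : p = mk hp1 hp2 := by
    have e1 : hp1.toLp _ = p.fst := Lp.toLp_coeFn _ _
    have e2 : hp2.toLp _ = p.snd := Lp.toLp_coeFn _ _
    simp only [mk, e1, e2]
    rfl
  have hpH : IsH1 Ω (p.fst : E d → ℝ) (p.snd : E d → E d) := by
    rw [← hmem hp1 hp2, ← hpe]
    exact hp
  have hval : ∀ {u : E d → ℝ} {g : E d → E d}, IsH1 Ω u g →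
      ∫ x, (u x * f x + inner ℝ (g x) (v x)) ∂μ = innerH1 Ω u g p.fst p.snd := by
    intro u g hu
    rw [← hinner hu.memLp hu.memLp_grad hf hv,
      hpq _ ((hmem hu.memLp hu.memLp_grad).2 hu)]
    conv_lhs => rw [hpe]
    rw [hinner]
    rfl
  rw [hval hu₀]
  refine (h _ _ hpH).congr' ?_
  filter_upwards [hu] with ε hε
  rw [hval hε]

end

/-! ### Density of the modes -/

/-- The mean value over the torus. -/
noncomputable def torusMean : Cper d →L[ℝ] ℝ :=
  LinearMap.mkContinuous
    { toFun := fun f => ∫ t, f t ∂torusMeasure d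
      map_add' := fun f g => integral_add (f.continuous.integrable_of_hasCompactSupport
        (HasCompactSupport.of_compactSpace _)) (g.continuous.integrable_of_hasCompactSupport
        (HasCompactSupport.of_compactSpace _))
      map_smul' := fun c f => integral_const_mul c _ } 1 fun f => by
    have := norm_integral_le_of_norm_le_const (μ := torusMeasure d) (f := f)
      (ae_of_all _ fun t => f.norm_coe_le_norm t)
    simpa using this

lemma torusMean_apply (f : Cper d) : torusMean f = ∫ t, f t ∂torusMeasure d := rfl

lemma abs_torusMean_le (f : Cper d) : |torusMean f| ≤ ‖f‖ := by
  have := norm_integral_le_of_norm_le_const (μ := torusMeasure d) (f := f)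
    (ae_of_all _ fun t => f.norm_coe_le_norm t)
  simpa [torusMean_apply] using this

lemma integral_mFourier {k : Fin d → ℤ} (hk : k ≠ 0) :
    ∫ t, UnitAddTorus.mFourier k t ∂torusMeasure d = 0 := by
  have h := (orthonormal_iff_ite.1 (UnitAddTorus.orthonormal_mFourier (d := Fin d))) 0 k
  rw [if_neg hk.symm, ContinuousMap.inner_toLp] at h
  rw [← h]
  refine integral_congr_ae (ae_of_all _ fun t => ?_)
  simp [UnitAddTorus.mFourier_zero]

lemma integrable_continuousMap {F : Type*} [NormedAddCommGroup F] (f : C(UnitAddTorus (Fin d), F)) :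
    Integrable f (torusMeasure d) :=
  f.continuous.integrable_of_hasCompactSupport (HasCompactSupport.of_compactSpace _)

lemma trig_apply (k : Fin d → ℤ) (θ : ℝ) (t : UnitAddTorus (Fin d)) :
    trig k θ t = (Complex.exp (θ * Complex.I) * UnitAddTorus.mFourier k t).re := rfl

lemma torusMean_trig {k : Fin d → ℤ} (hk : k ≠ 0) (θ : ℝ) : torusMean (trig k θ) = 0 := by
  rw [torusMean_apply]
  simp only [trig_apply]
  have h := integral_re (𝕜 := ℂ) (μ := torusMeasure d)
    ((integrable_continuousMap (UnitAddTorus.mFourier k)).const_mul (Complex.exp (θ * Complex.I)))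
  refine h.trans ?_
  rw [integral_const_mul, integral_mFourier hk]
  simp

lemma trig_zero (θ : ℝ) : trig (0 : Fin d → ℤ) θ = ContinuousMap.const _ (Real.cos θ) := by
  ext t
  rw [trig_apply, UnitAddTorus.mFourier_zero]
  simp [Complex.exp_ofReal_mul_I_re]

/-- The real modes span a dense subspace of `C_per(Y)`, being the real parts of the multiples of the
Fourier monomials. -/
lemma dense_span_trig :
    Dense (Submodule.span ℝ (range fun p : (Fin d → ℤ) × ℝ => trig p.1 p.2) : Set (Cper d)) := by
  set K := Submodule.span ℝ (range fun p : (Fin d → ℤ) × ℝ => trig p.1 p.2) with hK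
  let re : C(UnitAddTorus (Fin d), ℂ) → Cper d := fun f => ⟨fun t => (f t).re, by fun_prop⟩
  have hre : ∀ p ∈ Submodule.span ℂ (range (UnitAddTorus.mFourier (d := Fin d))),
      ∀ z : ℂ, re (z • p) ∈ K := by
    intro p hp
    induction hp using Submodule.span_induction with
    | mem x hx =>
      obtain ⟨k, rfl⟩ := hx
      intro z
      have : re (z • UnitAddTorus.mFourier k) = ‖z‖ • trig k z.arg := by
        ext t
        change (z * UnitAddTorus.mFourier k t).re = ‖z‖ * trig k z.arg t
        rw [trig_apply, ← Complex.re_ofReal_mul, ← mul_assoc, Complex.norm_mul_exp_arg_mul_I]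
      rw [this]
      exact K.smul_mem _ (Submodule.subset_span ⟨(k, z.arg), rfl⟩)
    | zero =>
      intro z
      have : re (z • 0) = 0 := by ext t; simp [re]
      rw [this]
      exact K.zero_mem
    | add x y _ _ hx hy =>
      intro z
      have : re (z • (x + y)) = re (z • x) + re (z • y) := by
        ext t; simp [re, mul_add]
      rw [this]
      exact K.add_mem (hx z) (hy z)
    | smul c x _ hx =>
      intro z
      rw [smul_smul]
      exact hx _
  rw [Metric.dense_iff]
  intro c δ hδ
  let cC : C(UnitAddTorus (Fin d), ℂ) := ⟨fun t => (c t : ℂ), by fun_prop⟩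
  have hc : cC ∈ closure (Submodule.span ℂ (range (UnitAddTorus.mFourier (d := Fin d))) :
      Set C(UnitAddTorus (Fin d), ℂ)) := by
    rw [← Submodule.topologicalClosure_coe, UnitAddTorus.span_mFourier_closure_eq_top]
    trivial
  obtain ⟨p, hp, hpd⟩ := Metric.mem_closure_iff.1 hc δ hδ
  refine ⟨re p, ?_, by simpa using hre p hp 1⟩
  rw [Metric.mem_ball, dist_comm]
  refine lt_of_le_of_lt ?_ hpd
  refine (ContinuousMap.dist_le dist_nonneg).2 fun t => ?_
  refine le_trans ?_ (ContinuousMap.dist_apply_le_dist t)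
  rw [Real.dist_eq, Complex.dist_eq]
  have := Complex.abs_re_le_norm (cC t - p t)
  simpa [cC, re] using this

lemma tendsto_of_approx {ι : Type*} {l : Filter ι} {T : ι → ℝ} {T₀ : ℝ}
    (h : ∀ δ > 0, ∃ (T' : ι → ℝ) (T₀' : ℝ), Tendsto T' l (𝓝 T₀') ∧ (∀ᶠ i in l, |T i - T' i| ≤ δ) ∧
      |T₀ - T₀'| ≤ δ) : Tendsto T l (𝓝 T₀) := by
  rw [Metric.tendsto_nhds]
  intro δ hδ
  obtain ⟨T', T₀', h1, h2, h3⟩ := h (δ / 3) (by positivity)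
  filter_upwards [h2, Metric.tendsto_nhds.1 h1 (δ / 3) (by positivity)] with i hi hi'
  rw [Real.dist_eq] at *
  have : T i - T₀ = (T i - T' i) + (T' i - T₀') - (T₀ - T₀') := by ring
  rw [this]
  calc _ ≤ |T i - T' i + (T' i - T₀')| + |T₀ - T₀'| := abs_sub _ _
    _ ≤ |T i - T' i| + |T' i - T₀'| + |T₀ - T₀'| := by gcongr; exact abs_add_le _ _
    _ < δ := by linarith

lemma memLp_smul_const {X F : Type*} [MeasurableSpace X] {μ : Measure X} [NormedAddCommGroup F]
    [NormedSpace ℝ F] {f : X → ℝ} (hf : MemLp f 2 μ) (b : F) : MemLp (fun x => f x • b) 2 μ :=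
  ((ContinuousLinearMap.id ℝ ℝ).smulRight b).comp_memLp' hf

/-- A linear functional of norm at most `C` on `L²(μ; V)`, given on functions rather than on their
classes modulo equality almost everywhere. -/
structure IsL2Functional {X V : Type*} [MeasurableSpace X] [NormedAddCommGroup V] [NormedSpace ℝ V]
    (μ : Measure X) (C : ℝ) (T : (X → V) → ℝ) : Prop where
  add : ∀ ψ ψ' : X → V, MemLp ψ 2 μ → MemLp ψ' 2 μ → T (fun x => ψ x + ψ' x) = T ψ + T ψ'
  smul : ∀ (a : ℝ) (ψ : X → V), MemLp ψ 2 μ → T (fun x => a • ψ x) = a * T ψ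
  bound : ∀ ψ : X → V, MemLp ψ 2 μ → |T ψ| ≤ C * lpNorm ψ 2 μ

section

variable {X V : Type*} [MeasurableSpace X] [NormedAddCommGroup V] [NormedSpace ℝ V]
  {μ : Measure X}

lemma IsL2Functional.abs_sub_le {C : ℝ} {T : (X → V) → ℝ} (hT : IsL2Functional μ C T)
    {ψ ψ' : X → V} (hψ : MemLp ψ 2 μ) (hψ' : MemLp ψ' 2 μ) :
    |T ψ - T ψ'| ≤ C * lpNorm (ψ - ψ') 2 μ := by
  have h := hT.add (ψ - ψ') ψ' (hψ.sub hψ') hψ'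
  simp only [Pi.sub_apply, sub_add_cancel] at h
  rw [show T ψ = T (ψ - ψ') + T ψ' from h, add_sub_cancel_right]
  exact hT.bound _ (hψ.sub hψ')

/-- Sums of products `f s` of a scalar function and an element `s` of a set with dense span are
dense in `L²(μ; V)`. -/
lemma exists_approx_of_span [IsFiniteMeasure μ] {S : Set V} (hS : Dense (Submodule.span ℝ S : Set V))
    {Q : (X → V) → Prop}
    (hmeas : ∀ ψ, Q ψ → AEStronglyMeasurable ψ μ)
    (hadd : ∀ ψ ψ', Q ψ → Q ψ' → Q (fun x => ψ x + ψ' x))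
    (hsmul : ∀ (a : ℝ) (ψ), Q ψ → Q (fun x => a • ψ x))
    (hbase : ∀ s ∈ S, ∀ f : X → ℝ, MemLp f 2 μ → Q (fun x => f x • s)) (hzero : Q (fun _ => 0))
    {ψ : X → V} (hψ : MemLp ψ 2 μ) {δ : ENNReal} (hδ : δ ≠ 0) :
    ∃ ψ', eLpNorm (ψ - ψ') 2 μ ≤ δ ∧ Q ψ' := by
  have hspan : ∀ (f : X → ℝ), MemLp f 2 μ → ∀ p ∈ Submodule.span ℝ S, Q (fun x => f x • p) := by
    intro f hf p hp
    induction hp using Submodule.span_induction with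
    | mem x hx => exact hbase x hx f hf
    | zero => simpa using hzero
    | add x y _ _ hx hy => simpa [smul_add] using hadd _ _ hx hy
    | smul c x _ hx => simpa [smul_comm c] using hsmul c _ hx
  refine hψ.induction_dense (by simp) Q ?_ hadd hmeas hδ
  intro c A hA hAfin δ hδ
  obtain ⟨q, hq0, hq⟩ : ∃ q : ℝ, 0 < q ∧ ENNReal.ofReal q * μ A ^ (1 / 2 : ℝ) ≤ δ := by
    rcases eq_or_ne δ ⊤ with h | h
    · exact ⟨1, one_pos, by simp [h]⟩
    have hm : μ A ^ (1 / 2 : ℝ) ≠ ⊤ := ENNReal.rpow_ne_top_of_nonneg (by norm_num) hAfin.ne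
    set m := (μ A ^ (1 / 2 : ℝ)).toReal with hmdef
    have hm0 : 0 ≤ m := ENNReal.toReal_nonneg
    have hδ0 : 0 < δ.toReal := ENNReal.toReal_pos hδ h
    refine ⟨δ.toReal / (m + 1), by positivity, ?_⟩
    rw [← ENNReal.ofReal_toReal hm, ← hmdef, ← ENNReal.ofReal_mul (by positivity)]
    refine ENNReal.ofReal_le_of_le_toReal ?_
    rw [div_mul_eq_mul_div, div_le_iff₀ (by positivity)]
    nlinarith
  obtain ⟨p, hpd, hp⟩ := Metric.dense_iff.1 hS c q hq0
  have hind : MemLp (A.indicator fun _ => (1 : ℝ)) 2 μ :=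
    (memLp_const (1 : ℝ)).indicator hA
  refine ⟨fun x => A.indicator (fun _ => (1 : ℝ)) x • p, ?_, hspan _ hind p hp⟩
  have e : (fun x => A.indicator (fun _ => (1 : ℝ)) x • p) - A.indicator (fun _ => c) =
      A.indicator (fun _ => p - c) := by
    ext1 x
    by_cases h : x ∈ A <;> simp [h]
  rw [e]
  refine (eLpNorm_indicator_const_le _ _).trans ?_
  refine le_trans ?_ hq
  have h2 : ‖p - c‖ₑ ≤ ENNReal.ofReal q := by
    rw [← ofReal_norm, ← dist_eq_norm]
    exact ENNReal.ofReal_le_ofReal (Metric.mem_ball.1 hpd).le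
  calc _ ≤ ENNReal.ofReal q * μ A ^ (1 / (2 : ENNReal).toReal) := by gcongr
    _ = _ := by simp

/-- Uniformly bounded functionals on `L²(μ; V)` converge as soon as they do on products `f s` with
`s` in a set with dense span. -/
lemma tendsto_of_isL2Functional [IsFiniteMeasure μ] {ι : Type*} {l : Filter ι}
    {S : Set V} (hS : Dense (Submodule.span ℝ S : Set V)) {C : ℝ} {T : ι → (X → V) → ℝ}
    {T₀ : (X → V) → ℝ} (hT : ∀ᶠ i in l, IsL2Functional μ C (T i)) (hT₀ : IsL2Functional μ C T₀)
    (hC : 0 ≤ C)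
    (hbase : ∀ s ∈ S, ∀ f : X → ℝ, MemLp f 2 μ →
      Tendsto (fun i => T i fun x => f x • s) l (𝓝 (T₀ fun x => f x • s)))
    {ψ : X → V} (hψ : MemLp ψ 2 μ) : Tendsto (fun i => T i ψ) l (𝓝 (T₀ ψ)) := by
  let Q : (X → V) → Prop := fun ψ => MemLp ψ 2 μ ∧ Tendsto (fun i => T i ψ) l (𝓝 (T₀ ψ))
  have hsmul : ∀ (a : ℝ) (ψ), Q ψ → Q (fun x => a • ψ x) := by
    intro a ψ h
    refine ⟨h.1.const_smul a, ?_⟩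
    rw [hT₀.smul a ψ h.1]
    refine (h.2.const_mul a).congr' ?_
    filter_upwards [hT] with i hi
    rw [hi.smul a ψ h.1]
  refine tendsto_of_approx fun δ hδ => ?_
  set q := δ / (C + 1) with hq
  have hq0 : 0 < q := by positivity
  have hCq : C * q ≤ δ := by
    rw [hq, mul_div_assoc', div_le_iff₀ (by positivity)]
    nlinarith
  have hzero : Q (fun _ => 0) := by
    refine ⟨MemLp.zero', ?_⟩
    have h0 : ∀ T : (X → V) → ℝ, IsL2Functional μ C T → T (fun _ => 0) = 0 := fun T h => by
      have := h.smul 0 (fun _ => 0) MemLp.zero'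
      simpa using this
    rw [h0 _ hT₀]
    refine tendsto_const_nhds.congr' ?_
    filter_upwards [hT] with i hi
    rw [h0 _ hi]
  obtain ⟨ψ', hψ', hQ⟩ := exists_approx_of_span (μ := μ) hS (Q := Q) (fun _ h => h.1.1) (by
      intro ψ ψ' h h'
      refine ⟨h.1.add h'.1, ?_⟩
      rw [hT₀.add ψ ψ' h.1 h'.1]
      refine (h.2.add h'.2).congr' ?_
      filter_upwards [hT] with i hi
      rw [hi.add ψ ψ' h.1 h'.1]) hsmul
    (fun s hs f hf => ⟨memLp_smul_const hf s, hbase s hs f hf⟩) hzero hψ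
    (δ := ENNReal.ofReal q) (by simpa using hq0)
  have hsubn : lpNorm (ψ - ψ') 2 μ ≤ q := by
    rw [← toReal_eLpNorm (hψ.sub hQ.1).1]
    exact ENNReal.toReal_le_of_le_ofReal hq0.le hψ'
  have hle : C * lpNorm (ψ - ψ') 2 μ ≤ δ := (mul_le_mul_of_nonneg_left hsubn hC).trans hCq
  refine ⟨_, _, hQ.2, ?_, (hT₀.abs_sub_le hψ hQ.1).trans hle⟩
  filter_upwards [hT] with i hi
  exact (hi.abs_sub_le hψ hQ.1).trans hle

end

/-! ### Convergence to mean values -/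

section

variable {Ω : Set (E d)} {D : E d → (E d ≃L[ℝ] E d)}

/-- The wave covector, as a vector: `D_x⁻ᵀ k`. -/
noncomputable def waveVec (D : E d → (E d ≃L[ℝ] E d)) (k : Fin d → ℤ) (x : E d) : E d :=
  (InnerProductSpace.toDual ℝ (E d)).symm (waveForm D k x)

lemma inner_waveVec (k : Fin d → ℤ) (x b : E d) : inner ℝ (waveVec D k x) b = waveForm D k x b :=
  InnerProductSpace.toDual_symm_apply

lemma waveForm_single (k : Fin d → ℤ) (x : E d) (i : Fin d) :
    waveForm D k x (EuclideanSpace.single i 1) = waveVec D k x i := by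
  rw [← inner_waveVec]
  simp [EuclideanSpace.inner_single_right]

lemma waveForm_eq_sum (k : Fin d → ℤ) (x b : E d) :
    waveForm D k x b = ∑ i, waveVec D k x i * b i := by
  rw [← inner_waveVec, PiLp.inner_apply]
  simp [mul_comm]

lemma IsTransformation.continuous_waveVec (hD : IsTransformation Ω D) (k : Fin d → ℤ) :
    Continuous (waveVec D k) :=
  (InnerProductSpace.toDual ℝ (E d)).symm.continuous.comp (hD.continuous_waveForm k)

lemma one_le_norm_latticePt {k : Fin d → ℤ} (hk : k ≠ 0) : 1 ≤ ‖(latticePt k : E d)‖ := by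
  obtain ⟨i, hi⟩ := Function.ne_iff.1 hk
  refine le_trans ?_ (PiLp.norm_apply_le (latticePt k : E d) i)
  have h1 : 1 ≤ |k i| := Int.one_le_abs hi
  have h2 : ((1 : ℤ) : ℝ) ≤ ((|k i| : ℤ) : ℝ) := Int.cast_le.2 h1
  simpa [latticePt] using h2

/-- As `|k|² = D_x⁻ᵀ k · D_x k`, wave vectors of nonzero frequency are bounded below. -/
lemma one_le_norm_waveVec {k : Fin d → ℤ} (hk : k ≠ 0) (x : E d) :
    1 ≤ ‖waveVec D k x‖ * ‖(D x : E d →L[ℝ] E d)‖ := by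
  have h1 := one_le_norm_latticePt hk
  have h2 : ‖(latticePt k : E d)‖ * ‖(latticePt k : E d)‖ ≤
      ‖waveVec D k x‖ * (‖(D x : E d →L[ℝ] E d)‖ * ‖(latticePt k : E d)‖) := by
    have e : inner ℝ (waveVec D k x) (D x (latticePt k)) = inner ℝ (latticePt k) (latticePt k) := by
      rw [inner_waveVec, waveForm_apply, ContinuousLinearEquiv.symm_apply_apply]
    rw [← real_inner_self_eq_norm_mul_norm, ← e]
    refine (real_inner_le_norm _ _).trans ?_
    exact mul_le_mul_of_nonneg_left ((D x : E d →L[ℝ] E d).le_opNorm _) (norm_nonneg _)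
  rw [← mul_assoc] at h2
  exact h1.trans (le_of_mul_le_mul_right h2 (by linarith))

lemma waveVec_ne_zero {k : Fin d → ℤ} (hk : k ≠ 0) (x : E d) : waveVec D k x ≠ 0 := by
  intro h
  have := one_le_norm_waveVec (D := D) hk x
  rw [h] at this
  simp at this
  linarith

/-- The vector `ω / |ω|²`, for the wave vector `ω = D_x⁻ᵀ k`; it is `0` for `k = 0`. -/
noncomputable def waveInv (D : E d → (E d ≃L[ℝ] E d)) (k : Fin d → ℤ) (x : E d) : E d :=
  (‖waveVec D k x‖ ^ 2)⁻¹ • waveVec D k x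

lemma sum_waveInv_mul {k : Fin d → ℤ} (hk : k ≠ 0) (x : E d) :
    ∑ i, waveInv D k x i * waveVec D k x i = 1 := by
  have h : ‖waveVec D k x‖ ^ 2 ≠ 0 := pow_ne_zero 2 (norm_ne_zero_iff.2 (waveVec_ne_zero hk x))
  have e : ∀ i, waveInv D k x i * waveVec D k x i =
      (‖waveVec D k x‖ ^ 2)⁻¹ * (waveVec D k x i) ^ 2 := fun i => by
    simp [waveInv]; ring
  simp only [e]
  rw [← Finset.mul_sum, ← EuclideanSpace.real_norm_sq_eq, inv_mul_cancel₀ h]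

lemma norm_waveInv_le {k : Fin d → ℤ} (hk : k ≠ 0) (x : E d) :
    ‖waveInv D k x‖ ≤ ‖(D x : E d →L[ℝ] E d)‖ := by
  have h : 0 < ‖waveVec D k x‖ := norm_pos_iff.2 (waveVec_ne_zero hk x)
  rw [waveInv, norm_smul, norm_inv, norm_pow, norm_norm, sq, mul_inv, mul_assoc,
    inv_mul_cancel₀ h.ne', mul_one, inv_le_iff_one_le_mul₀' h]
  exact one_le_norm_waveVec hk x

lemma IsTransformation.continuous_waveInv (hD : IsTransformation Ω D) {k : Fin d → ℤ} (hk : k ≠ 0) :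
    Continuous (waveInv D k) := by
  have h := hD.continuous_waveVec k
  exact ((h.norm.pow 2).inv₀ fun x => pow_ne_zero 2
    (norm_ne_zero_iff.2 (waveVec_ne_zero hk x))).smul h

lemma IsTransformation.exists_norm_le (hD : IsTransformation Ω D) (hb : Bornology.IsBounded Ω) :
    ∃ M : ℝ, 0 ≤ M ∧ ∀ x ∈ Ω, ‖(D x : E d →L[ℝ] E d)‖ ≤ M := by
  obtain ⟨K, hK⟩ := hD.lipschitz
  obtain ⟨M, hM⟩ := hb.isCompact_closure.exists_bound_of_continuousOn hK.continuous.continuousOn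
  exact ⟨max M 0, le_max_right _ _, fun x hx => (hM x (subset_closure hx)).trans (le_max_left _ _)⟩

lemma memLp_mul_waveInv (hΩ : IsOpen Ω) (hb : Bornology.IsBounded Ω) (hD : IsTransformation Ω D)
    {k : Fin d → ℤ} (hk : k ≠ 0) {f : E d → ℝ} (hf : MemLp f 2 (volume.restrict Ω)) (i : Fin d) :
    MemLp (fun x => f x * waveInv D k x i) 2 (volume.restrict Ω) := by
  obtain ⟨M, hM0, hM⟩ := hD.exists_norm_le hb
  have hc : Continuous fun x => waveInv D k x i :=
    (EuclideanSpace.proj (𝕜 := ℝ) i).continuous.comp (hD.continuous_waveInv hk)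
  refine MemLp.of_le_mul (g := f) (c := M) hf (hf.1.mul hc.aestronglyMeasurable) ?_
  filter_upwards [ae_restrict_mem hΩ.measurableSet] with x hx
  rw [norm_mul, mul_comm]
  refine mul_le_mul_of_nonneg_right ?_ (norm_nonneg _)
  exact (PiLp.norm_apply_le _ i).trans ((norm_waveInv_le hk x).trans (hM x hx))

/-- A bounded family in `H¹(Ω)` does not see the modes of nonzero frequency. This is the oscillation
lemma for the fields `u^ε e_i`, whose divergence `∂_i u^ε` is bounded. -/
lemma tendsto_integral_mul_trig (hΩ : IsOpen Ω) (hb : Bornology.IsBounded Ω)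
    (hD : IsTransformation Ω D) {r : ℝ} (hr₀ : 0 < r) (hr₁ : r < 1) {P : ℝ → CubeFamily d}
    (hP : ∀ ε : ℝ, 0 < ε → (P ε).IsPartition Ω (ε ^ r))
    {u : ℝ → E d → ℝ} {g : ℝ → E d → E d} {C : ℝ}
    (hu : ∀ ε, 0 < ε → IsH1 Ω (u ε) (g ε))
    (huC : ∀ ε, 0 < ε → lpNorm (u ε) 2 (volume.restrict Ω) ≤ C)
    (hgC : ∀ ε, 0 < ε → lpNorm (g ε) 2 (volume.restrict Ω) ≤ C)
    {k : Fin d → ℤ} (hk : k ≠ 0) (θ : ℝ) {f : E d → ℝ} (hf : MemLp f 2 (volume.restrict Ω)) :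
    Tendsto (fun ε => ∫ x in Ω, u ε x *
      (f x * locPerApprox D (P ε) ε (fun _ => trig k θ) x)) (𝓝[>] (0 : ℝ)) (𝓝 0) := by
  have hfin : IsFiniteMeasure (volume.restrict Ω) :=
    isFiniteMeasure_restrict.2 hb.measure_lt_top.ne
  have hdir : ∀ i : Fin d, ∀ h : E d → ℝ, MemLp h 2 (volume.restrict Ω) →
      Tendsto (fun ε => ∫ x in Ω, h x * (locPerApprox D (P ε) ε (fun _ => trig k θ) x *
        waveForm D k x (u ε x • EuclideanSpace.single i 1))) (𝓝[>] (0 : ℝ)) (𝓝 0) := by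
    intro i h hh
    set b : E d := EuclideanSpace.single i 1 with hbdef
    have hbn : ‖b‖ = 1 := by simp [hbdef]
    refine tendsto_integral_osc hΩ hb hD hr₀ hr₁ hP (α := fun ε x => u ε x • b)
      (β := fun ε x => -inner ℝ (g ε x) b) (C := C) ?_ ?_ ?_ ?_ ?_ k θ hh
    · intro ε hε
      exact memLp_smul_const (hu ε hε).memLp b
    · intro ε hε
      exact ((hu ε hε).memLp_grad.inner_const b).neg
    · intro ε hε
      refine le_trans (le_of_eq ?_) (huC ε hε)
      rw [lpNorm_two_eq (memLp_smul_const (hu ε hε).memLp b).1, lpNorm_two_eq (hu ε hε).memLp.1]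
      simp [norm_smul, hbn]
    · intro ε hε
      refine le_trans ?_ (hgC ε hε)
      have hgn := (hu ε hε).memLp_grad
      rw [lpNorm_fun_neg, ← lpNorm_norm hgn.1]
      refine lpNorm_mono_real hgn.norm fun x => ?_
      simpa [hbn] using norm_inner_le_norm (𝕜 := ℝ) (g ε x) b
    · intro ε hε Φ hΦ
      simp only [map_smul, smul_eq_mul]
      rw [(hu ε hε).integral_fderiv hΦ, ← integral_neg]
      congr 1
      ext x
      ring
  -- by `∑ (ω_i / |ω|²) ω_i = 1`, the mode is a combination of the directions `e_i`
  have hsum := tendsto_finsetSum Finset.univ fun i (_ : i ∈ Finset.univ) =>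
    hdir i _ (memLp_mul_waveInv hΩ hb hD hk hf i)
  simp only [Finset.sum_const_zero] at hsum
  refine hsum.congr' ?_
  filter_upwards [self_mem_nhdsWithin] with ε hε
  have hε : 0 < ε := hε
  rw [← integral_finsetSum]
  · congr 1
    ext x
    simp only [map_smul, waveForm_single, smul_eq_mul]
    calc _ = u ε x * (f x * locPerApprox D (P ε) ε (fun _ => trig k θ) x) *
          ∑ i, waveInv D k x i * waveVec D k x i := by
          rw [Finset.mul_sum]
          exact Finset.sum_congr rfl fun i _ => by ring
      _ = _ := by rw [sum_waveInv_mul hk, mul_one]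
  · intro i _
    exact (memLp_mul_waveInv hΩ hb hD hk hf i).integrable_mul
      (memLp_locPerApprox_trig_waveForm hΩ hb hD (hP ε hε) (Real.rpow_pos_of_pos hε r) k _
        (memLp_smul_const (hu ε hε).memLp _))

lemma CubeFamily.IsPartition.locPerApprox_const_ae {P : CubeFamily d} {s ε : ℝ}
    (hP : P.IsPartition Ω s) (hs : 0 < s) (hΩ : IsOpen Ω) (a : ℝ) :
    ∀ᵐ x ∂volume.restrict Ω, locPerApprox D P ε (fun _ => ContinuousMap.const _ a) x = a := by
  filter_upwards [hP.ae_mem hs hΩ] with x hx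
  obtain ⟨n, hn⟩ := hx
  rw [hP.locPerApprox_eq hn]
  rfl

/-- Pairing with `𝓛^ε ψ` is a bounded functional of `ψ ∈ L²(Ω; C_per(Y))`. -/
lemma CubeFamily.IsPartition.isL2Functional {P : CubeFamily d} {s : ℝ} (hP : P.IsPartition Ω s)
    (hs : 0 < s) (ε : ℝ) (D : E d → (E d ≃L[ℝ] E d)) {μ : Measure (E d)} {w : E d → ℝ}
    (hw : MemLp w 2 μ) {C : ℝ} (hC : lpNorm w 2 μ ≤ C) :
    IsL2Functional μ C (fun ψ : E d → Cper d => ∫ x, w x * locPerApprox D P ε ψ x ∂μ) where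
  add ψ ψ' h h' := by
    have i1 : Integrable (fun x => w x * locPerApprox D P ε ψ x) μ :=
      hw.integrable_mul (hP.memLp_locPerApprox hs h)
    have i2 : Integrable (fun x => w x * locPerApprox D P ε ψ' x) μ :=
      hw.integrable_mul (hP.memLp_locPerApprox hs h')
    rw [← integral_add i1 i2]
    exact integral_congr_ae (ae_of_all _ fun x => by
      change w x * locPerApprox D P ε (fun x => ψ x + ψ' x) x = _
      rw [locPerApprox_add, mul_add])
  smul a ψ h := by
    rw [← integral_const_mul]
    exact integral_congr_ae (ae_of_all _ fun x => by
      have := locPerApprox_smul (D := D) (P := P) (ε := ε) (fun _ => a) ψ x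
      beta_reduce
      rw [this, mul_left_comm])
  bound ψ h := by
    refine (abs_integral_le_lpNorm_mul hw h (ae_of_all _ fun x => ?_)).trans
      (mul_le_mul_of_nonneg_right hC lpNorm_nonneg)
    rw [abs_mul]
    exact mul_le_mul_of_nonneg_left (hP.abs_locPerApprox_le ψ x) (abs_nonneg _)

lemma isL2Functional_torusMean {μ : Measure (E d)} {w : E d → ℝ}
    (hw : MemLp w 2 μ) {C : ℝ} (hC : lpNorm w 2 μ ≤ C) :
    IsL2Functional μ C (fun ψ : E d → Cper d => ∫ x, w x * torusMean (ψ x) ∂μ) where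
  add ψ ψ' h h' := by
    have i1 : Integrable (fun x => w x * torusMean (ψ x)) μ :=
      hw.integrable_mul (torusMean.comp_memLp' h)
    have i2 : Integrable (fun x => w x * torusMean (ψ' x)) μ :=
      hw.integrable_mul (torusMean.comp_memLp' h')
    rw [← integral_add i1 i2]
    exact integral_congr_ae (ae_of_all _ fun x => by
      beta_reduce
      rw [map_add, mul_add])
  smul a ψ h := by
    rw [← integral_const_mul]
    exact integral_congr_ae (ae_of_all _ fun x => by
      beta_reduce
      rw [map_smul, smul_eq_mul, mul_left_comm])
  bound ψ h := by
    refine (abs_integral_le_lpNorm_mul hw h (ae_of_all _ fun x => ?_)).trans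
      (mul_le_mul_of_nonneg_right hC lpNorm_nonneg)
    rw [abs_mul]
    exact mul_le_mul_of_nonneg_left (abs_torusMean_le _) (abs_nonneg _)

/-- Bounded families in `H¹(Ω)` that converge weakly in `L²(Ω)` converge locally periodically in
the two-scale sense, to a limit that does not depend on the fast variable. -/
theorem tendsto_integral_mul_locPerApprox (hΩ : IsOpen Ω) (hb : Bornology.IsBounded Ω)
    (hD : IsTransformation Ω D) {r : ℝ} (hr₀ : 0 < r) (hr₁ : r < 1) {P : ℝ → CubeFamily d}
    (hP : ∀ ε : ℝ, 0 < ε → (P ε).IsPartition Ω (ε ^ r))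
    {u : ℝ → E d → ℝ} {g : ℝ → E d → E d} {C : ℝ}
    (hu : ∀ ε, 0 < ε → IsH1 Ω (u ε) (g ε))
    (huC : ∀ ε, 0 < ε → lpNorm (u ε) 2 (volume.restrict Ω) ≤ C)
    (hgC : ∀ ε, 0 < ε → lpNorm (g ε) 2 (volume.restrict Ω) ≤ C)
    {u₀ : E d → ℝ} (hu₀ : MemLp u₀ 2 (volume.restrict Ω))
    (hweak : ∀ f : E d → ℝ, MemLp f 2 (volume.restrict Ω) →
      Tendsto (fun ε => ∫ x in Ω, u ε x * f x) (𝓝[>] (0 : ℝ)) (𝓝 (∫ x in Ω, u₀ x * f x)))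
    {ψ : E d → Cper d} (hψ : MemLp ψ 2 (volume.restrict Ω)) :
    Tendsto (fun ε => ∫ x in Ω, u ε x * locPerApprox D (P ε) ε ψ x) (𝓝[>] (0 : ℝ))
      (𝓝 (∫ x in Ω, u₀ x * torusMean (ψ x))) := by
  have hfin : IsFiniteMeasure (volume.restrict Ω) :=
    isFiniteMeasure_restrict.2 hb.measure_lt_top.ne
  have hC0 : 0 ≤ C := lpNorm_nonneg.trans (huC 1 one_pos)
  have hpos : ∀ᶠ ε in 𝓝[>] (0 : ℝ), 0 < ε := self_mem_nhdsWithin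
  refine tendsto_of_isL2Functional (C := C + lpNorm u₀ 2 (volume.restrict Ω))
    (T := fun ε ψ => ∫ x in Ω, u ε x * locPerApprox D (P ε) ε ψ x)
    (T₀ := fun ψ => ∫ x in Ω, u₀ x * torusMean (ψ x))
    dense_span_trig ?_ (isL2Functional_torusMean hu₀ (by linarith))
    (add_nonneg hC0 lpNorm_nonneg) ?_ hψ
  · filter_upwards [hpos] with ε hε
    exact (hP ε hε).isL2Functional (Real.rpow_pos_of_pos hε r) ε D (hu ε hε).memLp
      ((huC ε hε).trans (le_add_of_nonneg_right lpNorm_nonneg))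
  · rintro _ ⟨⟨k, θ⟩, rfl⟩ f hf
    simp only [locPerApprox_smul, map_smul, smul_eq_mul]
    by_cases hk : k = 0
    · subst hk
      have e : torusMean (trig (0 : Fin d → ℤ) θ) = Real.cos θ := by
        rw [trig_zero, torusMean_apply]
        simp
      rw [e]
      refine (hweak _ (hf.mul_const (Real.cos θ))).congr' ?_
      filter_upwards [hpos] with ε hε
      refine integral_congr_ae ?_
      filter_upwards [(hP ε hε).locPerApprox_const_ae (D := D) (ε := ε)
        (Real.rpow_pos_of_pos hε r) hΩ (Real.cos θ)] with x hx
      rw [trig_zero, hx]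
    · rw [torusMean_trig hk]
      simp only [mul_zero, integral_zero]
      exact tendsto_integral_mul_trig hΩ hb hD hr₀ hr₁ hP hu huC hgC hk θ hf

end

/-! ### Weak compactness -/

lemma norm_toLp_eq_lpNorm {X V : Type*} [MeasurableSpace X] [NormedAddCommGroup V] {μ : Measure X}
    {ψ : X → V} (hψ : MemLp ψ 2 μ) : ‖hψ.toLp ψ‖ = lpNorm ψ 2 μ := by
  rw [Lp.norm_toLp, toReal_eLpNorm hψ.1]

section

variable {X V : Type*} [MeasurableSpace X] [NormedAddCommGroup V] [NormedSpace ℝ V]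
  {μ : Measure X} {C : ℝ}

lemma isL2Functional_zero (hC : 0 ≤ C) : IsL2Functional μ C (fun _ : X → V => 0) where
  add := by simp
  smul := by simp
  bound ψ _ := by simpa using mul_nonneg hC lpNorm_nonneg

lemma IsL2Functional.congr {T : (X → V) → ℝ} (hT : IsL2Functional μ C T) {ψ ψ' : X → V}
    (hψ : MemLp ψ 2 μ) (h : ψ =ᵐ[μ] ψ') : T ψ = T ψ' := by
  have hψ' : MemLp ψ' 2 μ := (memLp_congr_ae h).1 hψ
  have h1 := hT.abs_sub_le hψ hψ'
  have h0 : lpNorm (ψ - ψ') 2 μ = 0 := by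
    rw [lpNorm_eq_zero (hψ.sub hψ') (by simp)]
    filter_upwards [h] with x hx
    simp [hx]
  rw [h0, mul_zero] at h1
  exact sub_eq_zero.1 (abs_nonpos_iff.1 h1)

/-- The element of the dual of `L²(μ; V)` given by a bounded functional. -/
noncomputable def IsL2Functional.toDual {T : (X → V) → ℝ} (hT : IsL2Functional μ C T) :
    StrongDual ℝ (Lp V 2 μ) :=
  LinearMap.mkContinuous
    { toFun := fun ψ => T ψ
      map_add' := fun ψ ψ' => by
        rw [← hT.add _ _ (Lp.memLp ψ) (Lp.memLp ψ')]
        exact hT.congr (Lp.memLp _) (Lp.coeFn_add ψ ψ')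
      map_smul' := fun a ψ => by
        rw [RingHom.id_apply, smul_eq_mul, ← hT.smul a _ (Lp.memLp ψ)]
        exact hT.congr (Lp.memLp _) (Lp.coeFn_smul a ψ) } C fun ψ => by
    have h := hT.bound ψ (Lp.memLp ψ)
    rwa [← norm_toLp_eq_lpNorm (Lp.memLp ψ), Lp.toLp_coeFn] at h

/-- Sequential weak-* compactness, for functionals on a separable space `L²(μ; V)`. -/
lemma exists_subseq_isL2Functional [TopologicalSpace.SeparableSpace (Lp V 2 μ)] (hC : 0 ≤ C)
    {T : ℕ → (X → V) → ℝ} (hT : ∀ᶠ j in atTop, IsL2Functional μ C (T j)) :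
    ∃ k : ℕ → ℕ, StrictMono k ∧ ∃ F : (X → V) → ℝ, IsL2Functional μ C F ∧
      ∀ ψ, MemLp ψ 2 μ → Tendsto (fun j => T (k j) ψ) atTop (𝓝 (F ψ)) := by
  classical
  -- finitely many of the `T j` may fail to be bounded functionals: they are replaced by `0`
  let T' : ℕ → (X → V) → ℝ := fun j => if IsL2Functional μ C (T j) then T j else fun _ => 0
  have hT' : ∀ j, IsL2Functional μ C (T' j) := by
    intro j
    by_cases h : IsL2Functional μ C (T j)
    · simp [T', h]
    · simp only [T', h, if_false]
      exact isL2Functional_zero hC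
  have hmem : ∀ j, StrongDual.toWeakDual (hT' j).toDual ∈
      WeakDual.toStrongDual ⁻¹' Metric.closedBall (0 : StrongDual ℝ (Lp V 2 μ)) C := by
    intro j
    simp only [mem_preimage, mem_closedBall_zero_iff]
    refine ContinuousLinearMap.opNorm_le_bound _ hC fun ψ => ?_
    rw [← Lp.toLp_coeFn ψ (Lp.memLp ψ), norm_toLp_eq_lpNorm, Lp.toLp_coeFn]
    exact (hT' j).bound ψ (Lp.memLp ψ)
  obtain ⟨f, hf, k, hk, hlim⟩ := WeakDual.isSeqCompact_closedBall ℝ (Lp V 2 μ) 0 C hmem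
  have hf' : ‖WeakDual.toStrongDual f‖ ≤ C := by simpa using hf
  let F : (X → V) → ℝ := fun ψ => if h : MemLp ψ 2 μ then f (h.toLp ψ) else 0
  have hF : ∀ {ψ} (h : MemLp ψ 2 μ), F ψ = f (h.toLp ψ) := fun h => by simp [F, h]
  refine ⟨k, hk, F, ⟨?_, ?_, ?_⟩, ?_⟩
  · intro ψ ψ' h h'
    refine (hF (h.add h')).trans ?_
    rw [hF h, hF h', ← map_add]
    rfl
  · intro a ψ h
    refine (hF (h.const_smul a)).trans ?_
    rw [hF h, ← smul_eq_mul, ← map_smul]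
    rfl
  · intro ψ h
    rw [hF h, ← norm_toLp_eq_lpNorm h]
    exact ((WeakDual.toStrongDual f).le_opNorm _).trans
      (mul_le_mul_of_nonneg_right hf' (norm_nonneg _))
  · intro ψ h
    rw [hF h]
    have h2 : Tendsto (fun j => StrongDual.toWeakDual (hT' (k j)).toDual (h.toLp ψ)) atTop
        (𝓝 (f (h.toLp ψ))) := ((WeakDual.eval_continuous (h.toLp ψ)).tendsto f).comp hlim
    refine h2.congr' ?_
    filter_upwards [hk.tendsto_atTop.eventually hT] with j hj
    have e : T' (k j) = T (k j) := by simp [T', hj]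
    change T' (k j) (h.toLp ψ) = T (k j) ψ
    rw [e]
    exact hj.congr (Lp.memLp _) h.coeFn_toLp

/-- Simultaneous extraction for finitely many sequences of functionals. -/
lemma exists_subseq_isL2Functional_pi [TopologicalSpace.SeparableSpace (Lp V 2 μ)] (hC : 0 ≤ C) {ι : Type*}
    [Finite ι] {T : ℕ → ι → (X → V) → ℝ} (hT : ∀ᶠ j in atTop, ∀ i, IsL2Functional μ C (T j i)) :
    ∃ k : ℕ → ℕ, StrictMono k ∧ ∃ F : ι → (X → V) → ℝ, ∀ i, IsL2Functional μ C (F i) ∧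
      ∀ ψ, MemLp ψ 2 μ → Tendsto (fun j => T (k j) i ψ) atTop (𝓝 (F i ψ)) := by
  classical
  have := Fintype.ofFinite ι
  have h : ∀ s : Finset ι, ∃ k : ℕ → ℕ, StrictMono k ∧ ∀ i ∈ s, ∃ F : (X → V) → ℝ,
      IsL2Functional μ C F ∧
      ∀ ψ, MemLp ψ 2 μ → Tendsto (fun j => T (k j) i ψ) atTop (𝓝 (F ψ)) := by
    intro s
    induction s using Finset.induction_on with
    | empty => exact ⟨id, strictMono_id, by simp⟩
    | insert i s _ ih =>
      obtain ⟨k, hk, hs⟩ := ih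
      have hT' : ∀ᶠ j in atTop, IsL2Functional μ C (T (k j) i) := by
        filter_upwards [hk.tendsto_atTop.eventually hT] with j hj using hj i
      obtain ⟨k', hk', F, hF⟩ := exists_subseq_isL2Functional hC hT'
      refine ⟨k ∘ k', hk.comp hk', fun m hm => ?_⟩
      rcases Finset.mem_insert.1 hm with rfl | hm
      · exact ⟨F, hF⟩
      · obtain ⟨F', hF', hlim⟩ := hs m hm
        exact ⟨F', hF', fun ψ hψ => (hlim ψ hψ).comp hk'.tendsto_atTop⟩
  obtain ⟨k, hk, hF⟩ := h Finset.univ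
  choose F hF using fun i => hF i (Finset.mem_univ i)
  exact ⟨k, hk, F, hF⟩

end

/-- A linear functional dominated by the seminorm `‖J ·‖` of a Hilbert space is represented by a
vector of that space. -/
lemma exists_inner_eq_of_le_norm {A H : Type*} [AddCommGroup A] [Module ℝ A]
    [NormedAddCommGroup H] [InnerProductSpace ℝ H] [CompleteSpace H] (f : A →ₗ[ℝ] ℝ)
    (J : A →ₗ[ℝ] H) (C : ℝ) (h : ∀ a, |f a| ≤ C * ‖J a‖) : ∃ v : H, ∀ a, f a = inner ℝ v (J a) := by
  have hker : LinearMap.ker J ≤ LinearMap.ker f := by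
    intro a ha
    rw [LinearMap.mem_ker] at ha ⊢
    have := h a
    rw [ha, norm_zero, mul_zero] at this
    exact abs_nonpos_iff.1 this
  let f' : LinearMap.range J →ₗ[ℝ] ℝ :=
    ((LinearMap.ker J).liftQ f hker).comp (J.quotKerEquivRange.symm : _ →ₗ[ℝ] _)
  have hf' : ∀ a, f' ⟨J a, LinearMap.mem_range_self J a⟩ = f a := by
    intro a
    have := LinearMap.quotKerEquivRange_symm_apply_image J a (LinearMap.mem_range_self J a)
    simp only [f', LinearMap.comp_apply, LinearEquiv.coe_coe, this]
    simp
  let f'' : StrongDual ℝ (LinearMap.range J) := f'.mkContinuous C fun ⟨y, a, ha⟩ => by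
    subst ha
    rw [hf']
    exact h a
  obtain ⟨g, hg, -⟩ := exists_extension_norm_eq (LinearMap.range J) f''
  refine ⟨(InnerProductSpace.toDual ℝ H).symm g, fun a => ?_⟩
  rw [InnerProductSpace.toDual_symm_apply, ← hf' a]
  exact (hg ⟨J a, LinearMap.mem_range_self J a⟩).symm

/-- A bounded functional dominated by the seminorm `‖J ·‖` of a second space `L²(ν)` is represented
by a function of that space. -/
lemma IsL2Functional.exists_representation {X V Z : Type*} [MeasurableSpace X]
    [NormedAddCommGroup V] [NormedSpace ℝ V] {μ : Measure X} [MeasurableSpace Z] {ν : Measure Z}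
    {C : ℝ} {F : (X → V) → ℝ} (hF : IsL2Functional μ C F) (J : (X → V) →ₗ[ℝ] (Z → ℝ))
    (hJ : ∀ ψ, MemLp ψ 2 μ → MemLp (J ψ) 2 ν)
    (hle : ∀ ψ, MemLp ψ 2 μ → |F ψ| ≤ C * lpNorm (J ψ) 2 ν) :
    ∃ v : Z → ℝ, MemLp v 2 ν ∧ ∀ ψ, MemLp ψ 2 μ → F ψ = ∫ p, v p * J ψ p ∂ν := by
  let A : Submodule ℝ (X → V) :=
    { carrier := {ψ | MemLp ψ 2 μ}
      add_mem' := fun h h' => MemLp.add h h'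
      zero_mem' := MemLp.zero
      smul_mem' := fun a _ h => MemLp.const_smul h a }
  let f : A →ₗ[ℝ] ℝ :=
    { toFun := fun ψ => F ψ
      map_add' := fun ψ ψ' => hF.add _ _ ψ.2 ψ'.2
      map_smul' := fun a ψ => hF.smul a _ ψ.2 }
  let J' : A →ₗ[ℝ] Lp ℝ 2 ν :=
    { toFun := fun ψ => (hJ ψ ψ.2).toLp _
      map_add' := fun ψ ψ' => by
        rw [← MemLp.toLp_add]
        exact MemLp.toLp_congr _ _ (ae_of_all _ fun z => congrFun (map_add J ψ.1 ψ'.1) z)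
      map_smul' := fun a ψ => by
        rw [RingHom.id_apply, ← MemLp.toLp_const_smul]
        exact MemLp.toLp_congr _ _ (ae_of_all _ fun z => congrFun (map_smul J a ψ.1) z) }
  obtain ⟨v, hv⟩ := exists_inner_eq_of_le_norm f J' C fun ψ => by
    have h := hle ψ ψ.2
    rwa [← norm_toLp_eq_lpNorm (hJ ψ ψ.2)] at h
  refine ⟨v, Lp.memLp v, fun ψ hψ => ?_⟩
  refine (hv ⟨ψ, hψ⟩).trans ?_
  rw [L2.inner_def]
  refine integral_congr_ae ?_
  filter_upwards [(hJ ψ hψ).coeFn_toLp] with p hp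
  change inner ℝ (v p) (((hJ ψ hψ).toLp _ : Lp ℝ 2 ν) p) = _
  rw [hp]
  simp [mul_comm]

/-! ### Two-scale limits of bounded families in `L²` -/

section

variable {μ : Measure (E d)}

/-- A function on `Ω` with values in `C_per(Y)`, as a function on `Ω × 𝕋^d`. -/
def uncurryTorus (ψ : E d → Cper d) (p : E d × UnitAddTorus (Fin d)) : ℝ := ψ p.1 p.2

/-- `uncurryTorus` as a linear map. -/
def uncurryTorusₗ : (E d → Cper d) →ₗ[ℝ] (E d × UnitAddTorus (Fin d) → ℝ) where
  toFun := uncurryTorus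
  map_add' _ _ := rfl
  map_smul' _ _ := rfl

lemma memLp_uncurryTorus [SFinite μ] {ψ : E d → Cper d} (hψ : MemLp ψ 2 μ) :
    MemLp (uncurryTorus ψ) 2 (μ.prod (torusMeasure d)) := by
  have h : MemLp (fun p : E d × UnitAddTorus (Fin d) => ψ p.1) 2 (μ.prod (torusMeasure d)) :=
    hψ.comp_measurePreserving measurePreserving_fst
  have he : Continuous fun p : Cper d × UnitAddTorus (Fin d) => p.1 p.2 := by fun_prop
  exact h.mono (he.comp_aestronglyMeasurable (h.1.prodMk
      (continuous_snd.aestronglyMeasurable)))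
    (ae_of_all _ fun p => (ψ p.1).norm_coe_le_norm p.2)

/-- The supremum norm on `C_per(Y)` dominates the norm of `L²(𝕋^d)`. -/
lemma lpNorm_uncurryTorus_le [SFinite μ] {ψ : E d → Cper d} (hψ : MemLp ψ 2 μ) :
    lpNorm (uncurryTorus ψ) 2 (μ.prod (torusMeasure d)) ≤ lpNorm ψ 2 μ := by
  have hmp : MeasurePreserving (Prod.fst : E d × UnitAddTorus (Fin d) → E d)
    (μ.prod (torusMeasure d)) μ := measurePreserving_fst
  rw [← toReal_eLpNorm hψ.1, ← toReal_eLpNorm (memLp_uncurryTorus hψ).1,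
    ← eLpNorm_comp_measurePreserving hψ.1 hmp]
  refine ENNReal.toReal_mono ?_ (eLpNorm_mono fun p => (ψ p.1).norm_coe_le_norm p.2)
  exact (hψ.comp_measurePreserving hmp).eLpNorm_ne_top

end

section

variable {Ω : Set (E d)} {D : E d → (E d ≃L[ℝ] E d)}

/-- For bounded `ψ`, the norm of `𝓛^ε ψ` in `L²(Ω)` converges to the norm of `ψ` in
`L²(Ω × 𝕋^d)`: since `(𝓛^ε ψ)² = 𝓛^ε (ψ²)`, this is convergence to a mean value. -/
lemma tendsto_lpNorm_locPerApprox (hΩ : IsOpen Ω) (hb : Bornology.IsBounded Ω)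
    (hD : IsTransformation Ω D) {r : ℝ} (hr₀ : 0 < r) (hr₁ : r < 1) {P : ℝ → CubeFamily d}
    (hP : ∀ ε : ℝ, 0 < ε → (P ε).IsPartition Ω (ε ^ r)) {ψ : E d → Cper d}
    (hψ : MemLp ψ 2 (volume.restrict Ω)) {B : ℝ} (hB : ∀ x, ‖ψ x‖ ≤ B) :
    Tendsto (fun ε => lpNorm (locPerApprox D (P ε) ε ψ) 2 (volume.restrict Ω)) (𝓝[>] (0 : ℝ))
      (𝓝 (lpNorm (uncurryTorus ψ) 2 ((volume.restrict Ω).prod (torusMeasure d)))) := by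
  have hfin : IsFiniteMeasure (volume.restrict Ω) :=
    isFiniteMeasure_restrict.2 hb.measure_lt_top.ne
  set μ := volume.restrict Ω with hμ
  let ψ2 : E d → Cper d := fun x => ψ x * ψ x
  have hψ2 : MemLp ψ2 2 μ := by
    refine MemLp.of_bound ((continuous_mul).comp_aestronglyMeasurable (hψ.1.prodMk hψ.1)) (B * B)
      (ae_of_all _ fun x => (norm_mul_le _ _).trans ?_)
    exact mul_le_mul (hB x) (hB x) (norm_nonneg _) ((norm_nonneg _).trans (hB x))
  -- the constant family `1` in `H¹(Ω)`, tested with `ψ²`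
  have h := tendsto_integral_mul_locPerApprox hΩ hb hD hr₀ hr₁ hP
    (u := fun _ _ => 1) (g := fun _ _ => 0) (C := lpNorm (fun _ : E d => (1 : ℝ)) 2 μ)
    (u₀ := fun _ => 1) (fun ε _ => isH1_one) (fun _ _ => le_rfl)
    (fun _ _ => by
      have : lpNorm (fun _ : E d => (0 : E d)) 2 μ = 0 := lpNorm_zero 2 μ
      exact this.trans_le lpNorm_nonneg) (memLp_const 1) (fun _ _ => tendsto_const_nhds) hψ2
  simp only [one_mul] at h
  have e1 : ∫ x, torusMean (ψ2 x) ∂μ =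
      ∫ p, ‖uncurryTorus ψ p‖ ^ 2 ∂(μ.prod (torusMeasure d)) := by
    rw [integral_prod _ ((memLp_uncurryTorus hψ).integrable_norm_pow (by simp))]
    refine integral_congr_ae (ae_of_all _ fun x => ?_)
    beta_reduce
    rw [torusMean_apply]
    refine integral_congr_ae (ae_of_all _ fun t => ?_)
    simp [ψ2, uncurryTorus, sq]
  rw [e1] at h
  rw [lpNorm_two_eq (memLp_uncurryTorus hψ).1]
  refine ((Real.continuous_sqrt.tendsto _).comp h).congr' ?_
  filter_upwards [self_mem_nhdsWithin] with ε hε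
  rw [lpNorm_two_eq ((hP ε hε).aestronglyMeasurable_locPerApprox
    (Real.rpow_pos_of_pos hε r) hψ.1)]
  change √_ = √_
  congr 1
  refine integral_congr_ae (ae_of_all _ fun x => ?_)
  rcases (hP ε hε).locPerApprox_cases D ε x with ⟨t, ht⟩ | h0
  · simp [ht, ψ2, sq]
  · simp [h0]

/-- A limit of the pairings of a bounded family in `L²(Ω)` with `𝓛^ε ψ` is the pairing of `ψ` with
a function in `L²(Ω × 𝕋^d)`: in the limit, the pairing is dominated by the norm of `ψ` in
`L²(Ω × 𝕋^d)`. -/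
lemma exists_twoScale_limit (hΩ : IsOpen Ω) (hb : Bornology.IsBounded Ω)
    (hD : IsTransformation Ω D) {r : ℝ} (hr₀ : 0 < r) (hr₁ : r < 1) {P : ℝ → CubeFamily d}
    (hP : ∀ ε : ℝ, 0 < ε → (P ε).IsPartition Ω (ε ^ r)) {w : ℝ → E d → ℝ} {C : ℝ}
    (hw : ∀ ε, 0 < ε → MemLp (w ε) 2 (volume.restrict Ω))
    (hwC : ∀ ε, 0 < ε → lpNorm (w ε) 2 (volume.restrict Ω) ≤ C)
    {e : ℕ → ℝ} (he : Tendsto e atTop (𝓝[>] (0 : ℝ))) {F : (E d → Cper d) → ℝ}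
    (hF : IsL2Functional (volume.restrict Ω) C F)
    (hlim : ∀ ψ, MemLp ψ 2 (volume.restrict Ω) → Tendsto
      (fun j => ∫ x in Ω, w (e j) x * locPerApprox D (P (e j)) (e j) ψ x) atTop (𝓝 (F ψ))) :
    ∃ v : E d × UnitAddTorus (Fin d) → ℝ,
      MemLp v 2 ((volume.restrict Ω).prod (torusMeasure d)) ∧
      ∀ ψ, MemLp ψ 2 (volume.restrict Ω) →
        F ψ = ∫ p, v p * uncurryTorus ψ p ∂((volume.restrict Ω).prod (torusMeasure d)) := by
  have hfin : IsFiniteMeasure (volume.restrict Ω) :=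
    isFiniteMeasure_restrict.2 hb.measure_lt_top.ne
  set μ := volume.restrict Ω with hμ
  have hC0 : 0 ≤ C := lpNorm_nonneg.trans (hwC 1 one_pos)
  have hepos : ∀ᶠ j in atTop, 0 < e j := he.eventually self_mem_nhdsWithin
  have hbdd : ∀ ψ, MemLp ψ 2 μ → ∀ B : ℝ, (∀ x, ‖ψ x‖ ≤ B) →
      |F ψ| ≤ C * lpNorm (uncurryTorus ψ) 2 (μ.prod (torusMeasure d)) := by
    intro ψ hψ B hB
    refine le_of_tendsto_of_tendsto (hlim ψ hψ).abs
      (((tendsto_lpNorm_locPerApprox hΩ hb hD hr₀ hr₁ hP hψ hB).comp he).const_mul C) ?_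
    filter_upwards [hepos] with j hj
    have hL := (hP _ hj).memLp_locPerApprox (D := D) (ε := e j) (Real.rpow_pos_of_pos hj r) hψ
    refine (abs_integral_le_lpNorm_mul (hw _ hj) hL
      (ae_of_all _ fun x => (abs_mul _ _).le)).trans ?_
    exact mul_le_mul_of_nonneg_right (hwC _ hj) lpNorm_nonneg
  -- a general `ψ` is approximated by simple functions, which are bounded
  refine hF.exists_representation uncurryTorusₗ (fun ψ hψ => memLp_uncurryTorus hψ) fun ψ hψ =>
     le_of_forall_pos_le_add fun δ hδ => ?_
  set q := δ / (2 * C + 1) with hq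
  have hq0 : 0 < q := by positivity
  obtain ⟨S, hS, hSm⟩ := hψ.exists_simpleFunc_eLpNorm_sub_lt (by simp)
    (ε := ENNReal.ofReal q) (by simpa using hq0)
  have hsub : MemLp (ψ - (S : E d → Cper d)) 2 μ := hψ.sub hSm
  have hsubn : lpNorm (ψ - (S : E d → Cper d)) 2 μ ≤ q := by
    rw [← toReal_eLpNorm hsub.1]
    exact ENNReal.toReal_le_of_le_ofReal hq0.le hS.le
  obtain ⟨B, hB⟩ := S.exists_forall_norm_le
  have h1 := hbdd S hSm B hB
  have h2 := (hF.abs_sub_le hψ hSm).trans (mul_le_mul_of_nonneg_left hsubn hC0)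
  have h3 : lpNorm (uncurryTorus S) 2 (μ.prod (torusMeasure d)) ≤
      lpNorm (uncurryTorus ψ) 2 (μ.prod (torusMeasure d)) + q := by
    have h4 := lpNorm_le_lpNorm_add_lpNorm_sub' (memLp_uncurryTorus hψ) (f := uncurryTorus S)
      (show (1 : ENNReal) ≤ 2 by norm_num)
    refine h4.trans (add_le_add_right ?_ _)
    rw [lpNorm_sub_comm]
    exact (lpNorm_uncurryTorus_le hsub).trans hsubn
  have h5 : |F ψ| ≤ |F S| + |F ψ - F S| := by
    have := abs_add_le (F S) (F ψ - F S)
    simpa using this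
  have h6 : 2 * C * q ≤ δ := by
    rw [hq, mul_div_assoc', div_le_iff₀ (by positivity)]
    nlinarith
  have h7 := mul_le_mul_of_nonneg_left h3 hC0
  change |F ψ| ≤ C * lpNorm (uncurryTorus ψ) 2 (μ.prod (torusMeasure d)) + δ
  linarith

end

/-! ### Fibrewise Fourier coefficients of the two-scale limit -/

/-- A fibre integral vanishes almost everywhere if all its integrals over measurable sets do. -/
lemma ae_fibre_integral_eq_zero {X Z F : Type*} [MeasurableSpace X] [MeasurableSpace Z]
    [NormedAddCommGroup F] [NormedSpace ℝ F] [CompleteSpace F] {μ : Measure X} {τ : Measure Z}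
    [SFinite μ] [SFinite τ] {G : X × Z → F} (hG : Integrable G (μ.prod τ))
    (h : ∀ s, MeasurableSet s → ∫ p, s.indicator (fun _ => (1 : ℝ)) p.1 • G p ∂μ.prod τ = 0) :
    ∀ᵐ x ∂μ, ∫ t, G (x, t) ∂τ = 0 := by
  refine hG.integral_prod_left.ae_eq_zero_of_forall_setIntegral_eq_zero fun s hs _ => ?_
  have e : ∀ p : X × Z, s.indicator (fun _ => (1 : ℝ)) p.1 • G p =
      (s ×ˢ univ).indicator G p := by
    intro p
    by_cases hp : p.1 ∈ s <;> simp [hp]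
  have h1 := h s hs
  simp only [e] at h1
  rw [integral_indicator (hs.prod MeasurableSet.univ), setIntegral_prod _ hG.integrableOn] at h1
  simpa using h1

lemma ae_memLp_fibre {X Z F : Type*} [MeasurableSpace X] [MeasurableSpace Z]
    [NormedAddCommGroup F] {μ : Measure X} {τ : Measure Z}
    [SFinite μ] [SFinite τ] {G : X × Z → F} (hG : MemLp G 2 (μ.prod τ)) :
    ∀ᵐ x ∂μ, MemLp (fun t => G (x, t)) 2 τ := by
  have h := (memLp_two_iff_integrable_sq_norm hG.1).1 hG
  filter_upwards [h.prod_right_ae, hG.1.prodMk_left] with x hx hm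
  exact (memLp_two_iff_integrable_sq_norm hm).2 hx

lemma mFourierCoeff_ofReal {f : UnitAddTorus (Fin d) → ℝ} (hf : Integrable f (torusMeasure d))
    (k : Fin d → ℤ) :
    UnitAddTorus.mFourierCoeff (fun t => (f t : ℂ)) k =
      ((∫ t, f t * trig k 0 t ∂torusMeasure d : ℝ) : ℂ) +
        Complex.I * ((∫ t, f t * trig k (Real.pi / 2) t ∂torusMeasure d : ℝ) : ℂ) := by
  have hi : ∀ θ, Integrable (fun t => f t * trig k θ t) (torusMeasure d) := fun θ =>
    hf.mul_bdd (c := ‖trig k θ‖) (trig k θ).continuous.aestronglyMeasurable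
      (ae_of_all _ fun t => (trig k θ).norm_coe_le_norm t)
  rw [← integral_complex_ofReal, ← integral_complex_ofReal, ← integral_const_mul,
    ← integral_add (hi 0).ofReal ((hi _).ofReal.const_mul _)]
  refine integral_congr_ae (ae_of_all _ fun t => ?_)
  have e : UnitAddTorus.mFourier (-k) t = ((trig k 0 t : ℝ) : ℂ) +
      Complex.I * ((trig k (Real.pi / 2) t : ℝ) : ℂ) := by
    rw [UnitAddTorus.mFourier_neg, trig_apply, trig_apply]
    push_cast
    rw [Complex.exp_pi_div_two_mul_I, zero_mul, Complex.exp_zero, one_mul]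
    apply Complex.ext <;> simp
  beta_reduce
  rw [e, smul_eq_mul]
  push_cast
  ring

section

variable {Ω : Set (E d)} {D : E d → (E d ≃L[ℝ] E d)}

/-- The Fourier coefficients of a two-scale limit of gradients are parallel to the wave vector:
this is the limit of the vanishing of the curl, obtained from the oscillation lemma for the
divergence free fields `∂_a u e_b - ∂_b u e_a`. -/
lemma ae_waveVec_mul_integral_trig (hΩ : IsOpen Ω) (hb : Bornology.IsBounded Ω)
    (hD : IsTransformation Ω D) {r : ℝ} (hr₀ : 0 < r) (hr₁ : r < 1) {P : ℝ → CubeFamily d}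
    (hP : ∀ ε : ℝ, 0 < ε → (P ε).IsPartition Ω (ε ^ r))
    {u : ℝ → E d → ℝ} {g : ℝ → E d → E d} {C : ℝ}
    (hu : ∀ ε, 0 < ε → IsH1 Ω (u ε) (g ε))
    (hgC : ∀ ε, 0 < ε → lpNorm (g ε) 2 (volume.restrict Ω) ≤ C)
    {e : ℕ → ℝ} (he : Tendsto e atTop (𝓝[>] (0 : ℝ)))
    {v : Fin d → E d × UnitAddTorus (Fin d) → ℝ}
    (hv : ∀ i, MemLp (v i) 2 ((volume.restrict Ω).prod (torusMeasure d)))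
    (hlim : ∀ i, ∀ ψ, MemLp ψ 2 (volume.restrict Ω) → Tendsto
      (fun j => ∫ x in Ω, g (e j) x i * locPerApprox D (P (e j)) (e j) ψ x) atTop
      (𝓝 (∫ p, v i p * uncurryTorus ψ p ∂((volume.restrict Ω).prod (torusMeasure d)))))
    (k : Fin d → ℤ) (θ : ℝ) (a b : Fin d) :
    ∀ᵐ x ∂volume.restrict Ω, waveVec D k x b * ∫ t, v a (x, t) * trig k θ t ∂torusMeasure d =
      waveVec D k x a * ∫ t, v b (x, t) * trig k θ t ∂torusMeasure d := by
  have hfin : IsFiniteMeasure (volume.restrict Ω) :=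
    isFiniteMeasure_restrict.2 hb.measure_lt_top.ne
  obtain ⟨M, hM0, hM⟩ := hD.exists_waveForm_le hb k
  have hω : ∀ i, ∀ f : E d → ℝ, MemLp f 2 (volume.restrict Ω) →
      MemLp (fun x => f x * waveVec D k x i) 2 (volume.restrict Ω) := by
    intro i f hf
    have hc : Continuous fun x => waveVec D k x i :=
      (EuclideanSpace.proj (𝕜 := ℝ) i).continuous.comp (hD.continuous_waveVec k)
    refine MemLp.of_le_mul (g := f) (c := M) hf (hf.1.mul hc.aestronglyMeasurable) ?_
    filter_upwards [ae_restrict_mem hΩ.measurableSet] with x hx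
    rw [norm_mul, mul_comm]
    refine mul_le_mul_of_nonneg_right ?_ (norm_nonneg _)
    refine (PiLp.norm_apply_le _ i).trans ?_
    rw [waveVec, LinearIsometryEquiv.norm_map]
    exact hM x hx
  have key : ∀ f : E d → ℝ, MemLp f 2 (volume.restrict Ω) →
      ∫ p, v a p * uncurryTorus (fun x => (f x * waveVec D k x b) • trig k θ) p
          ∂((volume.restrict Ω).prod (torusMeasure d)) -
        ∫ p, v b p * uncurryTorus (fun x => (f x * waveVec D k x a) • trig k θ) p
          ∂((volume.restrict Ω).prod (torusMeasure d)) = 0 := by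
    intro f hf
    have h1 := (hlim a _ (memLp_smul_const (hω b f hf) (trig k θ))).sub
      (hlim b _ (memLp_smul_const (hω a f hf) (trig k θ)))
    refine tendsto_nhds_unique h1 ?_
    set ea : E d := EuclideanSpace.single a 1 with hea
    set eb : E d := EuclideanSpace.single b 1 with heb
    have hga : ∀ ε x, inner ℝ (g ε x) ea = g ε x a := fun ε x => by
      simp [hea, EuclideanSpace.inner_single_right]
    have hgb : ∀ ε x, inner ℝ (g ε x) eb = g ε x b := fun ε x => by
      simp [heb, EuclideanSpace.inner_single_right]
    have hα : ∀ ε, 0 < ε → MemLp (fun x => inner ℝ (g ε x) ea • eb - inner ℝ (g ε x) eb • ea) 2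
        (volume.restrict Ω) := fun ε hε =>
      (memLp_smul_const ((hu ε hε).memLp_grad.inner_const ea) eb).sub
        (memLp_smul_const ((hu ε hε).memLp_grad.inner_const eb) ea)
    have hosc := tendsto_integral_osc hΩ hb hD hr₀ hr₁ hP
      (α := fun ε x => inner ℝ (g ε x) ea • eb - inner ℝ (g ε x) eb • ea) (β := fun _ _ => 0)
      (C := 2 * C) hα (fun _ _ => MemLp.zero') (fun ε hε => by
        have hg := (hu ε hε).memLp_grad
        refine le_trans ?_ (mul_le_mul_of_nonneg_left (hgC ε hε) zero_le_two)
        have h2 : 2 * lpNorm (g ε) 2 (volume.restrict Ω) =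
            lpNorm (fun x => (2 : ℝ) • g ε x) 2 (volume.restrict Ω) := by
          have := lpNorm_const_smul (p := 2) (2 : ℝ) (g ε) (volume.restrict Ω)
          rw [coe_nnnorm, Real.norm_ofNat] at this
          exact this.symm
        have hg2 : MemLp (fun x => (2 : ℝ) • g ε x) 2 (volume.restrict Ω) := hg.const_smul (2 : ℝ)
        rw [h2, ← lpNorm_norm hg2.1]
        refine lpNorm_mono_real hg2.norm fun x => ?_
        have n1 : ‖inner ℝ (g ε x) ea • eb‖ ≤ ‖g ε x‖ := by
          rw [norm_smul]
          simpa [hea, heb] using norm_inner_le_norm (𝕜 := ℝ) (g ε x) ea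
        have n2 : ‖inner ℝ (g ε x) eb • ea‖ ≤ ‖g ε x‖ := by
          rw [norm_smul]
          simpa [hea, heb] using norm_inner_le_norm (𝕜 := ℝ) (g ε x) eb
        refine (norm_sub_le _ _).trans ((add_le_add n1 n2).trans (le_of_eq ?_))
        simp [norm_smul, two_mul])
      (fun ε hε => by
        have : lpNorm (fun _ : E d => (0 : ℝ)) 2 (volume.restrict Ω) = 0 := lpNorm_zero 2 _
        exact this.trans_le (mul_nonneg zero_le_two (lpNorm_nonneg.trans (hgC ε hε))))
      (fun ε hε Φ hΦ => by
        rw [(hu ε hε).integral_curl hΦ]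
        simp) k θ hf
    refine (hosc.comp he).congr' ?_
    filter_upwards [he.eventually self_mem_nhdsWithin] with j hj
    have hj : 0 < e j := hj
    have hgi : ∀ i, MemLp (fun x => g (e j) x i) 2 (volume.restrict Ω) := fun i =>
      (EuclideanSpace.proj (𝕜 := ℝ) i).comp_memLp' (hu _ hj).memLp_grad
    have hint : ∀ i l, Integrable (fun x => g (e j) x i * locPerApprox D (P (e j)) (e j)
        (fun x => (f x * waveVec D k x l) • trig k θ) x) (volume.restrict Ω) := fun i l =>
      (hgi i).integrable_mul ((hP _ hj).memLp_locPerApprox (Real.rpow_pos_of_pos hj r)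
        (memLp_smul_const (hω l f hf) (trig k θ)))
    rw [← integral_sub (hint a b) (hint b a)]
    refine integral_congr_ae (ae_of_all _ fun x => ?_)
    simp only [locPerApprox_smul, map_sub, map_smul, hga, hgb, smul_eq_mul]
    rw [hea, heb, waveForm_single, waveForm_single]
    ring
  have hint : ∀ i l, Integrable (fun p : E d × UnitAddTorus (Fin d) =>
      v i p * uncurryTorus (fun x => ((1 : ℝ) * waveVec D k x l) • trig k θ) p)
      ((volume.restrict Ω).prod (torusMeasure d)) := fun i l =>
    (hv i).integrable_mul (memLp_uncurryTorus (memLp_smul_const (hω l _ (memLp_const 1)) _))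
  have h0 := ae_fibre_integral_eq_zero ((hint a b).sub (hint b a)) fun s hs => by
    have hfs : MemLp (s.indicator fun _ => (1 : ℝ)) 2 (volume.restrict Ω) :=
      (memLp_const (1 : ℝ)).indicator hs
    rw [← key _ hfs, ← integral_sub]
    · refine integral_congr_ae (ae_of_all _ fun p => ?_)
      simp only [Pi.sub_apply, uncurryTorus, ContinuousMap.smul_apply, smul_eq_mul]
      ring
    · exact (hv a).integrable_mul (memLp_uncurryTorus (memLp_smul_const (hω b _ hfs) _))
    · exact (hv b).integrable_mul (memLp_uncurryTorus (memLp_smul_const (hω a _ hfs) _))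
  filter_upwards [h0, (hint a b).prod_right_ae, (hint b a).prod_right_ae] with x hx h1 h2
  rw [integral_congr_ae (ae_of_all _ fun t => Pi.sub_apply _ _ (x, t)), integral_sub h1 h2] at hx
  rw [← integral_const_mul, ← integral_const_mul]
  refine Eq.trans ?_ ((sub_eq_zero.1 hx).trans ?_) <;>
  · refine integral_congr_ae (ae_of_all _ fun t => ?_)
    simp only [uncurryTorus, ContinuousMap.smul_apply, smul_eq_mul]
    ring

/-- The mean value over the torus of the two-scale limit is the weak limit, as `𝓛^ε` leaves functions
of `x` alone unchanged. -/
lemma ae_integral_torus_eq (hΩ : IsOpen Ω) (hb : Bornology.IsBounded Ω)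
    {r : ℝ} {P : ℝ → CubeFamily d}
    (hP : ∀ ε : ℝ, 0 < ε → (P ε).IsPartition Ω (ε ^ r)) {w : ℝ → E d → ℝ}
    {e : ℕ → ℝ} (he : Tendsto e atTop (𝓝[>] (0 : ℝ))) {v : E d × UnitAddTorus (Fin d) → ℝ}
    (hv : MemLp v 2 ((volume.restrict Ω).prod (torusMeasure d)))
    (hlim : ∀ ψ, MemLp ψ 2 (volume.restrict Ω) → Tendsto
      (fun j => ∫ x in Ω, w (e j) x * locPerApprox D (P (e j)) (e j) ψ x) atTop
      (𝓝 (∫ p, v p * uncurryTorus ψ p ∂((volume.restrict Ω).prod (torusMeasure d)))))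
    {w₀ : E d → ℝ} (hw₀ : MemLp w₀ 2 (volume.restrict Ω))
    (hweak : ∀ f : E d → ℝ, MemLp f 2 (volume.restrict Ω) →
      Tendsto (fun ε => ∫ x in Ω, w ε x * f x) (𝓝[>] (0 : ℝ)) (𝓝 (∫ x in Ω, w₀ x * f x))) :
    ∀ᵐ x ∂volume.restrict Ω, ∫ t, v (x, t) ∂torusMeasure d = w₀ x := by
  have hfin : IsFiniteMeasure (volume.restrict Ω) :=
    isFiniteMeasure_restrict.2 hb.measure_lt_top.ne
  have hw : MemLp (fun p : E d × UnitAddTorus (Fin d) => w₀ p.1) 2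
      ((volume.restrict Ω).prod (torusMeasure d)) :=
    hw₀.comp_measurePreserving measurePreserving_fst
  have hvi := hv.integrable (by norm_num)
  have hwi := hw.integrable (by norm_num)
  have h0 := ae_fibre_integral_eq_zero (hvi.sub hwi) fun s hs => by
    have hfs : MemLp (s.indicator fun _ => (1 : ℝ)) 2 (volume.restrict Ω) :=
      (memLp_const (1 : ℝ)).indicator hs
    have hf2 : MemLp (fun p : E d × UnitAddTorus (Fin d) => s.indicator (fun _ => (1 : ℝ)) p.1) 2
      ((volume.restrict Ω).prod (torusMeasure d)) :=
      hfs.comp_measurePreserving measurePreserving_fst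
    have h1 := hlim _ (memLp_smul_const hfs (trig 0 0))
    have h2 := (hweak _ hfs).comp he
    have h3 := tendsto_nhds_unique h1 (h2.congr' (by
      filter_upwards [he.eventually self_mem_nhdsWithin] with j hj
      have hj : 0 < e j := hj
      refine integral_congr_ae ?_
      filter_upwards [(hP _ hj).locPerApprox_const_ae (D := D) (ε := e j)
        (Real.rpow_pos_of_pos hj r) hΩ (Real.cos 0)] with x hx
      rw [locPerApprox_smul, trig_zero, hx, Real.cos_zero, mul_one]))
    have e1 : ∫ p, s.indicator (fun _ => (1 : ℝ)) p.1 •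
        (v - fun p : E d × UnitAddTorus (Fin d) => w₀ p.1) p
        ∂((volume.restrict Ω).prod (torusMeasure d)) =
        ∫ p, (v p * uncurryTorus (fun x => s.indicator (fun _ => (1 : ℝ)) x • trig 0 0) p -
          w₀ p.1 * s.indicator (fun _ => (1 : ℝ)) p.1)
        ∂((volume.restrict Ω).prod (torusMeasure d)) := by
      refine integral_congr_ae (ae_of_all _ fun p => ?_)
      simp only [Pi.sub_apply, uncurryTorus, ContinuousMap.smul_apply, smul_eq_mul, trig_zero,
        ContinuousMap.const_apply, Real.cos_zero]
      ring
    have i1 : Integrable (fun p => v p *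
        uncurryTorus (fun x => s.indicator (fun _ => (1 : ℝ)) x • trig 0 0) p)
        ((volume.restrict Ω).prod (torusMeasure d)) :=
      hv.integrable_mul (memLp_uncurryTorus (memLp_smul_const hfs _))
    have i2 : Integrable (fun p : E d × UnitAddTorus (Fin d) =>
        w₀ p.1 * s.indicator (fun _ => (1 : ℝ)) p.1) ((volume.restrict Ω).prod (torusMeasure d)) :=
      hw.integrable_mul hf2
    rw [e1, integral_sub i1 i2, h3, integral_prod _ i2]
    simp
  filter_upwards [h0, hvi.prod_right_ae] with x hx h1
  change ∫ t, (v (x, t) - w₀ x) ∂torusMeasure d = 0 at hx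
  rw [integral_sub h1 (integrable_const _)] at hx
  simpa [sub_eq_zero] using hx

end

/-! ### Functions with prescribed fibrewise Fourier coefficients -/

lemma mFourierCoeff_toLp {f : UnitAddTorus (Fin d) → ℂ} (hf : MemLp f 2 (torusMeasure d))
    (k : Fin d → ℤ) :
    UnitAddTorus.mFourierCoeff (hf.toLp f) k = UnitAddTorus.mFourierCoeff f k := by
  refine integral_congr_ae ?_
  filter_upwards [hf.coeFn_toLp] with t ht
  rw [ht]

/-- **Parseval's identity**, for functions rather than classes. -/
lemma hasSum_norm_mFourierCoeff_sq {f : UnitAddTorus (Fin d) → ℂ} (hf : MemLp f 2 (torusMeasure d)) :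
    HasSum (fun k => ‖UnitAddTorus.mFourierCoeff f k‖ ^ 2) (∫ t, ‖f t‖ ^ 2 ∂torusMeasure d) := by
  have h := UnitAddTorus.hasSum_sq_mFourierCoeff (hf.toLp f)
  simp only [mFourierCoeff_toLp hf] at h
  have e : ∫ t, ‖hf.toLp f t‖ ^ 2 ∂torusMeasure d = ∫ t, ‖f t‖ ^ 2 ∂torusMeasure d := by
    refine integral_congr_ae ?_
    filter_upwards [hf.coeFn_toLp] with t ht
    rw [ht]
  rwa [← e]

lemma memLp_mul_mFourier {X : Type*} [MeasurableSpace X] {μ : Measure X} [SFinite μ]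
    {h : X → ℂ} (hh : MemLp h 2 μ) (k : Fin d → ℤ) :
    MemLp (fun p : X × UnitAddTorus (Fin d) => h p.1 * UnitAddTorus.mFourier k p.2) 2
      (μ.prod (torusMeasure d)) := by
  have h1 : MemLp (fun p : X × UnitAddTorus (Fin d) => h p.1) 2 (μ.prod (torusMeasure d)) :=
    hh.comp_measurePreserving measurePreserving_fst
  refine h1.of_le (h1.1.mul
    (UnitAddTorus.mFourier k).continuous.aestronglyMeasurable.comp_snd) (ae_of_all _ fun p => ?_)
  rw [norm_mul]
  refine mul_le_of_le_one_right (norm_nonneg _) ?_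
  exact ((UnitAddTorus.mFourier k).norm_coe_le_norm p.2).trans UnitAddTorus.mFourier_norm.le

section

variable {X : Type*} [MeasurableSpace X] {μ : Measure X} [IsFiniteMeasure μ]

lemma memLp_mFourierCoeff {V : X × UnitAddTorus (Fin d) → ℂ}
    (hV : MemLp V 2 (μ.prod (torusMeasure d))) (k : Fin d → ℤ) :
    MemLp (fun x => UnitAddTorus.mFourierCoeff (fun t => V (x, t)) k) 2 μ := by
  have hm : AEStronglyMeasurable (fun x => UnitAddTorus.mFourierCoeff (fun t => V (x, t)) k) μ := by
    have h1 : AEStronglyMeasurable (fun p : X × UnitAddTorus (Fin d) =>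
        UnitAddTorus.mFourier (-k) p.2 • V p) (μ.prod (torusMeasure d)) :=
      ((UnitAddTorus.mFourier (-k)).continuous.aestronglyMeasurable.comp_snd).smul hV.1
    exact h1.integral_prod_right'
  rw [memLp_two_iff_integrable_sq_norm hm]
  have hV2 := (memLp_two_iff_integrable_sq_norm hV.1).1 hV
  refine hV2.integral_prod_left.mono' (hm.norm.pow 2) ?_
  filter_upwards [ae_memLp_fibre hV] with x hx
  rw [Real.norm_of_nonneg (by positivity)]
  have h := hasSum_norm_mFourierCoeff_sq hx
  exact le_hasSum h k fun _ _ => by positivity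

lemma summable_integral_norm_mFourierCoeff_sq {V : X × UnitAddTorus (Fin d) → ℂ}
    (hV : MemLp V 2 (μ.prod (torusMeasure d))) :
    Summable fun k => ∫ x, ‖UnitAddTorus.mFourierCoeff (fun t => V (x, t)) k‖ ^ 2 ∂μ := by
  have hV2 := (memLp_two_iff_integrable_sq_norm hV.1).1 hV
  have hi : ∀ k, Integrable
      (fun x => ‖UnitAddTorus.mFourierCoeff (fun t => V (x, t)) k‖ ^ 2) μ := fun k =>
    (memLp_two_iff_integrable_sq_norm (memLp_mFourierCoeff hV k).1).1 (memLp_mFourierCoeff hV k)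
  refine summable_of_sum_le (c := ∫ x, ∫ t, ‖V (x, t)‖ ^ 2 ∂torusMeasure d ∂μ)
    (fun k => integral_nonneg fun x => by positivity) fun s => ?_
  rw [← integral_finsetSum _ fun k _ => hi k]
  refine integral_mono_ae (integrable_finsetSum _ fun k _ => hi k) hV2.integral_prod_left ?_
  filter_upwards [ae_memLp_fibre hV] with x hx
  exact sum_le_hasSum s (fun _ _ => by positivity) (hasSum_norm_mFourierCoeff_sq hx)

/-- The element `h ⊗ e_k` of `L²(X × 𝕋^d)`, for `h ∈ L²(X)` and the Fourier monomial `e_k`. -/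
noncomputable def fourierMode {h : X → ℂ} (hh : MemLp h 2 μ) (k : Fin d → ℤ) :
    Lp ℂ 2 (μ.prod (torusMeasure d)) :=
  (memLp_mul_mFourier hh k).toLp _

lemma inner_fourierMode_left {h : X → ℂ} (hh : MemLp h 2 μ) (k : Fin d → ℤ)
    (U : Lp ℂ 2 (μ.prod (torusMeasure d))) :
    inner ℂ (fourierMode hh k) U = ∫ p, star (h p.1) * (UnitAddTorus.mFourier (-k) p.2 * U p)
      ∂μ.prod (torusMeasure d) := by
  rw [L2.inner_def]
  refine integral_congr_ae ?_
  filter_upwards [(memLp_mul_mFourier hh k).coeFn_toLp] with p hp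
  rw [fourierMode, hp, UnitAddTorus.mFourier_neg]
  simp only [RCLike.inner_apply, map_mul, RCLike.star_def]
  ring

lemma inner_fourierMode_of_ne {h h' : X → ℂ} (hh : MemLp h 2 μ) (hh' : MemLp h' 2 μ)
    {k l : Fin d → ℤ} (hkl : k ≠ l) : inner ℂ (fourierMode hh k) (fourierMode hh' l) = 0 := by
  rw [inner_fourierMode_left]
  have e : ∫ p, star (h p.1) * (UnitAddTorus.mFourier (-k) p.2 * fourierMode hh' l p)
      ∂μ.prod (torusMeasure d) = ∫ p : X × UnitAddTorus (Fin d), (star (h p.1) * h' p.1) *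
        UnitAddTorus.mFourier (l - k) p.2 ∂μ.prod (torusMeasure d) := by
    refine integral_congr_ae ?_
    filter_upwards [(memLp_mul_mFourier hh' l).coeFn_toLp] with p hp
    rw [fourierMode, hp, sub_eq_add_neg, UnitAddTorus.mFourier_add]
    ring
  rw [e, integral_prod_mul (fun x => star (h x) * h' x),
    integral_mFourier (sub_ne_zero.2 hkl.symm), mul_zero]

lemma norm_fourierMode_sq_le {h : X → ℂ} (hh : MemLp h 2 μ) (k : Fin d → ℤ) :
    ‖fourierMode hh k‖ ^ 2 ≤ ∫ x, ‖h x‖ ^ 2 ∂μ := by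
  have hm := memLp_mul_mFourier hh k
  have h1 : MemLp (fun p : X × UnitAddTorus (Fin d) => h p.1) 2 (μ.prod (torusMeasure d)) :=
    hh.comp_measurePreserving measurePreserving_fst
  have i1 := (memLp_two_iff_integrable_sq_norm h1.1).1 h1
  rw [fourierMode, norm_toLp_eq_lpNorm, lpNorm_two_eq hm.1,
    Real.sq_sqrt (integral_nonneg fun p => by positivity)]
  have e : ∫ p : X × UnitAddTorus (Fin d), ‖h p.1‖ ^ 2 ∂μ.prod (torusMeasure d) =
      ∫ x, ‖h x‖ ^ 2 ∂μ := by
    rw [integral_prod _ i1]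
    simp
  rw [← e]
  refine integral_mono ((memLp_two_iff_integrable_sq_norm hm.1).1 hm) i1 fun p => ?_
  beta_reduce
  rw [norm_mul]
  gcongr
  refine mul_le_of_le_one_right (norm_nonneg _) ?_
  exact ((UnitAddTorus.mFourier k).norm_coe_le_norm p.2).trans UnitAddTorus.mFourier_norm.le

/-- Square summable coefficients are the fibrewise Fourier coefficients of a function, namely of the
sum of the orthogonal series `∑ c_k ⊗ e_k`. -/
lemma exists_mFourierCoeff_eq {c : (Fin d → ℤ) → X → ℂ} (hc : ∀ k, MemLp (c k) 2 μ)
    (hs : Summable fun k => ∫ x, ‖c k x‖ ^ 2 ∂μ) :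
    ∃ U : X × UnitAddTorus (Fin d) → ℂ, MemLp U 2 (μ.prod (torusMeasure d)) ∧
      ∀ᵐ x ∂μ, ∀ k, UnitAddTorus.mFourierCoeff (fun t => U (x, t)) k = c k x := by
  let F : (Fin d → ℤ) → Lp ℂ 2 (μ.prod (torusMeasure d)) := fun k => fourierMode (hc k) k
  have hF : Summable F := by
    have horth : OrthogonalFamily ℂ (fun k => Submodule.span ℂ {F k})
        fun k => (Submodule.span ℂ {F k}).subtypeₗᵢ := by
      intro k l hkl v w
      obtain ⟨a, ha⟩ := Submodule.mem_span_singleton.1 v.2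
      obtain ⟨b, hb⟩ := Submodule.mem_span_singleton.1 w.2
      change inner ℂ (v : Lp ℂ 2 (μ.prod (torusMeasure d))) w = 0
      rw [← ha, ← hb, inner_smul_left, inner_smul_right, inner_fourierMode_of_ne (hc k) (hc l) hkl, mul_zero, mul_zero]
    refine (horth.summable_iff_norm_sq_summable
      fun k => ⟨F k, Submodule.mem_span_singleton_self _⟩).2 ?_
    exact hs.of_nonneg_of_le (fun k => by positivity) fun k => norm_fourierMode_sq_le (hc k) k
  set U := ∑' k, F k with hU
  refine ⟨U, Lp.memLp U, ?_⟩
  rw [ae_all_iff]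
  intro k
  have hUF : ∀ V : Lp ℂ 2 (μ.prod (torusMeasure d)),
      Integrable (fun p => UnitAddTorus.mFourier (-k) p.2 * V p) (μ.prod (torusMeasure d)) := by
    intro V
    refine ((Lp.memLp V).integrable (by norm_num)).bdd_mul (c := 1)
      (UnitAddTorus.mFourier (-k)).continuous.aestronglyMeasurable.comp_snd
      (ae_of_all _ fun p => ?_)
    exact ((UnitAddTorus.mFourier (-k)).norm_coe_le_norm p.2).trans UnitAddTorus.mFourier_norm.le
  -- the coefficients of `U` and of its `k`-th term agree on average over every measurable set
  have h0 := ae_fibre_integral_eq_zero ((hUF U).sub (hUF (F k))) fun s hs => by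
    have hfs : MemLp (s.indicator fun _ => (1 : ℂ)) 2 μ := (memLp_const (1 : ℂ)).indicator hs
    have h1 : inner ℂ (fourierMode hfs k) U = inner ℂ (fourierMode hfs k) (F k) := by
      have h2 := hF.hasSum.mapL (innerSL ℂ (fourierMode hfs k))
      have h3 : HasSum (fun l => innerSL ℂ (fourierMode hfs k) (F l))
          (innerSL ℂ (fourierMode hfs k) (F k)) := hasSum_single k fun l hl =>
        inner_fourierMode_of_ne hfs (hc l) hl.symm
      exact h2.unique h3
    have h4 : inner ℂ (fourierMode hfs k) (U - F k) = 0 := by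
      rw [inner_sub_right, h1, sub_self]
    rw [inner_fourierMode_left] at h4
    rw [← h4]
    refine integral_congr_ae ?_
    filter_upwards [Lp.coeFn_sub U (F k)] with p hp
    rw [hp]
    by_cases hps : p.1 ∈ s <;> simp [hps, mul_sub]
  have hae : ∀ᵐ x ∂μ, ∀ᵐ t ∂torusMeasure d, F k (x, t) = c k x * UnitAddTorus.mFourier k t :=
    Measure.ae_ae_of_ae_prod (memLp_mul_mFourier (hc k) k).coeFn_toLp
  filter_upwards [h0, (hUF U).prod_right_ae, (hUF (F k)).prod_right_ae, hae] with x hx i1 i2 hxF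
  change ∫ t, (UnitAddTorus.mFourier (-k) t * U (x, t) - UnitAddTorus.mFourier (-k) t * F k (x, t))
    ∂torusMeasure d = 0 at hx
  rw [integral_sub i1 i2, sub_eq_zero] at hx
  refine hx.trans ?_
  have e : ∀ᵐ t ∂torusMeasure d, UnitAddTorus.mFourier (-k) t * F k (x, t) = c k x := by
    filter_upwards [hxF] with t ht
    rw [ht, mul_left_comm, ← UnitAddTorus.mFourier_add, neg_add_cancel, UnitAddTorus.mFourier_zero]
    simp
  rw [integral_congr_ae e]
  simp

end

/-! ### Weak gradients of periodic functions -/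

lemma exists_map_toTorus_symm_le (A : E d ≃L[ℝ] E d) {B : Set (E d)} (hB : Bornology.IsBounded B) :
    ∃ C : NNReal, (volume.restrict B).map (fun y => toTorus (A.symm y)) ≤ C • torusMeasure d := by
  have hB' : Bornology.IsBounded (A.symm '' B) :=
    (A.symm : E d →L[ℝ] E d).lipschitz.isBounded_image hB
  obtain ⟨C, hC⟩ := exists_map_toTorus_le hB'
  have hm : Measurable fun y => toTorus (A.symm y) :=
    (continuous_toTorus.comp A.symm.continuous).measurable
  refine ⟨Real.toNNReal |(A : E d →L[ℝ] E d).det| * C, Measure.le_iff.2 fun S hS => ?_⟩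
  rw [Measure.map_apply hm hS, Measure.restrict_apply (hS.preimage hm)]
  have hsub : (fun y => toTorus (A.symm y)) ⁻¹' S ∩ B ⊆
      (A : E d →L[ℝ] E d) '' (toTorus ⁻¹' S ∩ A.symm '' B) := by
    rintro y ⟨hy, hyB⟩
    exact ⟨A.symm y, ⟨hy, y, hyB, rfl⟩, A.apply_symm_apply y⟩
  refine (measure_mono hsub).trans ?_
  rw [Measure.addHaar_image_continuousLinearMap]
  have h := hC S
  rw [Measure.map_apply continuous_toTorus.measurable hS,
    Measure.restrict_apply (hS.preimage continuous_toTorus.measurable)] at h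
  refine (mul_le_mul_right h _).trans (le_of_eq ?_)
  simp only [Measure.smul_apply, ENNReal.smul_def, smul_eq_mul, ENNReal.coe_mul]
  rw [ENNReal.ofReal, mul_assoc]

lemma exists_setIntegral_toTorus_symm_le (A : E d ≃L[ℝ] E d) {B : Set (E d)}
    (hB : Bornology.IsBounded B) : ∃ C : ℝ, 0 ≤ C ∧ ∀ {F : Type} [NormedAddCommGroup F]
      {f : UnitAddTorus (Fin d) → F}, Integrable f (torusMeasure d) →
      IntegrableOn (fun y => f (toTorus (A.symm y))) B ∧
      ∫ y in B, ‖f (toTorus (A.symm y))‖ ≤ C * ∫ t, ‖f t‖ ∂torusMeasure d := by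
  obtain ⟨C, hC⟩ := exists_map_toTorus_symm_le A hB
  have hm : Measurable fun y => toTorus (A.symm y) :=
    (continuous_toTorus.comp A.symm.continuous).measurable
  refine ⟨C, C.2, fun {F} _ {f} hf => ?_⟩
  have h1 : Integrable f (C • torusMeasure d) := hf.smul_measure_nnreal
  have h2 := h1.mono_measure hC
  refine ⟨h2.comp_measurable hm, ?_⟩
  rw [← integral_map (φ := fun y => toTorus (A.symm y)) hm.aemeasurable (f := fun t => ‖f t‖)
    h2.norm.1]
  refine (integral_mono_measure hC (ae_of_all _ fun t => norm_nonneg _) h1.norm).trans ?_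
  rw [integral_smul_nnreal_measure]
  rfl

lemma locallyIntegrable_toTorus_symm (A : E d ≃L[ℝ] E d) {F : Type} [NormedAddCommGroup F]
    {f : UnitAddTorus (Fin d) → F} (hf : Integrable f (torusMeasure d)) :
    LocallyIntegrable (fun y => f (toTorus (A.symm y))) := by
  intro x
  obtain ⟨C, -, h⟩ := exists_setIntegral_toTorus_symm_le A (Metric.isBounded_ball (x := x) (r := 1))
  exact ⟨_, Metric.ball_mem_nhds x one_pos, (h hf).1⟩

/-- Integration of `f([A⁻¹ y])` against a continuous function with compact support, as a functional
of `f ∈ L²(𝕋^d)`. -/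
lemma exists_clm_integral_toTorus_symm (A : E d ≃L[ℝ] E d) {η : E d → ℝ} (hη : Continuous η)
    (hc : HasCompactSupport η) : ∃ L : Lp ℂ 2 (torusMeasure d) →L[ℂ] ℂ,
      ∀ f (hf : MemLp f 2 (torusMeasure d)),
        L (hf.toLp f) = ∫ y, f (toTorus (A.symm y)) * (η y : ℂ) := by
  obtain ⟨C, hC0, hC⟩ := exists_setIntegral_toTorus_symm_le A hc.isCompact.isBounded
  have hint : ∀ f : UnitAddTorus (Fin d) → ℂ, Integrable f (torusMeasure d) →
      Integrable fun y => f (toTorus (A.symm y)) * (η y : ℂ) := fun f hf => by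
    have := (locallyIntegrable_toTorus_symm A hf).integrable_smul_left_of_hasCompactSupport hη hc
    refine this.congr (ae_of_all _ fun y => ?_)
    simp [mul_comm]
  obtain ⟨M, hM⟩ := hc.exists_bound_of_continuous hη
  have hM0 : 0 ≤ M := (norm_nonneg _).trans (hM 0)
  have hbound : ∀ f : UnitAddTorus (Fin d) → ℂ, Integrable f (torusMeasure d) →
      ‖∫ y, f (toTorus (A.symm y)) * (η y : ℂ)‖ ≤ C * M * ∫ t, ‖f t‖ ∂torusMeasure d := by
    intro f hf
    have e : ∫ y, f (toTorus (A.symm y)) * (η y : ℂ) =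
        ∫ y in tsupport η, f (toTorus (A.symm y)) * (η y : ℂ) := by
      refine (setIntegral_eq_integral_of_forall_compl_eq_zero fun y hy => ?_).symm
      rw [image_eq_zero_of_notMem_tsupport hy, Complex.ofReal_zero, mul_zero]
    rw [e]
    have h1 := (hC hf).1.norm.mul_const M
    refine (norm_integral_le_of_norm_le h1 (ae_of_all _ fun y => ?_)).trans ?_
    · rw [norm_mul, Complex.norm_real]
      exact mul_le_mul_of_nonneg_left (hM y) (norm_nonneg _)
    · rw [integral_mul_const]
      nlinarith [mul_le_mul_of_nonneg_right (hC hf).2 hM0]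
  have hcongr : ∀ f g : UnitAddTorus (Fin d) → ℂ, Integrable f (torusMeasure d) →
      f =ᵐ[torusMeasure d] g → ∫ y, f (toTorus (A.symm y)) * (η y : ℂ) =
        ∫ y, g (toTorus (A.symm y)) * (η y : ℂ) := by
    intro f g hf hfg
    have hg := hf.congr hfg
    have h1 := hbound _ (hf.sub hg)
    have h2 : ∫ t, ‖(f - g) t‖ ∂torusMeasure d = 0 := by
      rw [integral_eq_zero_of_ae]
      filter_upwards [hfg] with t ht
      simp [ht]
    rw [h2, mul_zero] at h1
    rw [← sub_eq_zero, ← integral_sub (hint f hf) (hint g hg)]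
    refine Eq.trans ?_ (norm_le_zero_iff.1 h1)
    simp only [Pi.sub_apply, sub_mul]
  have hLp : ∀ U : Lp ℂ 2 (torusMeasure d), Integrable U (torusMeasure d) := fun U =>
    (Lp.memLp U).integrable (by norm_num)
  let L : Lp ℂ 2 (torusMeasure d) →L[ℂ] ℂ := LinearMap.mkContinuous
    { toFun := fun U => ∫ y, U (toTorus (A.symm y)) * (η y : ℂ)
      map_add' := fun U V => by
        rw [hcongr _ _ (hLp _) (Lp.coeFn_add U V), ← integral_add (hint _ (hLp U)) (hint _ (hLp V))]
        simp only [Pi.add_apply, add_mul]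
      map_smul' := fun a U => by
        rw [hcongr _ _ (hLp _) (Lp.coeFn_smul a U), RingHom.id_apply, smul_eq_mul,
          ← integral_const_mul]
        simp only [Pi.smul_apply, smul_eq_mul, mul_assoc] } (C * M) fun U => by
    refine (hbound U (hLp U)).trans (mul_le_mul_of_nonneg_left ?_ (by positivity))
    have := integral_norm_le_lpNorm (Lp.memLp U)
    rw [probReal_univ, Real.sqrt_one, one_mul, ← norm_toLp_eq_lpNorm (Lp.memLp U),
      Lp.toLp_coeFn] at this
    exact this
  exact ⟨L, fun f hf => hcongr _ _ (hLp _) hf.coeFn_toLp⟩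

/-- Integration by parts against a Fourier monomial. -/
lemma integral_mFourier_mul_fderiv (A : E d ≃L[ℝ] E d) (k : Fin d → ℤ) {φ : E d → ℝ}
    (hφ : ContDiff ℝ ∞ φ) (hc : HasCompactSupport φ) (b : E d) :
    ∫ y, UnitAddTorus.mFourier k (toTorus (A.symm y)) * (fderiv ℝ φ y b : ℂ) =
      -(((2 * Real.pi * inner ℝ (latticePt k) (A.symm b) : ℝ) : ℂ) * Complex.I *
        ∫ y, UnitAddTorus.mFourier k (toTorus (A.symm y)) * (φ y : ℂ)) := by
  let f : E d → ℂ := fun y => UnitAddTorus.mFourier k (toTorus (A.symm y))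
  let g : E d → ℂ := fun y => (φ y : ℂ)
  have hfc : Continuous f :=
    (UnitAddTorus.mFourier k).continuous.comp (continuous_toTorus.comp A.symm.continuous)
  have hf : ∀ y, HasFDerivAt f (((Complex.exp ((2 * Real.pi *
      inner ℝ (latticePt k) (A.symm y) : ℝ) * Complex.I)) * Complex.I) •
        (Complex.ofRealCLM.comp ((2 * Real.pi) • (innerSL ℝ (latticePt k)).comp
          (A.symm : E d →L[ℝ] E d)))) y := by
    intro y
    have h1 : HasFDerivAt (fun y : E d => 2 * Real.pi * inner ℝ (latticePt k) (A.symm y))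
        ((2 * Real.pi) • (innerSL ℝ (latticePt k)).comp (A.symm : E d →L[ℝ] E d)) y :=
      (((innerSL ℝ (latticePt k)).comp (A.symm : E d →L[ℝ] E d)).hasFDerivAt).const_smul
        (2 * Real.pi)
    have h2 := ((Complex.ofRealCLM.hasFDerivAt.comp y h1).mul_const Complex.I).cexp
    have e : f = fun y => Complex.exp ((2 * Real.pi *
      inner ℝ (latticePt k) (A.symm y) : ℝ) * Complex.I) := by
      funext y
      exact mFourier_toTorus k _
    rw [e, mul_smul]
    exact h2
  have hfd : ∀ y, fderiv ℝ f y b = ((2 * Real.pi * inner ℝ (latticePt k) (A.symm b) : ℝ) : ℂ) *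
      Complex.I * f y := by
    intro y
    rw [(hf y).fderiv]
    have e : f y = _ := mFourier_toTorus k _
    rw [e]
    simp
    ring
  have hg : ∀ y, HasFDerivAt g (Complex.ofRealCLM.comp (fderiv ℝ φ y)) y := fun y =>
    Complex.ofRealCLM.hasFDerivAt.comp y (hφ.differentiable (by simp) y).hasFDerivAt
  have hgd : ∀ y, fderiv ℝ g y b = (fderiv ℝ φ y b : ℂ) := fun y => by
    rw [(hg y).fderiv]
    simp
  have hi : ∀ η : E d → ℝ, Continuous η → HasCompactSupport η →
      Integrable (fun y => f y * (η y : ℂ)) := by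
    intro η h1 h2
    refine Continuous.integrable_of_hasCompactSupport (by fun_prop) ?_
    exact (h2.comp_left (g := fun a : ℝ => (a : ℂ)) Complex.ofReal_zero).mul_left
  have h := integral_mul_fderiv_eq_neg_fderiv_mul_of_integrable (μ := (volume : Measure (E d)))
    (f := f) (g := g) (v := b) (by
      simp only [hfd, mul_assoc]
      exact ((hi φ hφ.continuous hc).const_mul _).const_mul _) (by
      simp only [hgd]
      exact hi _ ((hφ.continuous_fderiv (by simp)).clm_apply continuous_const)
        (hc.fderiv_apply ℝ b)) (hi φ hφ.continuous hc)
    (fun y _ => (hf y).differentiableAt) (fun y _ => (hg y).differentiableAt)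
  simp only [hgd, hfd, mul_assoc] at h
  rw [integral_const_mul, integral_const_mul] at h
  simpa only [mul_assoc] using h

/-- A relation between Fourier coefficients amounts to a weak derivative: it does for each monomial,
and Fourier series converge in `L²(𝕋^d)`, on which both sides are continuous. -/
lemma integral_toTorus_mul_fderiv (A : E d ≃L[ℝ] E d) {U W : UnitAddTorus (Fin d) → ℂ}
    (hU : MemLp U 2 (torusMeasure d)) (hW : MemLp W 2 (torusMeasure d)) (b : E d)
    (h : ∀ k, UnitAddTorus.mFourierCoeff W k =
      ((2 * Real.pi * inner ℝ (latticePt k) (A.symm b) : ℝ) : ℂ) * Complex.I *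
        UnitAddTorus.mFourierCoeff U k) {φ : E d → ℝ}
    (hφ : ContDiff ℝ ∞ φ) (hc : HasCompactSupport φ) :
    ∫ y, U (toTorus (A.symm y)) * (fderiv ℝ φ y b : ℂ) =
      -∫ y, W (toTorus (A.symm y)) * (φ y : ℂ) := by
  obtain ⟨L, hL⟩ := exists_clm_integral_toTorus_symm A hφ.continuous hc
  obtain ⟨L', hL'⟩ := exists_clm_integral_toTorus_symm A
    ((hφ.continuous_fderiv (by simp)).clm_apply (continuous_const (y := b))) (hc.fderiv_apply ℝ b)
  have hmode : ∀ k, MemLp (UnitAddTorus.mFourier k) 2 (torusMeasure d) := fun k =>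
    .of_bound (UnitAddTorus.mFourier k).continuous.aestronglyMeasurable _
      (ae_of_all _ (UnitAddTorus.mFourier k).norm_coe_le_norm)
  have hmode' : ∀ k, UnitAddTorus.mFourierLp 2 k = (hmode k).toLp _ := fun k => rfl
  have hs1 := (UnitAddTorus.hasSum_mFourier_series_L2 (hU.toLp U)).mapL L'
  have hs2 := (UnitAddTorus.hasSum_mFourier_series_L2 (hW.toLp W)).mapL L
  rw [← hL' U hU, ← hL W hW]
  refine hs1.unique ?_
  refine hs2.neg.congr_fun fun k => ?_
  rw [mFourierCoeff_toLp, mFourierCoeff_toLp, h k, map_smul, map_smul, hmode', hL, hL',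
    integral_mFourier_mul_fderiv A k hφ hc b]
  simp only [smul_eq_mul]
  ring

/-- The function `y ↦ Re U([A⁻¹ y])` has the weak gradient `y ↦ G([A⁻¹ y])` if the Fourier
coefficients of `G` are those of a gradient. -/
lemma hasWeakGrad_toTorus (A : E d ≃L[ℝ] E d) {U : UnitAddTorus (Fin d) → ℂ}
    (hU : MemLp U 2 (torusMeasure d)) {G : UnitAddTorus (Fin d) → E d}
    (hG : MemLp G 2 (torusMeasure d))
    (h : ∀ b k, UnitAddTorus.mFourierCoeff (fun t => ((inner ℝ (G t) b : ℝ) : ℂ)) k =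
      ((2 * Real.pi * inner ℝ (latticePt k) (A.symm b) : ℝ) : ℂ) * Complex.I *
        UnitAddTorus.mFourierCoeff U k) :
    HasWeakGrad univ (fun y => (U (toTorus (A.symm y))).re) (fun y => G (toTorus (A.symm y))) := by
  have hu : LocallyIntegrable fun y => (U (toTorus (A.symm y))).re :=
    locallyIntegrable_toTorus_symm A (f := fun t => (U t).re) (hU.re.integrable (by norm_num))
  have hg : LocallyIntegrable fun y => G (toTorus (A.symm y)) :=
    locallyIntegrable_toTorus_symm A (hG.integrable (by norm_num))
  refine .of_forall (hu.locallyIntegrableOn _) (hg.locallyIntegrableOn _) (fun φ hφ => ?_)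
    (fun φ hφ => ?_) fun φ hφ b => ?_
  · rw [Measure.restrict_univ]
    refine hu.integrable_smul_right_of_hasCompactSupport (continuous_gradient hφ.smooth) ?_
    exact (hφ.compact.fderiv ℝ).comp_left (map_zero (InnerProductSpace.toDual ℝ (E d)).symm)
  · rw [Measure.restrict_univ]
    exact hg.integrable_smul_left_of_hasCompactSupport hφ.smooth.continuous hφ.compact
  · rw [Measure.restrict_univ]
    have hW : MemLp (fun t => ((inner ℝ (G t) b : ℝ) : ℂ)) 2 (torusMeasure d) :=
      (hG.inner_const b).ofReal
    have h1 := congrArg Complex.re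
      (integral_toTorus_mul_fderiv A hU hW b (h b) hφ.smooth hφ.compact)
    have hi : Integrable fun y => U (toTorus (A.symm y)) * (fderiv ℝ φ y b : ℂ) := by
      have := (locallyIntegrable_toTorus_symm A
        (hU.integrable (by norm_num))).integrable_smul_left_of_hasCompactSupport
        (hφ.fderiv_apply b).smooth.continuous (hφ.fderiv_apply b).compact
      refine this.congr (ae_of_all _ fun y => ?_)
      simp [mul_comm]
    have e1 : ∫ y, (U (toTorus (A.symm y))).re * fderiv ℝ φ y b =
        (∫ y, U (toTorus (A.symm y)) * (fderiv ℝ φ y b : ℂ)).re := by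
      refine Eq.trans ?_ (integral_re hi)
      simp
    have e2 : ∫ y, φ y * inner ℝ (G (toTorus (A.symm y))) b =
        (∫ y, ((inner ℝ (G (toTorus (A.symm y))) b : ℝ) : ℂ) * (φ y : ℂ)).re := by
      simp only [← Complex.ofReal_mul]
      rw [integral_complex_ofReal, Complex.ofReal_re]
      simp only [mul_comm]
    rw [e1, h1, Complex.neg_re, e2]

/-! ### The corrector -/

lemma mFourierCoeff_inner_sub {v : Fin d → UnitAddTorus (Fin d) → ℝ}
    (hv : ∀ i, Integrable (v i) (torusMeasure d)) (g b : E d) (k : Fin d → ℤ) :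
    UnitAddTorus.mFourierCoeff (fun t =>
        ((inner ℝ (WithLp.toLp 2 (fun i => v i t - g i) : E d) b : ℝ) : ℂ)) k =
      ∑ i, (b i : ℂ) * (UnitAddTorus.mFourierCoeff (fun t => (v i t : ℂ)) k -
        g i * ∫ t, UnitAddTorus.mFourier (-k) t ∂torusMeasure d) := by
  have hm : ∀ i, Integrable (fun t => UnitAddTorus.mFourier (-k) t * (v i t : ℂ))
      (torusMeasure d) := fun i =>
    (hv i).ofReal.bdd_mul (UnitAddTorus.mFourier (-k)).continuous.aestronglyMeasurable
      (ae_of_all _ (UnitAddTorus.mFourier (-k)).norm_coe_le_norm)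
  have hk := integrable_continuousMap (UnitAddTorus.mFourier (-k))
  have e : ∀ i, (b i : ℂ) * (UnitAddTorus.mFourierCoeff (fun t => (v i t : ℂ)) k -
        g i * ∫ t, UnitAddTorus.mFourier (-k) t ∂torusMeasure d) =
      ∫ t, (b i : ℂ) * (UnitAddTorus.mFourier (-k) t * (v i t : ℂ) -
        g i * UnitAddTorus.mFourier (-k) t) ∂torusMeasure d := by
    intro i
    rw [integral_const_mul, integral_sub (hm i) (hk.const_mul _), integral_const_mul]
    rfl
  have hi : ∀ i, Integrable (fun t => (b i : ℂ) * (UnitAddTorus.mFourier (-k) t * (v i t : ℂ) -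
      g i * UnitAddTorus.mFourier (-k) t)) (torusMeasure d) := fun i =>
    ((hm i).sub (hk.const_mul _)).const_mul _
  simp only [e]
  rw [← integral_finsetSum _ fun i _ => hi i]
  refine integral_congr_ae (ae_of_all _ fun t => ?_)
  simp only [PiLp.inner_apply, RCLike.inner_apply, conj_trivial, smul_eq_mul]
  push_cast
  rw [Finset.mul_sum]
  exact Finset.sum_congr rfl fun i _ => by ring

section

variable {Ω : Set (E d)} {D : E d → (E d ≃L[ℝ] E d)}

/-- The Fourier coefficients of the potential of a field with Fourier coefficients `v̂_i(x, k)`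
parallel to the wave vector `ω`: they are `(2πi)⁻¹ ∑ ω_i v̂_i(x, k) / |ω|²`. -/
noncomputable def potentialCoeff (D : E d → (E d ≃L[ℝ] E d))
    (v : Fin d → E d × UnitAddTorus (Fin d) → ℝ) (k : Fin d → ℤ) (x : E d) : ℂ :=
  ∑ i, ((waveInv D k x i : ℝ) : ℂ) * (-(2 * Real.pi : ℝ)⁻¹ * Complex.I) *
    UnitAddTorus.mFourierCoeff (fun t => (v i (x, t) : ℂ)) k

lemma waveVec_zero (x : E d) : waveVec D 0 x = 0 := by
  have h : waveForm D 0 x = 0 := by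
    ext b
    have : (latticePt (0 : Fin d → ℤ) : E d) = 0 := by
      ext i
      simp [latticePt]
    rw [waveForm_apply, this, inner_zero_left, zero_apply]
  rw [waveVec, h, map_zero]

lemma potentialCoeff_zero (v : Fin d → E d × UnitAddTorus (Fin d) → ℝ) (x : E d) :
    potentialCoeff D v 0 x = 0 := by
  simp [potentialCoeff, waveInv, waveVec_zero]

lemma norm_potentialCoeff_le (v : Fin d → E d × UnitAddTorus (Fin d) → ℝ) {k : Fin d → ℤ} {M : ℝ}
    {x : E d} (hM : ‖(D x : E d →L[ℝ] E d)‖ ≤ M) (hk : k ≠ 0) : ‖potentialCoeff D v k x‖ ≤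
      M * ∑ i, ‖UnitAddTorus.mFourierCoeff (fun t => (v i (x, t) : ℂ)) k‖ := by
  rw [Finset.mul_sum]
  refine norm_sum_le_of_le _ fun i _ => ?_
  rw [norm_mul, norm_mul]
  have h1 : ‖((waveInv D k x i : ℝ) : ℂ)‖ ≤ M := by
    rw [Complex.norm_real]
    exact (PiLp.norm_apply_le _ i).trans ((norm_waveInv_le hk x).trans hM)
  have h2 : ‖(-(2 * Real.pi : ℝ)⁻¹ * Complex.I : ℂ)‖ ≤ 1 := by
    rw [norm_mul, Complex.norm_I, mul_one, norm_neg, Complex.norm_real, norm_inv,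
      Real.norm_of_nonneg (by positivity)]
    exact inv_le_one_of_one_le₀ (by linarith [Real.two_le_pi])
  refine mul_le_mul_of_nonneg_right ?_ (norm_nonneg _)
  exact (mul_le_mul h1 h2 (norm_nonneg _) ((norm_nonneg _).trans h1)).trans (mul_one _).le

/-- The potential has the prescribed gradient: a coefficient parallel to the wave vector `ω` is the
sum of its components along `ω_i / |ω|²`. -/
lemma waveVec_mul_potentialCoeff {v : Fin d → E d × UnitAddTorus (Fin d) → ℝ} {k : Fin d → ℤ}
    (hk : k ≠ 0) {x : E d}
    (h : ∀ a b, (waveVec D k x b : ℂ) *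
        UnitAddTorus.mFourierCoeff (fun t => (v a (x, t) : ℂ)) k =
      waveVec D k x a * UnitAddTorus.mFourierCoeff (fun t => (v b (x, t) : ℂ)) k) (b : Fin d) :
    ((2 * Real.pi * waveVec D k x b : ℝ) : ℂ) * Complex.I * potentialCoeff D v k x =
      UnitAddTorus.mFourierCoeff (fun t => (v b (x, t) : ℂ)) k := by
  have hpi : (Real.pi : ℂ) ≠ 0 := Complex.ofReal_ne_zero.2 Real.pi_ne_zero
  have h1 : ∑ i, (waveInv D k x i : ℂ) * (waveVec D k x i : ℂ) = 1 := by
    exact_mod_cast sum_waveInv_mul (D := D) hk x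
  rw [potentialCoeff, Finset.mul_sum, ← one_mul (UnitAddTorus.mFourierCoeff _ k), ← h1,
    Finset.sum_mul]
  refine Finset.sum_congr rfl fun i _ => ?_
  rw [mul_assoc (waveInv D k x i : ℂ) (waveVec D k x i : ℂ), ← h i b]
  push_cast
  field_simp
  rw [Complex.I_sq]
  ring

/-- A field in `L²(Ω × 𝕋^d)` with fibrewise vanishing curl is, up to its mean values over the cells,
the gradient in `y` of a function in `L²(Ω; H¹_per(Y_x)/ℝ)`. The potential is square integrable as
the wave vectors of nonzero frequency are bounded below. -/
lemma exists_corrector (hΩ : IsOpen Ω) (hb : Bornology.IsBounded Ω) (hD : IsTransformation Ω D)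
    {v : Fin d → E d × UnitAddTorus (Fin d) → ℝ}
    (hv : ∀ i, MemLp (v i) 2 ((volume.restrict Ω).prod (torusMeasure d)))
    {g₀ : E d → E d} (hg₀ : MemLp g₀ 2 (volume.restrict Ω))
    (hcurl : ∀ k θ a b, ∀ᵐ x ∂volume.restrict Ω,
      waveVec D k x b * ∫ t, v a (x, t) * trig k θ t ∂torusMeasure d =
        waveVec D k x a * ∫ t, v b (x, t) * trig k θ t ∂torusMeasure d)
    (hmean : ∀ i, ∀ᵐ x ∂volume.restrict Ω, ∫ t, v i (x, t) ∂torusMeasure d = g₀ x i) :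
    ∃ (u₁ : E d → E d → ℝ) (g₁ : E d → E d → E d), IsL2H1perModConst Ω D u₁ g₁ ∧
      ∀ x y i, g₁ x y i = v i (x, toTorus ((D x).symm y)) - g₀ x i := by
  have hfin : IsFiniteMeasure (volume.restrict Ω) :=
    isFiniteMeasure_restrict.2 hb.measure_lt_top.ne
  obtain ⟨M, hM0, hM⟩ := hD.exists_norm_le hb
  have hvC : ∀ i, MemLp (fun p => (v i p : ℂ)) 2 ((volume.restrict Ω).prod (torusMeasure d)) :=
    fun i => (hv i).ofReal
  have hcoeff := fun i k => memLp_mFourierCoeff (hvC i) k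
  have hsq : ∀ i k, Integrable (fun x =>
      ‖UnitAddTorus.mFourierCoeff (fun t => (v i (x, t) : ℂ)) k‖ ^ 2) (volume.restrict Ω) :=
    fun i k => (memLp_two_iff_integrable_sq_norm (hcoeff i k).1).1 (hcoeff i k)
  have hc : ∀ k, MemLp (potentialCoeff D v k) 2 (volume.restrict Ω) := by
    intro k
    by_cases hk : k = 0
    · subst hk
      have : potentialCoeff D v 0 = fun _ => 0 := funext fun x => potentialCoeff_zero v x
      rw [this]
      exact MemLp.zero'
    refine memLp_finsetSum _ fun i _ => ?_
    have hci : Continuous fun x => ((waveInv D k x i : ℝ) : ℂ) *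
        (-(2 * Real.pi : ℝ)⁻¹ * Complex.I) :=
      (Complex.continuous_ofReal.comp ((EuclideanSpace.proj (𝕜 := ℝ) i).continuous.comp
        (hD.continuous_waveInv hk))).mul continuous_const
    obtain ⟨B, hB⟩ := hb.isCompact_closure.exists_bound_of_continuousOn hci.continuousOn
    refine MemLp.of_le_mul (c := B) (hcoeff i k)
      (hci.aestronglyMeasurable.mul (hcoeff i k).1) ?_
    filter_upwards [ae_restrict_mem hΩ.measurableSet] with x hx
    rw [norm_mul]
    exact mul_le_mul_of_nonneg_right (hB x (subset_closure hx)) (norm_nonneg _)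
  have hs : Summable fun k => ∫ x in Ω, ‖potentialCoeff D v k x‖ ^ 2 := by
    have h1 : Summable fun k => (M ^ 2 * d) * ∑ i,
        ∫ x in Ω, ‖UnitAddTorus.mFourierCoeff (fun t => (v i (x, t) : ℂ)) k‖ ^ 2 :=
      (summable_sum fun i _ => summable_integral_norm_mFourierCoeff_sq (hvC i)).mul_left _
    refine h1.of_nonneg_of_le (fun k => integral_nonneg fun x => by positivity) fun k => ?_
    rw [← integral_finsetSum _ fun i _ => hsq i k, ← integral_const_mul]
    refine integral_mono_ae ((memLp_two_iff_integrable_sq_norm (hc k).1).1 (hc k))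
      ((integrable_finsetSum _ fun i _ => hsq i k).const_mul _) ?_
    filter_upwards [ae_restrict_mem hΩ.measurableSet] with x hx
    by_cases hk : k = 0
    · subst hk
      rw [potentialCoeff_zero]
      simp only [norm_zero, ne_eq, OfNat.ofNat_ne_zero, not_false_eq_true, zero_pow]
      positivity
    calc ‖potentialCoeff D v k x‖ ^ 2
        ≤ (M * ∑ i, ‖UnitAddTorus.mFourierCoeff (fun t => (v i (x, t) : ℂ)) k‖) ^ 2 := by
          gcongr
          exact norm_potentialCoeff_le v (hM x hx) hk
      _ ≤ M ^ 2 * (d * ∑ i, ‖UnitAddTorus.mFourierCoeff (fun t => (v i (x, t) : ℂ)) k‖ ^ 2) := by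
          rw [mul_pow]
          gcongr
          simpa using sq_sum_le_card_mul_sum_sq (s := Finset.univ)
            (f := fun i => ‖UnitAddTorus.mFourierCoeff (fun t => (v i (x, t) : ℂ)) k‖)
      _ = _ := by ring
  obtain ⟨U, hU, hUc⟩ := exists_mFourierCoeff_eq hc hs
  let W : E d × UnitAddTorus (Fin d) → E d := fun p => WithLp.toLp 2 fun i => v i p - g₀ p.1 i
  have hW : MemLp W 2 ((volume.restrict Ω).prod (torusMeasure d)) := by
    refine memLp_piLp_iff.2 fun i => (hv i).sub ?_
    have : MemLp (fun x => g₀ x i) 2 (volume.restrict Ω) :=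
      (EuclideanSpace.proj (𝕜 := ℝ) i).comp_memLp' hg₀
    exact this.comp_measurePreserving measurePreserving_fst
  refine ⟨fun x y => (U (x, toTorus ((D x).symm y))).re,
    fun x y => W (x, toTorus ((D x).symm y)), ⟨?_, ?_, ?_, ?_, ?_⟩, fun x y i => rfl⟩
  · exact hD.isL2L2 hΩ (W := fun p => (U p).re) hU.re
  · exact hD.isL2L2 hΩ hW
  · refine ae_of_all _ fun x k y => ?_
    simp only [map_add, ContinuousLinearEquiv.symm_apply_apply, toTorus_add_latticePt]
  · have hcurl' := fun k θ a => ae_all_iff.2 (hcurl k θ a)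
    -- the phases `0` and `π / 2` give the real and imaginary parts of the Fourier coefficients
    have hcurl0 := ae_all_iff.2 fun k => ae_all_iff.2 (hcurl' k 0)
    have hcurl1 := ae_all_iff.2 fun k => ae_all_iff.2 (hcurl' k (Real.pi / 2))
    filter_upwards [ae_memLp_fibre hU, ae_memLp_fibre hW, hUc, hcurl0, hcurl1,
      ae_all_iff.2 hmean, ae_all_iff.2 fun i => ae_memLp_fibre (hv i)] with x hUx hWx hcx h0 h1 hmx hvx
    have hvi : ∀ i, Integrable (fun t => v i (x, t)) (torusMeasure d) := fun i =>
      (hvx i).integrable (by norm_num)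
    refine hasWeakGrad_toTorus (D x) hUx hWx fun b k => ?_
    refine (mFourierCoeff_inner_sub hvi (g₀ x) b k).trans ?_
    rw [hcx k]
    by_cases hk : k = 0
    · subst hk
      rw [potentialCoeff_zero, mul_zero]
      refine Finset.sum_eq_zero fun i _ => ?_
      rw [mFourierCoeff_ofReal (hvi i), neg_zero, UnitAddTorus.mFourier_zero]
      simp only [trig_zero, Real.cos_zero, ContinuousMap.const_apply, mul_one, hmx i,
        Real.cos_pi_div_two, mul_zero, integral_zero]
      simp
    · have hpar : ∀ a b, (waveVec D k x b : ℂ) *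
          UnitAddTorus.mFourierCoeff (fun t => (v a (x, t) : ℂ)) k =
          waveVec D k x a * UnitAddTorus.mFourierCoeff (fun t => (v b (x, t) : ℂ)) k := by
        intro a b
        rw [mFourierCoeff_ofReal (hvi a), mFourierCoeff_ofReal (hvi b), mul_add, mul_add,
          mul_left_comm, mul_left_comm (waveVec D k x a : ℂ) Complex.I]
        norm_cast
        rw [h0 k a b, h1 k a b]
      rw [integral_mFourier (neg_ne_zero.2 hk), ← waveForm_apply, waveForm_eq_sum]
      push_cast
      rw [Finset.mul_sum, Finset.sum_mul, Finset.sum_mul]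
      refine Finset.sum_congr rfl fun i _ => ?_
      rw [← waveVec_mul_potentialCoeff hk hpar i]
      push_cast
      ring
  · filter_upwards [ae_memLp_fibre hU, hUc] with x hUx hcx
    rw [integral_cell D x fun t => (U (x, t)).re]
    have h1 : ∫ t, (U (x, t)).re ∂torusMeasure d = (∫ t, U (x, t) ∂torusMeasure d).re :=
      integral_re (hUx.integrable (by norm_num))
    have h2 := hcx 0
    rw [potentialCoeff_zero, UnitAddTorus.mFourierCoeff] at h2
    simp only [neg_zero, UnitAddTorus.mFourier_zero, ContinuousMap.one_apply, one_smul] at h2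
    have h3 : ∫ t, U (x, t) ∂torusMeasure d = 0 := h2
    rw [h1, h3, Complex.zero_re, smul_zero]

end

/-! ### Locally periodic two-scale convergence -/

section

variable {Ω : Set (E d)} {D : E d → (E d ≃L[ℝ] E d)}

/-- The limit in the definition of locally periodic two-scale convergence, as an integral over
`Ω × 𝕋^d`. -/
lemma integral_average_cell_mul {v : E d × UnitAddTorus (Fin d) → ℝ}
    (hv : MemLp v 2 ((volume.restrict Ω).prod (torusMeasure d))) {ψ : E d → Cper d}
    (hψ : MemLp ψ 2 (volume.restrict Ω)) :
    ∫ x in Ω, ⨍ y in cell D x, v (x, toTorus ((D x).symm y)) * perEval (ψ x) ((D x).symm y) =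
      ∫ p, v p * uncurryTorus ψ p ∂((volume.restrict Ω).prod (torusMeasure d)) := by
  have hi : Integrable (fun p => v p * uncurryTorus ψ p)
      ((volume.restrict Ω).prod (torusMeasure d)) := hv.integrable_mul (memLp_uncurryTorus hψ)
  rw [integral_prod _ hi]
  refine integral_congr_ae (ae_of_all _ fun x => ?_)
  exact average_cell D x fun t => v (x, t) * ψ x t

end

end LTS

open LTS

theorem theorem3p3 (d : ℕ) (hd : 0 < d)
    (Ω : Set (LTS.E d)) (hΩ : LTS.IsLipschitzDomain Ω)
    (D : LTS.E d → (LTS.E d ≃L[ℝ] LTS.E d)) (hD : LTS.IsTransformation Ω D)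
    (r : ℝ) (hr₀ : 0 < r) (hr₁ : r < 1)
    (P : ℝ → LTS.CubeFamily d) (hP : ∀ ε : ℝ, 0 < ε → (P ε).IsPartition Ω (ε ^ r))
    (u : ℝ → LTS.E d → ℝ) (gradu : ℝ → LTS.E d → LTS.E d)
    (hu : ∀ ε : ℝ, 0 < ε → LTS.IsH1 Ω (u ε) (gradu ε))
    (hbdd : ∃ C : ℝ, ∀ ε : ℝ, 0 < ε → LTS.innerH1 Ω (u ε) (gradu ε) (u ε) (gradu ε) ≤ C)
    (u₀ : LTS.E d → ℝ) (gradu₀ : LTS.E d → LTS.E d) (hu₀ : LTS.IsH1 Ω u₀ gradu₀)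
    (hweak : LTS.TendstoWeaklyH1 Ω (𝓝[>] (0 : ℝ)) u gradu u₀ gradu₀) :
    LTS.TendstoLTS Ω D P (𝓝[>] (0 : ℝ)) u (fun x _ => u₀ x) ∧
    ∀ e : ℕ → ℝ, Tendsto e atTop (𝓝[>] (0 : ℝ)) →
      ∃ k : ℕ → ℕ, StrictMono k ∧
        ∃ (u₁ : LTS.E d → LTS.E d → ℝ) (gradu₁ : LTS.E d → LTS.E d → LTS.E d),
          LTS.IsL2H1perModConst Ω D u₁ gradu₁ ∧
          ∀ i : Fin d, LTS.TendstoLTS Ω D P (map (fun j => e (k j)) atTop)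
            (fun ε x => gradu ε x i) (fun x y => gradu₀ x i + gradu₁ x y i) := by
  obtain ⟨C, hC⟩ := hbdd
  have hb := hΩ.isBounded
  have hfin : IsFiniteMeasure (volume.restrict Ω) :=
    isFiniteMeasure_restrict.2 hb.measure_lt_top.ne
  have huC := fun ε hε => (lpNorm_le_of_innerH1_le (hu ε hε) (hC ε hε)).1
  have hgC := fun ε hε => (lpNorm_le_of_innerH1_le (hu ε hε) (hC ε hε)).2
  have hpos : ∀ᶠ ε in 𝓝[>] (0 : ℝ), 0 < ε := self_mem_nhdsWithin
  have hlim := fun {f v} hf hv => hweak.tendsto_integral (hpos.mono hu) hu₀ (f := f) (v := v) hf hv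
  -- weak convergence in `H¹(Ω)` gives weak convergence in `L²(Ω)` of `u` and of each derivative
  have hweak_u : ∀ f : E d → ℝ, MemLp f 2 (volume.restrict Ω) →
      Tendsto (fun ε => ∫ x in Ω, u ε x * f x) (𝓝[>] (0 : ℝ)) (𝓝 (∫ x in Ω, u₀ x * f x)) := by
    intro f hf
    have h := hlim hf (MemLp.zero' (α := E d) (ε := E d))
    simpa only [inner_zero_right, add_zero] using h
  have hgi : ∀ ε, 0 < ε → ∀ i, MemLp (fun x => gradu ε x i) 2 (volume.restrict Ω) := fun ε hε i =>
    (EuclideanSpace.proj (𝕜 := ℝ) i).comp_memLp' (hu ε hε).memLp_grad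
  have hgiC : ∀ ε, 0 < ε → ∀ i, lpNorm (fun x => gradu ε x i) 2 (volume.restrict Ω) ≤ √C := by
    intro ε hε i
    refine le_trans ?_ (hgC ε hε)
    have hgn := (hu ε hε).memLp_grad
    rw [← lpNorm_norm hgn.1]
    exact lpNorm_mono_real hgn.norm fun x => PiLp.norm_apply_le (gradu ε x) i
  have hg₀i : ∀ i, MemLp (fun x => gradu₀ x i) 2 (volume.restrict Ω) := fun i =>
    (EuclideanSpace.proj (𝕜 := ℝ) i).comp_memLp' hu₀.memLp_grad
  have hweak_g : ∀ i, ∀ f : E d → ℝ, MemLp f 2 (volume.restrict Ω) →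
      Tendsto (fun ε => ∫ x in Ω, gradu ε x i * f x) (𝓝[>] (0 : ℝ))
        (𝓝 (∫ x in Ω, gradu₀ x i * f x)) := by
    intro i f hf
    have h := hlim (MemLp.zero' (α := E d) (ε := ℝ))
      (memLp_smul_const hf (EuclideanSpace.single i (1 : ℝ) : E d))
    simpa [inner_smul_right, EuclideanSpace.inner_single_right, mul_comm] using h
  refine ⟨⟨hpos.mono fun ε hε => (hu ε hε).memLp, ?_, fun ψ hψ => ?_⟩, fun e he => ?_⟩
  · exact hD.isL2L2 hΩ.isOpen (W := fun p => u₀ p.1)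
      (hu₀.memLp.comp_measurePreserving measurePreserving_fst)
  · have hu₀' : MemLp (fun p : E d × UnitAddTorus (Fin d) => u₀ p.1) 2
        ((volume.restrict Ω).prod (torusMeasure d)) :=
      hu₀.memLp.comp_measurePreserving measurePreserving_fst
    have hi : Integrable (fun p : E d × UnitAddTorus (Fin d) => u₀ p.1 * uncurryTorus ψ p)
        ((volume.restrict Ω).prod (torusMeasure d)) := hu₀'.integrable_mul (memLp_uncurryTorus hψ)
    have h1 := integral_average_cell_mul (D := D) hu₀' hψ
    have h2 : ∫ p : E d × UnitAddTorus (Fin d), u₀ p.1 * uncurryTorus ψ p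
        ∂((volume.restrict Ω).prod (torusMeasure d)) = ∫ x in Ω, u₀ x * torusMean (ψ x) := by
      rw [integral_prod _ hi]
      refine integral_congr_ae (ae_of_all _ fun x => ?_)
      exact integral_const_mul (u₀ x) fun t => ψ x t
    rw [h1, h2]
    exact tendsto_integral_mul_locPerApprox hΩ.isOpen hb hD hr₀ hr₁ hP hu huC hgC hu₀.memLp
      hweak_u hψ
  -- the pairings with the derivatives converge along a subsequence, to pairings with functions `v i`
  -- in `L²(Ω × 𝕋^d)`
  have : Fact ((2 : ENNReal) ≠ ⊤) := ⟨by simp⟩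
  have hsep : TopologicalSpace.SeparableSpace (Lp (Cper d) 2 (volume.restrict Ω)) :=
    inferInstance
  have hepos : ∀ᶠ j in atTop, 0 < e j := he.eventually hpos
  obtain ⟨k, hk, F, hF⟩ := exists_subseq_isL2Functional_pi (μ := volume.restrict Ω) (V := Cper d)
    (C := √C) (Real.sqrt_nonneg C)
    (T := fun j i ψ => ∫ x in Ω, gradu (e j) x i * locPerApprox D (P (e j)) (e j) ψ x) (by
      filter_upwards [hepos] with j hj i
      exact (hP _ hj).isL2Functional (Real.rpow_pos_of_pos hj r) _ D (hgi _ hj i) (hgiC _ hj i))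
  have hek : Tendsto (fun j => e (k j)) atTop (𝓝[>] (0 : ℝ)) := he.comp hk.tendsto_atTop
  have hv : ∀ i, ∃ v : E d × UnitAddTorus (Fin d) → ℝ, _ := fun i =>
    exists_twoScale_limit hΩ.isOpen hb hD hr₀ hr₁ hP (w := fun ε x => gradu ε x i)
      (fun ε hε => hgi ε hε i) (fun ε hε => hgiC ε hε i) hek (hF i).1 (hF i).2
  choose v hvL hvF using hv
  have hlimv : ∀ i, ∀ ψ, MemLp ψ 2 (volume.restrict Ω) → Tendsto
      (fun j => ∫ x in Ω, gradu (e (k j)) x i * locPerApprox D (P (e (k j))) (e (k j)) ψ x) atTop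
      (𝓝 (∫ p, v i p * uncurryTorus ψ p ∂((volume.restrict Ω).prod (torusMeasure d)))) := by
    intro i ψ hψ
    rw [← hvF i ψ hψ]
    exact (hF i).2 ψ hψ
  -- `v` is curl free in `y` and has mean value `∇u₀`, so `v - ∇u₀` is a gradient in `y`
  obtain ⟨u₁, gradu₁, h₁, hgrad⟩ := exists_corrector hΩ.isOpen hb hD hvL hu₀.memLp_grad
    (fun m θ a b => ae_waveVec_mul_integral_trig hΩ.isOpen hb hD hr₀ hr₁ hP hu hgC hek hvL hlimv
      m θ a b)
    (fun i => ae_integral_torus_eq hΩ.isOpen hb hP hek (hvL i) (hlimv i) (hg₀i i) (hweak_g i))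
  refine ⟨k, hk, u₁, gradu₁, h₁, fun i => ?_⟩
  have hw : (fun x y => gradu₀ x i + gradu₁ x y i) =
      fun x y => v i (x, toTorus ((D x).symm y)) := by
    funext x y
    rw [hgrad, add_sub_cancel]
  rw [hw]
  refine ⟨?_, hD.isL2L2 hΩ.isOpen (hvL i), fun ψ hψ => ?_⟩
  · rw [eventually_map]
    exact (hek.eventually hpos).mono fun j hj => hgi _ hj i
  · rw [tendsto_map'_iff, integral_average_cell_mul (hvL i) hψ]
    exact hlimv i ψ hψ
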